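/- **Improved estimates for the lower derivatives and convergence.** *Setting.* Let $q_1,q_2,q_3>0$ and $A\ge 0$ satisfy $\sum_i q_i=1$ and $\sum_i q_i^2=1-A^2$, and consider the Kasner solution with spatial metric $\mathring g=\sum_i t^{2q_i}(dx^i)^2$ and scalar field $A\ln t$ on $(0,\infty)\times\mathbb T^3$. Put $\mathring K^i_{\ j}=\mathrm{diag}(-q_1,-q_2,-q_3)$, $\hat{\mathring K}{}^i_{\ j}=\mathring K^i_{\ j}+\tfrac13\delta^i_{\ j}$, and $\sigma\ge 0$ with $\sigma^2=\sum_i q_i^2-\tfrac13$. Repeated indices are summed unless they label a fixed component. The Einstein-scalar field equations in constant-mean-curvature transported spatial coordinates, linearized around this solution, are the following system on $(0,1]\times\mathbb T^3$ for a symmetric tensorfield $h_{ij}$ (metric), a tensorfield $K^i_{\ j}$ (time-rescaled mixed second fundamental form), a function $\varphi$ (scalar field) and a function $n$ (lapse): $$K^a_{\ a}=0,\qquad t^2R-2\hat{\mathring K}{}^a_{\ b}K^b_{\ a}-2At\,\partial_t\varphi+2A^2n=0,$$ $$\partial_aK^a_{\ i}=-A\partial_i\varphi-\Gamma_{a\ b}^{\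 a}\hat{\mathring K}{}^b_{\ i}+\Gamma_{a\ i}^{\ b}\hat{\mathring K}{}^a_{\ b},\qquad \mathring g^{ab}\partial_aK^i_{\ b}=-A\mathring g^{ia}\partial_a\varphi-\mathring g^{ab}\Gamma_{a\ c}^{\ i}\hat{\mathring K}{}^c_{\ b}+\mathring g^{ab}\Gamma_{a\ b}^{\ c}\hat{\mathring K}{}^i_{\ c},$$ $$2At\,\partial_t\varphi+2\hat{\mathring K}{}^a_{\ b}K^b_{\ a}=t^2\mathring g^{ab}\partial_a\partial_bn+(2A^2-1)n,\qquad t^2\mathring g^{ab}\partial_a\partial_bn-n=t^2R,$$ $$\partial_th_{ij}=-2t^{-1}\mathring K^a_{\ j}h_{ia}-2t^{-1}\mathring g_{ia}K^a_{\ j}-2t^{-1}\mathring g_{ia}\mathring K^a_{\ j}n,\qquad \partial_tK^i_{\ j}=-t\mathring g^{ia}\partial_a\partial_jn-t^{-1}\mathring K^i_{\ j}n+t\,\mathrm{Ric}^i_{\ j},$$ $$-\partial_t(t\,\partial_t\varphi)+t\,\mathring g^{ab}\partial_a\partial_b\varphi=-A\,\partial_tn+At^{-1}n,$$ where $$\Gamma_{a\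 b}^{\ i}=\tfrac12\mathring g^{ic}(\partial_ah_{cb}+\partial_bh_{ac}-\partial_ch_{ab}),\qquad R=-\tfrac12\mathring g^{ab}\mathring g^{ef}\partial_e\partial_fh_{ab}+\mathring g^{ef}\partial_a\Gamma_{e\ f}^{\ a},$$ $$\mathrm{Ric}^i_{\ j}=-\tfrac12\mathring g^{ia}\mathring g^{ef}\partial_e\partial_fh_{ja}+\tfrac12\mathring g^{ef}\partial_j\Gamma_{e\ f}^{\ i}+\tfrac12\mathring g^{ia}\mathring g_{jb}\mathring g^{ef}\partial_a\Gamma_{e\ f}^{\ b}.$$ A solution consists of functions that are integrable on $\mathbb T^3$ at each time, spatial derivatives being taken in the sense of distributions and time derivatives after pairing with smooth functions on $\mathbb T^3$. For a tensorfield $T$ on $\mathbb T^3$ let $\|T\|_{H^M}=\sum_{|\vec I|\le M}\|\,|\partial_{\vec I}T|\,\|_{L^2}$ with $|\cdot|$ the Euclidean norm of the coordinate components, $\|\cdot\|_{L^2}=\|\cdot\|_{H^0}$, let $\partial$ denote the spatial coordinate gradient, and set $$\mathcal H_M(t)=\|K\|_{H^M}+\|\partial h\|_{H^M}+\|t\,\partial_t\varphi\|_{H^M}+t^{2/3}\|\partial\varphi\|_{H^M}+\sum_{p=0}^2t^{2p/3}\|n\|_{H^{M+p}}.$$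 Let $L_\sigma(t)=1/\sigma$ if $\sigma>0$ and $L_0(t)=1+|\ln t|$. *Statement.* There exist constants $C,c,\sigma_0>0$ such that for every integer $N\ge2$, every Kasner background as above with $0\le\sigma\le\sigma_0$, and every solution of the linearized equations with $\|h\|_{L^2}(1)<\infty$ and $\mathcal H_N(1)<\infty$, the following hold for all $t\in(0,1]$: $$\|\partial_tK\|_{H^{N-1}}\le C\mathcal H_N(1)t^{-1/3-c\sigma},\qquad \|K\|_{H^{N-1}}\le C\mathcal H_N(1),$$ $$\|h\|_{L^2}\le C\{\|h\|_{L^2}(1)+L_\sigma(t)\mathcal H_N(1)\}t^{2/3-c\sigma},\qquad \|\partial h\|_{H^{N-1}}\le C L_\sigma(t)\mathcal H_N(1)t^{2/3-c\sigma},$$ $$\|\partial_t(t\,\partial_t\varphi-An)\|_{H^{N-1}}\le C\mathcal H_N(1)t^{-1/3-c\sigma},\qquad \|t\,\partial_t\varphi\|_{H^{N-1}}\le C\mathcal H_N(1),\qquad \|\partial\varphi\|_{H^{N-2}}\le C\mathcal H_N(1)\{1+|\ln t|\},$$ $$\|n\|_{H^N}\le C\mathcal H_N(1)t^{-c\sigma},\qquad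 \|n\|_{H^{N-1}}\le C\mathcal H_N(1)t^{2/3-c\sigma},\qquad \|n\|_{H^{N-2}}\le C L_\sigma(t)\mathcal H_N(1)t^{4/3-c\sigma}.$$ Moreover there exist a symmetric tensorfield $(h_{Bang})_{ij}\in H^{N-1}(\mathbb T^3)$, a tensorfield $(K_{Bang})^i_{\ j}\in H^{N-1}(\mathbb T^3)$ with $(K_{Bang})^a_{\ a}\equiv0$, and a function $\Psi_{Bang}\in H^{N-1}(\mathbb T^3)$ such that for all $t\in(0,1]$ and all $i,j$ (no summation) $$\Big\|t^{-2q_j}h_{ij}+2\ln(t)\,(K_{Bang})^i_{\ j}-(h_{Bang})_{ij}\Big\|_{H^{N-1}}\le C\mathcal H_N(1)t^{2/3-c\sigma}\quad\text{if }q_i=q_j,$$ $$\Big\|t^{-2q_j}h_{ij}+\frac{t^{2(q_i-q_j)}-1}{q_i-q_j}(K_{Bang})^i_{\ j}-(h_{Bang})_{ij}\Big\|_{H^{N-1}}\le C\mathcal H_N(1)t^{2/3-c\sigma}\quad\text{if }q_i\ne q_j,$$ $$\|K-K_{Bang}\|_{H^{N-1}}\le C\mathcal H_N(1)t^{2/3-c\sigma},\qquad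 \|t\,\partial_t\varphi-\Psi_{Bang}\|_{H^{N-1}}\le C\mathcal H_N(1)t^{2/3-c\sigma},\qquad \|\partial\varphi-\ln(t)\,\partial\Psi_{Bang}\|_{H^{N-2}}\le C\mathcal H_N(1),$$ and $$\|h_{Bang}-h(1)\|_{H^{N-1}}\le C\mathcal H_N(1),\qquad \|K_{Bang}-K(1)\|_{H^{N-1}}\le C\mathcal H_N(1),\qquad \|\Psi_{Bang}-\partial_t\varphi(1)\|_{H^{N-1}}\le C\mathcal H_N(1).$$ -/

import Mathlib

open MeasureTheory Set
open scoped ENNReal ContDiff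

noncomputable section

namespace KasnerLin

/-! ### The torus, test functions, weak derivatives -/

/-- The torus `𝕋³`, with its Lebesgue measure `volume`. -/
abbrev T3 : Type := UnitAddTorus (Fin 3)

/-- The coordinate vectorfield `∂_a` acting on functions on the torus. -/
def pd (a : Fin 3) (ψ : T3 → ℝ) : T3 → ℝ :=
  fun x => deriv (fun s : ℝ => ψ (x + Pi.single a (s : UnitAddCircle))) 0

/-- `∂_I = ∂_1^{I_1} ∂_2^{I_2} ∂_3^{I_3}`. -/
def pdMulti (I : Fin 3 → ℕ) (ψ : T3 → ℝ) : T3 → ℝ :=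
  (pd 0)^[I 0] ((pd 1)^[I 1] ((pd 2)^[I 2] ψ))

/-- Smooth functions on the torus (smoothness of the periodic lift to `ℝ³`). -/
def IsTest (ψ : T3 → ℝ) : Prop :=
  ContDiff ℝ ∞ (fun x : Fin 3 → ℝ => ψ (fun i => (x i : UnitAddCircle)))

/-- `g` is the weak derivative `∂_I f`. -/
def HasWeakDeriv (I : Fin 3 → ℕ) (f g : T3 → ℝ) : Prop :=
  Integrable f ∧ Integrable g ∧
    ∀ ψ : T3 → ℝ, IsTest ψ →
      ∫ x, f x * pdMulti I ψ x = (-1) ^ (∑ i, I i) * ∫ x, g x * ψ x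

/-- The spatial multi-indices of order at most `M`. -/
def multiIndices (M : ℕ) : Finset (Fin 3 → ℕ) :=
  (Fintype.piFinset fun _ => Finset.range (M + 1)).filter fun I => ∑ i, I i ≤ M

/-! ### Sobolev norms

A tensorfield is a family `T : ι → T3 → ℝ` of components. All norms take values in `[0, ∞]`;
they equal `∞` if one of the weak derivatives needed does not exist. Weak derivatives are unique
almost everywhere, so the infima below run over a single class of almost everywhere equal
functions. -/

/-- `‖T‖_{H^M_Frame} = ∑_{|I| ≤ M} ‖ |∂_I T|_Frame ‖_{L²}`. -/
def frameNorm {ι : Type} [Fintype ι] (M : ℕ) (T : ι → T3 → ℝ) : ℝ≥0∞ :=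
  ∑ I ∈ multiIndices M,
    ⨅ (G : ι → T3 → ℝ) (_ : ∀ c, HasWeakDeriv I (T c) (G c)),
      eLpNorm (fun x => Real.sqrt (∑ c, (G c x) ^ 2)) 2 volume

/-- `‖f‖_{H^M}` for a scalar function. -/
def scalarNorm (M : ℕ) (f : T3 → ℝ) : ℝ≥0∞ := frameNorm M (fun _ : Unit => f)

/-- `‖∂T‖_{H^M_Frame}`, where `∂T` is the weak spatial coordinate gradient of `T`. -/
def gradNorm {ι : Type} [Fintype ι] (M : ℕ) (T : ι → T3 → ℝ) : ℝ≥0∞ :=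
  ⨅ (G : Fin 3 × ι → T3 → ℝ) (_ : ∀ a c, HasWeakDeriv (Pi.single a 1) (T c) (G (a, c))),
    frameNorm M G

/-- `‖∂f‖_{H^M_Frame}` for a scalar function. -/
def scalarGradNorm (M : ℕ) (f : T3 → ℝ) : ℝ≥0∞ := gradNorm M (fun _ : Unit => f)

/-! ### Distributions on the torus and their time derivatives -/

/-- Functionals on test functions. Only their values on smooth functions matter. -/
abbrev Distr : Type := (T3 → ℝ) → ℝ

/-- The distribution `ψ ↦ ∫ f ψ` of an integrable function. -/
def toDistr (f : T3 → ℝ) : Distr := fun ψ => ∫ x, f x * ψ x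

/-- The distributional derivative `∂_a u`. -/
def D (a : Fin 3) (u : Distr) : Distr := fun ψ => -u (pd a ψ)

/-- Equality of distributions. -/
def EqDistr (u v : Distr) : Prop := ∀ ψ : T3 → ℝ, IsTest ψ → u ψ = v ψ

/-- The curve of distributions `u`, defined on `(0,1]`, has time derivative `v` at time `t`
(one-sided at `t = 1`). -/
def HasTimeDeriv (u : ℝ → Distr) (v : Distr) (t : ℝ) : Prop :=
  ∀ ψ : T3 → ℝ, IsTest ψ → HasDerivWithinAt (fun s => u s ψ) (v ψ) (Ioc 0 1) t

/-- `‖∂_t T‖_{H^M_Frame}(t)`; it equals `∞` if the time derivative is not a function. -/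
def timeDerivNorm {ι : Type} [Fintype ι] (M : ℕ) (T : ℝ → ι → T3 → ℝ) (t : ℝ) : ℝ≥0∞ :=
  ⨅ (V : ι → T3 → ℝ)
    (_ : ∀ c, Integrable (V c) ∧
      HasTimeDeriv (fun s => toDistr (T s c)) (toDistr (V c)) t),
    frameNorm M V

/-! ### The Kasner background -/

/-- Kasner exponents `q_1, q_2, q_3 > 0` and the scalar field parameter `A ≥ 0`. -/
structure Kasner where
  q : Fin 3 → ℝ
  A : ℝ
  q_pos : ∀ i, 0 < q i
  A_nonneg : 0 ≤ A
  sum_q : ∑ i, q i = 1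
  sum_q_sq : ∑ i, q i ^ 2 = 1 - A ^ 2

namespace Kasner

variable (B : Kasner)

/-- The parameter `σ ≥ 0`, `σ² = ∑ q_i² - 1/3`: the size of the trace-free part of the
time-rescaled second fundamental form. -/
def sigma : ℝ := Real.sqrt (∑ i, B.q i ^ 2 - 1 / 3)

/-- The background spatial metric `∑ t^{2 q_i} (dx^i)²`. -/
def g (t : ℝ) (i j : Fin 3) : ℝ := if i = j then t ^ (2 * B.q i) else 0

/-- The inverse background spatial metric. -/
def ginv (t : ℝ) (i j : Fin 3) : ℝ := if i = j then t ^ (-(2 * B.q i)) else 0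

/-- The time-rescaled mixed second fundamental form of the background, `diag(-q_1,-q_2,-q_3)`;
see `bigK_eq`. -/
def bigK (i j : Fin 3) : ℝ := if i = j then -B.q i else 0

/-- Its trace-free part. -/
def hatK (i j : Fin 3) : ℝ := B.bigK i j + if i = j then 1 / 3 else 0

/-- `t k^i_j`, with `k^i_j = -(1/2) g^{ia} ∂_t g_{aj}`, is the constant matrix `bigK`. -/
theorem bigK_eq (t : ℝ) (ht : 0 < t) (i j : Fin 3) :
    t * (-(1 / 2) * ∑ a, B.ginv t i a * deriv (fun s => B.g s a j) t) = B.bigK i j := by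
  have h1 : ∑ a, B.ginv t i a * deriv (fun s => B.g s a j) t
      = t ^ (-(2 * B.q i)) * deriv (fun s => B.g s i j) t := by
    simp [ginv]
  rw [h1]
  by_cases hij : i = j
  · subst hij
    simp only [g, bigK, if_true]
    rw [Real.deriv_rpow_const, Real.rpow_sub_one ht.ne', Real.rpow_neg ht.le]
    have := (Real.rpow_pos_of_pos ht (2 * B.q i)).ne'
    field_simp
  · simp [g, bigK, hij]

end Kasner

/-! ### The linearized Einstein-scalar field equations -/

/-- The linearized variables on `(0,1] × 𝕋³`: the metric perturbation `h_{ij}`, the perturbation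
`K^i_j` of the time-rescaled mixed second fundamental form, the scalar field perturbation `φ`, its
time derivative `φ' = ∂_t φ`, and the lapse perturbation `n`. -/
structure Fields where
  h : ℝ → Fin 3 × Fin 3 → T3 → ℝ
  K : ℝ → Fin 3 × Fin 3 → T3 → ℝ
  φ : ℝ → T3 → ℝ
  dtφ : ℝ → T3 → ℝ
  n : ℝ → T3 → ℝ

section Linearized

variable (B : Kasner) (F : Fields)

/-- The linearized Christoffel symbols
`Γ_a^i_b = (1/2) g^{ic} (∂_a h_{cb} + ∂_b h_{ac} - ∂_c h_{ab})`. -/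
def christ (t : ℝ) (a i b : Fin 3) : Distr :=
  (1 / 2 : ℝ) • ∑ c, B.ginv t i c •
    (D a (toDistr (F.h t (c, b))) + D b (toDistr (F.h t (a, c))) - D c (toDistr (F.h t (a, b))))

/-- The linearized scalar curvature
`-(1/2) g^{ab} g^{ef} ∂_e ∂_f h_{ab} + g^{ef} ∂_a Γ_e^a_f`. -/
def scalCurv (t : ℝ) : Distr :=
  -((1 / 2 : ℝ) • ∑ a, ∑ b, ∑ e, ∑ f,
      (B.ginv t a b * B.ginv t e f) • D e (D f (toDistr (F.h t (a, b)))))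
    + ∑ a, ∑ e, ∑ f, B.ginv t e f • D a (christ B F t e a f)

/-- The linearized mixed Ricci curvature
`-(1/2) g^{ia} g^{ef} ∂_e ∂_f h_{ja} + (1/2) g^{ef} ∂_j Γ_e^i_f
  + (1/2) g^{ia} g_{jb} g^{ef} ∂_a Γ_e^b_f`. -/
def ric (t : ℝ) (i j : Fin 3) : Distr :=
  -((1 / 2 : ℝ) • ∑ a, ∑ e, ∑ f,
      (B.ginv t i a * B.ginv t e f) • D e (D f (toDistr (F.h t (j, a)))))
    + (1 / 2 : ℝ) • (∑ e, ∑ f, B.ginv t e f • D j (christ B F t e i f))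
    + (1 / 2 : ℝ) • (∑ a, ∑ b, ∑ e, ∑ f,
        (B.ginv t i a * B.g t j b * B.ginv t e f) • D a (christ B F t e b f))

/-- The background Laplacian `g^{ab} ∂_a ∂_b u`. -/
def lap (t : ℝ) (u : Distr) : Distr := ∑ a, ∑ b, B.ginv t a b • D a (D b u)

/-- `K̂^a_b K^b_a`, the contraction of the trace-free background form with `K`. -/
def hatKK (t : ℝ) : Distr := ∑ a, ∑ b, B.hatK a b • toDistr (F.K t (b, a))

/-- `F` solves the Einstein-scalar field equations in CMC-transported spatial coordinates,
linearized around the Kasner solution `B`, on `(0,1] × 𝕋³`. At each time the unknowns are integrable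
functions on the torus; spatial derivatives are taken in the sense of distributions, time
derivatives after pairing with a test function. -/
structure IsLinearizedSolution : Prop where
  int_h : ∀ t ∈ Ioc (0 : ℝ) 1, ∀ c, Integrable (F.h t c)
  int_K : ∀ t ∈ Ioc (0 : ℝ) 1, ∀ c, Integrable (F.K t c)
  int_φ : ∀ t ∈ Ioc (0 : ℝ) 1, Integrable (F.φ t)
  int_dtφ : ∀ t ∈ Ioc (0 : ℝ) 1, Integrable (F.dtφ t)
  int_n : ∀ t ∈ Ioc (0 : ℝ) 1, Integrable (F.n t)
  /-- `h` is a symmetric tensorfield. -/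
  symm_h : ∀ t ∈ Ioc (0 : ℝ) 1, ∀ i j, F.h t (i, j) =ᵐ[volume] F.h t (j, i)
  /-- `dtφ = ∂_t φ`. -/
  dt_φ : ∀ t ∈ Ioc (0 : ℝ) 1, HasTimeDeriv (fun s => toDistr (F.φ s)) (toDistr (F.dtφ t)) t
  /-- The constant mean curvature condition `K^a_a = 0`. -/
  cmc : ∀ t ∈ Ioc (0 : ℝ) 1, ∀ᵐ x, ∑ a, F.K t (a, a) x = 0
  /-- The Hamiltonian constraint. -/
  hamiltonian : ∀ t ∈ Ioc (0 : ℝ) 1,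
    EqDistr (t ^ 2 • scalCurv B F t - (2 : ℝ) • hatKK B F t
      - (2 * B.A * t) • toDistr (F.dtφ t) + (2 * B.A ^ 2) • toDistr (F.n t)) 0
  /-- The momentum constraint. -/
  momentum : ∀ t ∈ Ioc (0 : ℝ) 1, ∀ i,
    EqDistr (∑ a, D a (toDistr (F.K t (a, i))))
      (-(B.A • D i (toDistr (F.φ t)))
        - (∑ a, ∑ b, B.hatK b i • christ B F t a a b)
        + ∑ a, ∑ b, B.hatK a b • christ B F t a b i)
  /-- The momentum constraint with the free index raised. -/
  momentum' : ∀ t ∈ Ioc (0 : ℝ) 1, ∀ i,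
    EqDistr (∑ a, ∑ b, B.ginv t a b • D a (toDistr (F.K t (i, b))))
      (-(B.A • ∑ a, B.ginv t i a • D a (toDistr (F.φ t)))
        - (∑ a, ∑ b, ∑ c, (B.ginv t a b * B.hatK c b) • christ B F t a i c)
        + ∑ a, ∑ b, ∑ c, (B.ginv t a b * B.hatK i c) • christ B F t a c b)
  /-- The lapse equation, first form. -/
  lapse : ∀ t ∈ Ioc (0 : ℝ) 1,
    EqDistr ((2 * B.A * t) • toDistr (F.dtφ t) + (2 : ℝ) • hatKK B F t)
      (t ^ 2 • lap B t (toDistr (F.n t)) + (2 * B.A ^ 2 - 1) • toDistr (F.n t))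
  /-- The lapse equation, second form. -/
  lapse' : ∀ t ∈ Ioc (0 : ℝ) 1,
    EqDistr (t ^ 2 • lap B t (toDistr (F.n t)) - toDistr (F.n t)) (t ^ 2 • scalCurv B F t)
  /-- The evolution equation for `h`. -/
  evol_h : ∀ t ∈ Ioc (0 : ℝ) 1, ∀ i j,
    HasTimeDeriv (fun s => toDistr (F.h s (i, j)))
      (-((2 * t⁻¹) • ∑ a, B.bigK a j • toDistr (F.h t (i, a)))
        - (2 * t⁻¹) • (∑ a, B.g t i a • toDistr (F.K t (a, j)))
        - (2 * t⁻¹) • ∑ a, (B.g t i a * B.bigK a j) • toDistr (F.n t)) t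
  /-- The evolution equation for `K`. -/
  evol_K : ∀ t ∈ Ioc (0 : ℝ) 1, ∀ i j,
    HasTimeDeriv (fun s => toDistr (F.K s (i, j)))
      (-(t • ∑ a, B.ginv t i a • D a (D j (toDistr (F.n t))))
        - (t⁻¹ * B.bigK i j) • toDistr (F.n t)
        + t • ric B F t i j) t
  /-- The wave equation `-∂_t (t ∂_t φ) + t g^{ab} ∂_a ∂_b φ = -A ∂_t n + A t⁻¹ n`, solved for
  `∂_t (t ∂_t φ - A n)`. -/
  wave : ∀ t ∈ Ioc (0 : ℝ) 1,
    HasTimeDeriv (fun s => s • toDistr (F.dtφ s) - B.A • toDistr (F.n s))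
      (t • lap B t (toDistr (F.φ t)) - (B.A * t⁻¹) • toDistr (F.n t)) t

end Linearized

/-- The solution norm
`‖K‖_{H^M} + ‖∂h‖_{H^M} + ‖t ∂_t φ‖_{H^M} + t^{2/3} ‖∂φ‖_{H^M} + ∑_{p=0}^2 t^{2p/3} ‖n‖_{H^{M+p}}`
at time `t`. -/
def highNorm (F : Fields) (M : ℕ) (t : ℝ) : ℝ≥0∞ :=
  frameNorm M (F.K t) + gradNorm M (F.h t) + scalarNorm M (fun x => t * F.dtφ t x)
    + ENNReal.ofReal (t ^ (2 / 3 : ℝ)) * scalarGradNorm M (F.φ t)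
    + ∑ p ∈ Finset.range 3,
        ENNReal.ofReal (t ^ ((2 / 3 : ℝ) * (p : ℝ))) * scalarNorm (M + p) (F.n t)

/-- The factor `1/σ` for `σ > 0`, which becomes `1 + |ln t|` for `σ = 0`. -/
def sigmaLoss (σ t : ℝ) : ℝ := if σ = 0 then 1 + |Real.log t| else 1 / σ

/-- The coefficient `2 ∫_1^t s^{-1+2(q_i-q_j)} ds` of the correction term in the convergence of
the metric components. -/
def metricCorrection (B : Kasner) (t : ℝ) (i j : Fin 3) : ℝ :=
  if B.q i = B.q j then 2 * Real.log t
  else (t ^ (2 * (B.q i - B.q j)) - 1) / (B.q i - B.q j)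

end KasnerLin

end

open MeasureTheory Set
open scoped ENNReal ContDiff

noncomputable section

namespace KasnerLin
open Filter Topology

/-! The coefficients of the linearized system depend on t alone, so testing against the functions
cos(2πk·x) and sin(2πk·x) decouples it into one constrained system of ordinary differential
equations per index, `Mode.IsSol`. Every norm in the theorem is a sum of weighted ℓ² norms of
Fourier coefficients (`frameNorm_eq`, `gradNorm_eq`). It therefore suffices to bound each mode by
its size at t = 1, uniformly in the frequency ξ, with a factor (1 + |ξ|)^k when k derivatives are
given up. These bounds do not involve N, and neither do C and c.

Energy. In the orthonormal frame of the background put E = |k|² + ¼ t²|η|²|χ|² + 2000 (g² +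
t²|η|²φ²), with g = t∂_tφ - An. The constraints remove every contraction of k with the frequency
from t∂_tE and leave a main term plus an error (`denergy_eq`). The main term is nonnegative
(`mainTerm_nonneg`): t²|η|² grows like t^(4/3), which gives positive squares of χ and φ, and the
lapse equation turns the coupling -2Agn into a positive square of n. Every part of the error has a
factor from the trace-free background form, so it is O(σ)E (`abs_errTerm_le`). Hence E(t) ≤
t^(-10⁶σ) E(1): `Mode.IsSol.energy_le`.

Decay below top order. Since t|η| ≤ t^(2/3-σ)|ξ|, a derivative can be exchanged for a power t^(2/3).
In coordinate components t∂_tK contains no undifferentiated K: it consists of the lapse and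
curvature, and is thus O(t^(2/3)) after giving up one derivative. The same holds for t∂_t(t∂_tφ -
An), and the second form of the lapse equation makes n small as well. So K and t∂_tφ converge. The
rescaled metric t^(-2q_j)h_ij has logarithmic derivative O(t^(-cσ)); integrating it costs 1/σ, or
|ln t| if σ = 0. Reinserting this bound into the lapse equation gives the rate t^(4/3) for n.
Subtracting the integral of the limit of K from the rescaled metric, and ln t times the limit of
t∂_tφ from φ, leaves integrable derivatives (`Mode.IsSol.nonempty_asymptotics`).

Return to functions. The fields are only assumed integrable, so uniqueness of Fourier coefficients
is needed in L¹ (`ae_eq_zero_of_forall_fourier`). Combined with L² synthesis it turns square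
summable coefficients into L² functions, which produces the weak derivatives, the time derivatives
and the limiting fields. -/

/-- The data of a single Fourier mode in the orthonormal frame of the background at one time:
`χ` is the metric perturbation, `k` the second fundamental form, `g = t ∂_t φ - A n`, `x = t²`. -/
structure FrameState where
  χ : Fin 3 → Fin 3 → ℝ
  k : Fin 3 → Fin 3 → ℝ
  η : Fin 3 → ℝ
  κ : Fin 3 → ℝ
  A : ℝ
  n : ℝ
  φ : ℝ
  g : ℝ
  x : ℝ

/-! ### Energy identity and energy inequality at a fixed time. -/

namespace FrameState

variable (s : FrameState)

/-- The squared length of the frequency. -/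
def freq : ℝ := ∑ i, s.η i ^ 2
/-- The trace of the metric perturbation. -/
def trχ : ℝ := ∑ a, s.χ a a
/-- The metric perturbation contracted with the trace-free background form. -/
def trκχ : ℝ := ∑ a, s.κ a * s.χ a a
/-- The metric perturbation contracted with the frequency. -/
def div (i : Fin 3) : ℝ := ∑ e, s.η e * s.χ i e
/-- `K̂^a_b K^b_a`. -/
def trκk : ℝ := ∑ a, s.κ a * s.k a a
/-- The squared norm of the metric perturbation. -/
def normχ : ℝ := ∑ i, ∑ j, s.χ i j ^ 2
/-- The squared norm of the second fundamental form. -/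
def normk : ℝ := ∑ i, ∑ j, s.k i j ^ 2
/-- The trace-free background form evaluated on the frequency. -/
def κη : ℝ := ∑ i, s.κ i * s.η i ^ 2

/-- The logarithmic time derivative of `k`. -/
def dk (i j : Fin 3) : ℝ :=
  (s.κ j - s.κ i) * s.k i j + s.x * (s.η i * s.η j * s.n
    + 1 / 2 * (s.freq * s.χ i j - s.η j * s.div i - s.η i * s.div j + s.η i * s.η j * s.trχ))
    + if i = j then (1 / 3 - s.κ i) * s.n else 0

/-- The logarithmic time derivative of `χ`. -/
def dχ (i j : Fin 3) : ℝ :=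
  -(s.k i j + s.k j i) + if i = j then 2 * (1 / 3 - s.κ i) * s.n else 0

/-- The logarithmic time derivative of `x * freq`. -/
def dxfreq : ℝ := s.x * (4 / 3 * s.freq + 2 * s.κη)

/-- The energy of a Fourier mode. -/
def energy : ℝ := s.normk + 1 / 4 * (s.x * s.freq) * s.normχ
  + 2000 * (s.g ^ 2 + s.x * s.freq * s.φ ^ 2)

/-- The logarithmic time derivative of the energy. -/
def denergy : ℝ := (∑ i, ∑ j, 2 * s.k i j * s.dk i j)
  + 1 / 4 * (s.dxfreq * s.normχ + s.x * s.freq * ∑ i, ∑ j, 2 * s.χ i j * s.dχ i j)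
  + 2000 * (2 * s.g * (-(s.x * s.freq * s.φ) - s.A * s.n) + s.dxfreq * s.φ ^ 2
      + 2 * (s.x * s.freq) * s.φ * (s.g + s.A * s.n))

/-- The algebraic relations satisfied by a Fourier mode of a solution. -/
structure Constraints : Prop where
  symm : ∀ i j, s.χ i j = s.χ j i
  tr_k : ∑ a, s.k a a = 0
  mom : ∀ i, ∑ a, s.η a * s.k a i
    = -(s.A * s.η i * s.φ) + 1 / 2 * s.η i * (s.trκχ - s.κ i * s.trχ)
  mom' : ∀ i, ∑ a, s.η a * s.k i a
    = -(s.A * s.η i * s.φ) + ∑ a, (s.κ i - s.κ a) * s.η a * s.χ i a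
      - 1 / 2 * s.η i * (s.κ i * s.trχ - s.trκχ)
  lapse : (1 + s.x * s.freq) * s.n = -(2 * s.A * s.g) - 2 * s.trκk

/-- The part of the energy identity that survives on an isotropic background. -/
def mainTerm : ℝ :=
  s.x * s.freq * (1 / 3 * s.normχ + 1 / 3 * s.n * s.trχ - 2 * s.A * s.n * s.φ
    - s.A * s.φ * s.trχ) + 2 * s.A * s.φ * s.x * (∑ i, s.η i * s.div i)
  + 2000 * (s.n ^ 2 + s.x * s.freq * (s.n ^ 2 + 2 * s.A * s.φ * s.n + 4 / 3 * s.φ ^ 2))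

/-- The part of the energy identity caused by the anisotropy of the background. -/
def errTerm : ℝ :=
  (∑ i, ∑ j, 2 * (s.κ j - s.κ i) * s.k i j ^ 2)
  - s.x * s.n * s.κη * s.trχ
  - s.x * (∑ i, s.div i * (∑ a, (s.κ i - s.κ a) * s.η a * s.χ i a
      - 1 / 2 * s.η i * (s.κ i * s.trχ - s.trκχ)))
  - s.x * (∑ i, s.div i * (1 / 2 * s.η i * (s.trκχ - s.κ i * s.trχ)))
  + 1 / 2 * s.x * s.trχ * (s.freq * s.trκχ - s.κη * s.trχ)
  - 2 * (s.n * s.trκk) + 1 / 2 * (s.x * s.κη * s.normχ)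
  + 2000 * (2 * (s.n * s.trκk) + 2 * (s.x * s.κη * s.φ ^ 2))

variable {s}

-- All constraints are used: trace, lapse and both forms of the momentum constraint. They eliminate
-- the terms that are linear in k and carry derivatives, which have no sign.
set_option maxHeartbeats 1000000 in
theorem denergy_eq (hs : s.Constraints) : s.denergy = s.mainTerm + s.errTerm := by
  have h10 := hs.symm 1 0
  have h20 := hs.symm 2 0
  have h21 := hs.symm 2 1
  have htr := hs.tr_k
  have hl := hs.lapse
  have m0 := hs.mom 0
  have m1 := hs.mom 1
  have m2 := hs.mom 2
  have m0' := hs.mom' 0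
  have m1' := hs.mom' 1
  have m2' := hs.mom' 2
  -- The products of k with freq·χ coming from `normk` and from `normχ` cancel by the symmetry of χ.
  -- Apart from terms with a factor κ, k survives only in its trace and in its contractions with η.
  have key : s.denergy = (∑ i, ∑ j, 2 * (s.κ j - s.κ i) * s.k i j ^ 2)
      + s.x * (2 * s.n + s.trχ) * (∑ i, s.η i * ∑ a, s.η a * s.k a i)
      - s.x * (∑ i, s.div i * ∑ a, s.η a * s.k i a)
      - s.x * (∑ i, s.div i * ∑ a, s.η a * s.k a i)
      + 2 / 3 * s.n * (∑ a, s.k a a) - 2 * s.n * s.trκk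
      + 1 / 4 * s.dxfreq * s.normχ + s.x * s.freq * s.n * (1 / 3 * s.trχ - s.trκχ)
      + 2000 * (-(2 * s.A * s.g) * s.n + s.dxfreq * s.φ ^ 2
        + 2 * s.A * (s.x * s.freq) * s.φ * s.n) := by
    simp only [denergy, dk, dχ, trκk, trχ, trκχ, Fin.sum_univ_three, Fin.isValue, if_true,
      Fin.reduceEq, if_false, h10, h20, h21]
    ring
  -- This replacement creates the positive terms in n² of `mainTerm`.
  have hl' : -(2 * s.A * s.g) = (1 + s.x * s.freq) * s.n + 2 * s.trκk := by linarith
  rw [key, htr, hl']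
  simp only [hs.mom, hs.mom']
  simp only [mainTerm, errTerm, dxfreq, κη, freq, Fin.sum_univ_three]
  ring

theorem abs_sum_three_le {f : Fin 3 → ℝ} {b : ℝ} (h : ∀ i, |f i| ≤ b) : |∑ i, f i| ≤ 3 * b := by
  have := Finset.sum_le_card_nsmul Finset.univ (fun i => |f i|) b fun i _ => h i
  simp only [Finset.card_univ, Fintype.card_fin, nsmul_eq_mul, Nat.cast_ofNat] at this
  exact (Finset.abs_sum_le_sum_abs _ _).trans this

variable (s)

theorem freq_nonneg : 0 ≤ s.freq := Finset.sum_nonneg fun _ _ => sq_nonneg _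
theorem normχ_nonneg : 0 ≤ s.normχ :=
  Finset.sum_nonneg fun _ _ => Finset.sum_nonneg fun _ _ => sq_nonneg _
theorem normk_nonneg : 0 ≤ s.normk :=
  Finset.sum_nonneg fun _ _ => Finset.sum_nonneg fun _ _ => sq_nonneg _

theorem abs_η_le (i : Fin 3) : |s.η i| ≤ √s.freq :=
  Real.abs_le_sqrt (Finset.single_le_sum (f := fun i => s.η i ^ 2)
    (fun _ _ => sq_nonneg _) (Finset.mem_univ i))

theorem sq_le_sum_sq (f : Fin 3 → Fin 3 → ℝ) (i j : Fin 3) :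
    f i j ^ 2 ≤ ∑ i, ∑ j, f i j ^ 2 :=
  (Finset.single_le_sum (f := fun j => f i j ^ 2)
    (fun _ _ => sq_nonneg _) (Finset.mem_univ j)).trans
  (Finset.single_le_sum (f := fun i => ∑ j, f i j ^ 2)
    (fun _ _ => Finset.sum_nonneg fun _ _ => sq_nonneg _) (Finset.mem_univ i))

theorem abs_χ_le (i j : Fin 3) : |s.χ i j| ≤ √s.normχ := Real.abs_le_sqrt (sq_le_sum_sq s.χ i j)
theorem abs_k_le (i j : Fin 3) : |s.k i j| ≤ √s.normk := Real.abs_le_sqrt (sq_le_sum_sq s.k i j)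

theorem abs_trχ_le : |s.trχ| ≤ 3 * √s.normχ := abs_sum_three_le fun i => s.abs_χ_le i i

theorem abs_div_le (i : Fin 3) : |s.div i| ≤ 3 * (√s.freq * √s.normχ) :=
  abs_sum_three_le fun e => by
    rw [abs_mul]
    exact mul_le_mul (s.abs_η_le e) (s.abs_χ_le i e) (abs_nonneg _) (Real.sqrt_nonneg _)

theorem abs_η_div_le : |∑ i, s.η i * s.div i| ≤ 9 * (s.freq * √s.normχ) := by
  refine (abs_sum_three_le (b := √s.freq * (3 * (√s.freq * √s.normχ))) fun i => ?_).trans_eq ?_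
  · rw [abs_mul]
    exact mul_le_mul (s.abs_η_le i) (s.abs_div_le i) (abs_nonneg _) (Real.sqrt_nonneg _)
  · nth_rewrite 3 [← Real.mul_self_sqrt s.freq_nonneg]
    ring

variable {s}

theorem abs_trκχ_le {σ : ℝ} (hκ : ∀ i, |s.κ i| ≤ σ) : |s.trκχ| ≤ 3 * (σ * √s.normχ) :=
  abs_sum_three_le fun i => by
    rw [abs_mul]
    exact mul_le_mul (hκ i) (s.abs_χ_le i i) (abs_nonneg _) ((abs_nonneg _).trans (hκ i))

theorem abs_trκk_le {σ : ℝ} (hκ : ∀ i, |s.κ i| ≤ σ) : |s.trκk| ≤ 3 * (σ * √s.normk) :=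
  abs_sum_three_le fun i => by
    rw [abs_mul]
    exact mul_le_mul (hκ i) (s.abs_k_le i i) (abs_nonneg _) ((abs_nonneg _).trans (hκ i))

theorem abs_κη_le {σ : ℝ} (hκ : ∀ i, |s.κ i| ≤ σ) : |s.κη| ≤ σ * s.freq := by
  rw [freq, Finset.mul_sum]
  refine (Finset.abs_sum_le_sum_abs _ _).trans (Finset.sum_le_sum fun i _ => ?_)
  rw [abs_mul, abs_of_nonneg (sq_nonneg (s.η i))]
  exact mul_le_mul_of_nonneg_right (hκ i) (sq_nonneg _)

/-- The weight 2000 of the scalar field energy is large enough for the squares of n and φ, together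
with that of χ, to absorb every cross term between metric, lapse and scalar field. -/
theorem mainTerm_nonneg (hx : 0 ≤ s.x) (hA : 0 ≤ s.A) (hA' : s.A ^ 2 ≤ 2 / 3) :
    0 ≤ s.mainTerm := by
  have hA1 : s.A ≤ 1 := by nlinarith
  have hX : 0 ≤ s.x * s.freq := mul_nonneg hx s.freq_nonneg
  set a := √s.normχ with ha
  have ha0 : 0 ≤ a := Real.sqrt_nonneg _
  have ha2 : s.normχ = a ^ 2 := (Real.sq_sqrt s.normχ_nonneg).symm
  have h1 : -(s.x * s.freq * (18 * |s.φ| * a)) ≤ 2 * s.A * s.φ * s.x * (∑ i, s.η i * s.div i) := by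
    have : |2 * s.A * s.φ * s.x * (∑ i, s.η i * s.div i)|
        ≤ 2 * 1 * |s.φ| * s.x * (9 * (s.freq * a)) := by
      rw [abs_mul, abs_mul, abs_mul, abs_mul, abs_of_nonneg hA, abs_of_nonneg hx, abs_two]
      have := s.abs_η_div_le
      gcongr
    have := (abs_le.1 this).1
    nlinarith
  have h2 : -(|s.n| * a) ≤ 1 / 3 * s.n * s.trχ := by
    have : |s.n * s.trχ| ≤ |s.n| * (3 * a) := by
      rw [abs_mul]; exact mul_le_mul_of_nonneg_left s.abs_trχ_le (abs_nonneg _)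
    have := (abs_le.1 this).1
    linarith
  have h3 : -(3 * |s.φ| * a) ≤ -(s.A * s.φ * s.trχ) := by
    have : |s.A * s.φ * s.trχ| ≤ 1 * |s.φ| * (3 * a) := by
      rw [abs_mul, abs_mul, abs_of_nonneg hA]
      have := s.abs_trχ_le
      gcongr
    have := (abs_le.1 this).2
    linarith
  have h4 : -(2 * |s.n| * |s.φ|) ≤ -(2 * s.A * s.n * s.φ) := by
    have : |s.A * s.n * s.φ| ≤ 1 * |s.n| * |s.φ| := by
      rw [abs_mul, abs_mul, abs_of_nonneg hA]
      gcongr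
    have := (abs_le.1 this).2
    linarith
  -- Here A² ≤ 2/3 is decisive: completing the square gives 2Aφn ≥ -(2/3)n² - (3/2)A²φ² ≥ -(2/3)n² -
  -- φ².
  have h5 : 1 / 3 * (s.n ^ 2 + s.φ ^ 2) ≤ s.n ^ 2 + 2 * s.A * s.φ * s.n + 4 / 3 * s.φ ^ 2 := by
    nlinarith [sq_nonneg (2 * s.n + 3 * (s.A * s.φ)), mul_le_mul_of_nonneg_right hA' (sq_nonneg s.φ)]
  -- The cross term 21|φ|a dictates the weight: absorbing it in a²/6 requires 661.5 φ², just below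
  -- 2000/3.
  have h6 : 0 ≤ 1 / 3 * a ^ 2 - |s.n| * a - 2 * |s.n| * |s.φ| - 21 * |s.φ| * a
      + 2000 / 3 * (s.n ^ 2 + s.φ ^ 2) := by
    rw [← sq_abs s.n, ← sq_abs s.φ]
    nlinarith [sq_nonneg (a - 3 * |s.n|), sq_nonneg (a - 63 * |s.φ|), sq_nonneg (|s.n| - |s.φ|),
      sq_nonneg s.n, sq_nonneg |s.φ|, sq_nonneg |s.n|]
  have h7 := mul_nonneg hX h6
  have h8 : 0 ≤ s.x * s.freq * ((1 / 3 * s.normχ + 1 / 3 * s.n * s.trχ - 2 * s.A * s.n * s.φ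
      - s.A * s.φ * s.trχ) - (1 / 3 * a ^ 2 - |s.n| * a - 2 * |s.n| * |s.φ| - 3 * |s.φ| * a)) := by
    refine mul_nonneg hX ?_
    rw [ha2]
    linarith
  have h9 := mul_nonneg hX (sub_nonneg.2 h5)
  rw [mainTerm]
  nlinarith [sq_nonneg s.n]

/-- The lapse equation is elliptic with a zeroth order term of good sign, so n is controlled by the
energy without any derivative loss. -/
theorem lapse_sq_le (hs : s.Constraints) (hA : 0 ≤ s.A) (hA' : s.A ^ 2 ≤ 2 / 3)
    {σ : ℝ} (hσ : σ ≤ 1) (hκ : ∀ i, |s.κ i| ≤ σ) :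
    ((1 + s.x * s.freq) * s.n) ^ 2 ≤ 8 * s.g ^ 2 + 72 * s.normk := by
  have hA1 : s.A ≤ 1 := by nlinarith
  have h := abs_trκk_le hκ
  set b := √s.normk with hb
  have hb0 : 0 ≤ b := Real.sqrt_nonneg _
  have hb2 : s.normk = b ^ 2 := (Real.sq_sqrt s.normk_nonneg).symm
  have h1 : s.trκk ^ 2 ≤ (3 * b) ^ 2 := by
    rw [sq_le_sq]
    refine h.trans ((?_ : _ ≤ 3 * b).trans (le_abs_self _))
    nlinarith
  rw [hs.lapse, hb2]
  nlinarith [sq_nonneg (2 * s.A * s.g - 2 * s.trκk), sq_nonneg s.g,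
    mul_le_mul_of_nonneg_right hA' (sq_nonneg s.g)]

/-- This isolates the linear bookkeeping: the eight summands of `errTerm` enter as opaque variables.
-/
theorem abs_errTerm_aux {σ u₁ u₂ u₃ u₄ u₅ u₆ u₇ u₈ b₁ b₂ b₃ b₄ b₅ b₆ b₇ b₈ : ℝ}
    (h₁ : |u₁| ≤ σ * b₁) (h₂ : |u₂| ≤ σ * b₂) (h₃ : |u₃| ≤ σ * b₃) (h₄ : |u₄| ≤ σ * b₄)
    (h₅ : |u₅| ≤ σ * b₅) (h₆ : |u₆| ≤ σ * b₆) (h₇ : |u₇| ≤ σ * b₇) (h₈ : |u₈| ≤ σ * b₈) :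
    |u₁ - u₂ - u₃ - u₄ + u₅ - 2 * u₆ + 1 / 2 * u₇ + 2000 * (2 * u₆ + 2 * u₈)|
      ≤ σ * (b₁ + b₂ + b₃ + b₄ + b₅ + 4002 * b₆ + 1 / 2 * b₇ + 4000 * b₈) := by
  rw [abs_le] at *
  constructor <;> linarith

-- Each summand has a factor κ, hence σ, times a quadratic form controlled by the energy; the
-- products with n are handled by `lapse_sq_le`.
set_option maxHeartbeats 800000 in
theorem abs_errTerm_le (hs : s.Constraints) (hx : 0 ≤ s.x) (hA : 0 ≤ s.A)
    (hA' : s.A ^ 2 ≤ 2 / 3) {σ : ℝ} (hσ0 : 0 ≤ σ) (hσ : σ ≤ 1) (hκ : ∀ i, |s.κ i| ≤ σ) :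
    |s.errTerm| ≤ 1000000 * σ * s.energy := by
  have hX : 0 ≤ s.x * s.freq := mul_nonneg hx s.freq_nonneg
  have hS := abs_trκχ_le hκ
  have hkk := abs_trκk_le hκ
  have hη := abs_κη_le hκ
  have hH := s.abs_trχ_le
  have hη_le := s.abs_η_le
  have hχ_le := s.abs_χ_le
  have hdiv := s.abs_div_le
  have hlap := lapse_sq_le hs hA hA' hσ hκ
  have hO := s.freq_nonneg
  have hO2 : s.freq = √s.freq ^ 2 := (Real.sq_sqrt s.freq_nonneg).symm
  set a := √s.normχ with ha
  have ha0 : 0 ≤ a := Real.sqrt_nonneg _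
  have ha2 : s.normχ = a ^ 2 := (Real.sq_sqrt s.normχ_nonneg).symm
  set b := √s.normk with hb
  have hb0 : 0 ≤ b := Real.sqrt_nonneg _
  have hb2 : s.normk = b ^ 2 := (Real.sq_sqrt s.normk_nonneg).symm
  set e := √s.freq with he
  have he0 : 0 ≤ e := Real.sqrt_nonneg _
  have hκκ : ∀ i j, |s.κ i - s.κ j| ≤ 2 * σ := fun i j =>
    (abs_sub _ _).trans (by linarith [hκ i, hκ j])
  have t1 : |∑ i, ∑ j, 2 * (s.κ j - s.κ i) * s.k i j ^ 2| ≤ σ * (4 * b ^ 2) := by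
    rw [← hb2, normk, Finset.mul_sum, Finset.mul_sum]
    refine (Finset.abs_sum_le_sum_abs _ _).trans (Finset.sum_le_sum fun i _ => ?_)
    rw [Finset.mul_sum, Finset.mul_sum]
    refine (Finset.abs_sum_le_sum_abs _ _).trans (Finset.sum_le_sum fun j _ => ?_)
    rw [abs_mul, abs_mul, abs_two, abs_of_nonneg (sq_nonneg (s.k i j))]
    nlinarith [hκκ j i, sq_nonneg (s.k i j)]
  have t2 : |s.x * s.n * s.κη * s.trχ| ≤ σ * (3 * (s.x * s.freq) * (|s.n| * a)) := by
    rw [abs_mul, abs_mul, abs_mul, abs_of_nonneg hx]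
    calc s.x * |s.n| * |s.κη| * |s.trχ| ≤ s.x * |s.n| * (σ * s.freq) * (3 * a) := by gcongr
      _ = _ := by ring
  have t3 : |s.x * (∑ i, s.div i * (∑ a, (s.κ i - s.κ a) * s.η a * s.χ i a
      - 1 / 2 * s.η i * (s.κ i * s.trχ - s.trκχ)))| ≤ σ * (81 * (s.x * s.freq) * a ^ 2) := by
    rw [abs_mul, abs_of_nonneg hx]
    have : ∀ i, |s.div i * (∑ a, (s.κ i - s.κ a) * s.η a * s.χ i a
      - 1 / 2 * s.η i * (s.κ i * s.trχ - s.trκχ))| ≤ 3 * (e * a) * (9 * (σ * (e * a))) := by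
      intro i
      rw [abs_mul]
      refine mul_le_mul (hdiv i) ?_ (abs_nonneg _) (by positivity)
      have u1 : |∑ c, (s.κ i - s.κ c) * s.η c * s.χ i c| ≤ 3 * (2 * σ * e * a) :=
        abs_sum_three_le fun c => by
          rw [abs_mul, abs_mul]
          have := hκκ i c
          have := hη_le c
          have := hχ_le i c
          gcongr
      have u2 : |1 / 2 * s.η i * (s.κ i * s.trχ - s.trκχ)| ≤ 1 / 2 * e * (6 * (σ * a)) := by
        rw [abs_mul, abs_mul, abs_of_pos (by norm_num : (0 : ℝ) < 1 / 2)]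
        have := hη_le i
        have : |s.κ i * s.trχ - s.trκχ| ≤ 6 * (σ * a) := by
          refine (abs_sub _ _).trans ?_
          rw [abs_mul]
          have := mul_le_mul (hκ i) hH (abs_nonneg _) hσ0
          linarith
        gcongr
      refine (abs_sub _ _).trans ?_
      linarith
    calc _ ≤ s.x * (3 * (3 * (e * a) * (9 * (σ * (e * a))))) :=
          mul_le_mul_of_nonneg_left (abs_sum_three_le this) hx
      _ = _ := by rw [hO2]; ring
  have t4 : |s.x * (∑ i, s.div i * (1 / 2 * s.η i * (s.trκχ - s.κ i * s.trχ)))|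
      ≤ σ * (27 * (s.x * s.freq) * a ^ 2) := by
    rw [abs_mul, abs_of_nonneg hx]
    have : ∀ i, |s.div i * (1 / 2 * s.η i * (s.trκχ - s.κ i * s.trχ))|
        ≤ 3 * (e * a) * (3 * (σ * (e * a))) := by
      intro i
      rw [abs_mul]
      refine mul_le_mul (hdiv i) ?_ (abs_nonneg _) (by positivity)
      have u2 : |1 / 2 * s.η i * (s.trκχ - s.κ i * s.trχ)| ≤ 1 / 2 * e * (6 * (σ * a)) := by
        rw [abs_mul, abs_mul, abs_of_pos (by norm_num : (0 : ℝ) < 1 / 2)]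
        have := hη_le i
        have : |s.trκχ - s.κ i * s.trχ| ≤ 6 * (σ * a) := by
          refine (abs_sub _ _).trans ?_
          rw [abs_mul]
          have := mul_le_mul (hκ i) hH (abs_nonneg _) hσ0
          linarith
        gcongr
      linarith
    calc _ ≤ s.x * (3 * (3 * (e * a) * (3 * (σ * (e * a))))) :=
          mul_le_mul_of_nonneg_left (abs_sum_three_le this) hx
      _ = _ := by rw [hO2]; ring
  have t5 : |1 / 2 * s.x * s.trχ * (s.freq * s.trκχ - s.κη * s.trχ)|
      ≤ σ * (9 * (s.x * s.freq) * a ^ 2) := by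
    rw [abs_mul, abs_mul, abs_mul, abs_of_nonneg hx, abs_of_pos (by norm_num : (0 : ℝ) < 1 / 2)]
    have : |s.freq * s.trκχ - s.κη * s.trχ| ≤ 6 * (σ * s.freq * a) := by
      refine (abs_sub _ _).trans ?_
      rw [abs_mul, abs_mul, abs_of_nonneg hO]
      have h1 := mul_le_mul hη hH (abs_nonneg _) (by positivity)
      have h2 := mul_le_mul_of_nonneg_left hS hO
      linarith
    calc _ ≤ 1 / 2 * s.x * (3 * a) * (6 * (σ * s.freq * a)) := by gcongr
      _ = _ := by ring
  have t6 : |s.n * s.trκk| ≤ σ * (3 * (|s.n| * b)) := by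
    rw [abs_mul]
    nlinarith [mul_le_mul_of_nonneg_left hkk (abs_nonneg s.n)]
  have t7 : |s.x * s.κη| ≤ σ * (s.x * s.freq) := by
    rw [abs_mul, abs_of_nonneg hx]
    nlinarith
  have t7a : |s.x * s.κη * s.normχ| ≤ σ * (s.x * s.freq * a ^ 2) := by
    rw [abs_mul, ha2, abs_of_nonneg (sq_nonneg a), ← mul_assoc]
    exact mul_le_mul_of_nonneg_right t7 (sq_nonneg a)
  have t7b : |s.x * s.κη * s.φ ^ 2| ≤ σ * (s.x * s.freq * s.φ ^ 2) := by
    rw [abs_mul, abs_of_nonneg (sq_nonneg s.φ), ← mul_assoc]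
    exact mul_le_mul_of_nonneg_right t7 (sq_nonneg _)
  have hn : s.n ^ 2 + s.x * s.freq * s.n ^ 2 ≤ 8 * s.g ^ 2 + 72 * b ^ 2 := by
    rw [hb2] at hlap
    refine le_trans ?_ hlap
    have : 0 ≤ (s.x * s.freq + (s.x * s.freq) ^ 2) * s.n ^ 2 := by positivity
    nlinarith only [this]
  have hna : 2 * (|s.n| * a) ≤ s.n ^ 2 + a ^ 2 := by
    rw [← sq_abs s.n]; nlinarith only [sq_nonneg (|s.n| - a)]
  have hnb : 2 * (|s.n| * b) ≤ s.n ^ 2 + b ^ 2 := by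
    rw [← sq_abs s.n]; nlinarith only [sq_nonneg (|s.n| - b)]
  have hXna := mul_le_mul_of_nonneg_left hna hX
  -- The coefficient 118 rounds up 81 + 27 + 9 + 1/2.
  have bound : |s.errTerm| ≤ σ * (4 * b ^ 2 + 3 * (s.x * s.freq) * (|s.n| * a)
      + 118 * (s.x * s.freq * a ^ 2) + 4002 * (3 * (|s.n| * b))
      + 4000 * (s.x * s.freq * s.φ ^ 2)) := by
    have z2 : 0 ≤ σ * (s.x * s.freq * a ^ 2) := by positivity
    rw [errTerm]
    refine (abs_errTerm_aux t1 t2 t3 t4 t5 t6 t7a t7b).trans ?_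
    nlinarith only [z2]
  refine bound.trans ?_
  rw [show 1000000 * σ * s.energy = σ * (1000000 * s.energy) by ring]
  refine mul_le_mul_of_nonneg_left ?_ hσ0
  rw [energy, ha2, hb2]
  have z1 : 0 ≤ s.x * s.freq * a ^ 2 := by positivity
  have z2 : 0 ≤ s.x * s.freq * s.φ ^ 2 := by positivity
  nlinarith only [sq_nonneg s.g, sq_nonneg b, sq_nonneg s.n, mul_nonneg hX (sq_nonneg s.n), z1, z2,
    hn, hnb, hXna]

theorem energy_nonneg (hx : 0 ≤ s.x) : 0 ≤ s.energy := by
  have := s.normk_nonneg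
  have := s.normχ_nonneg
  have := s.freq_nonneg
  rw [energy]
  positivity

/-- The energy inequality: the energy is almost monotone in time. -/
theorem denergy_ge (hs : s.Constraints) (hx : 0 ≤ s.x) (hA : 0 ≤ s.A)
    (hA' : s.A ^ 2 ≤ 2 / 3) {σ : ℝ} (hσ0 : 0 ≤ σ) (hσ : σ ≤ 1) (hκ : ∀ i, |s.κ i| ≤ σ) :
    -(1000000 * σ * s.energy) ≤ s.denergy := by
  rw [denergy_eq hs]
  linarith [(abs_le.1 (abs_errTerm_le hs hx hA hA' hσ0 hσ hκ)).1, mainTerm_nonneg hx hA hA']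

end FrameState

/-! ### Calculus on the interval `(0, 1]` -/

theorem monotoneOn_of_hasDerivWithinAt_nonneg {X X' : ℝ → ℝ}
    (hX : ∀ t ∈ Ioc (0 : ℝ) 1, HasDerivWithinAt X (X' t) (Ioc 0 1) t)
    (h0 : ∀ t ∈ Ioc (0 : ℝ) 1, 0 ≤ X' t) : MonotoneOn X (Ioc 0 1) := by
  have hd : ∀ t ∈ interior (Ioc (0 : ℝ) 1), HasDerivAt X (X' t) t := fun t ht =>
    (hX t (interior_subset ht)).hasDerivAt (mem_interior_iff_mem_nhds.1 ht)
  exact monotoneOn_of_deriv_nonneg (convex_Ioc 0 1) (fun t ht => (hX t ht).continuousWithinAt)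
    (fun t ht => (hd t ht).differentiableAt.differentiableWithinAt)
    fun t ht => (hd t ht).deriv ▸ h0 t (interior_subset ht)

/-- Both Y - X and Y + X are monotone. No integrability of the derivative X' is required. -/
theorem abs_sub_le_of_abs_deriv_le {X X' Y Y' : ℝ → ℝ}
    (hX : ∀ t ∈ Ioc (0 : ℝ) 1, HasDerivWithinAt X (X' t) (Ioc 0 1) t)
    (hY : ∀ t ∈ Ioc (0 : ℝ) 1, HasDerivWithinAt Y (Y' t) (Ioc 0 1) t)
    (h : ∀ t ∈ Ioc (0 : ℝ) 1, |X' t| ≤ Y' t) {s t : ℝ} (hs : 0 < s) (hst : s ≤ t) (ht : t ≤ 1) :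
    |X t - X s| ≤ Y t - Y s := by
  have hs' : s ∈ Ioc (0 : ℝ) 1 := ⟨hs, hst.trans ht⟩
  have ht' : t ∈ Ioc (0 : ℝ) 1 := ⟨hs.trans_le hst, ht⟩
  have h1 := monotoneOn_of_hasDerivWithinAt_nonneg (fun t ht => (hY t ht).sub (hX t ht))
    (fun t ht => by linarith [(abs_le.1 (h t ht)).2]) hs' ht' hst
  have h2 := monotoneOn_of_hasDerivWithinAt_nonneg (fun t ht => (hY t ht).add (hX t ht))
    (fun t ht => by linarith [(abs_le.1 (h t ht)).1]) hs' ht' hst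
  simp only [Pi.sub_apply, Pi.add_apply] at h1 h2
  rw [abs_le]
  constructor <;> linarith

theorem hasDerivWithinAt_rpow {t : ℝ} (ht : t ∈ Ioc (0 : ℝ) 1) (α : ℝ) :
    HasDerivWithinAt (fun s : ℝ => s ^ α) (t⁻¹ * (α * t ^ α)) (Ioc 0 1) t := by
  have := (Real.hasDerivAt_rpow_const (x := t) (p := α) (Or.inl ht.1.ne')).hasDerivWithinAt
    (s := Ioc 0 1)
  rwa [Real.rpow_sub_one ht.1.ne', show α * (t ^ α / t) = t⁻¹ * (α * t ^ α) by ring] at this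

/-- A function whose logarithmic derivative is `O(t^α)`, `α > 0`, has a limit as `t → 0`. -/
theorem exists_tendsto_of_abs_deriv_le {X X' : ℝ → ℝ} {M α : ℝ} (hα : 0 < α) (hM : 0 ≤ M)
    (hX : ∀ t ∈ Ioc (0 : ℝ) 1, HasDerivWithinAt X (t⁻¹ * X' t) (Ioc 0 1) t)
    (h : ∀ t ∈ Ioc (0 : ℝ) 1, |X' t| ≤ M * t ^ α) :
    ∃ L, Tendsto X (𝓝[>] 0) (𝓝 L) ∧ ∀ t ∈ Ioc (0 : ℝ) 1, |X t - L| ≤ M / α * t ^ α := by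
  have hY : ∀ t ∈ Ioc (0 : ℝ) 1, HasDerivWithinAt (fun s : ℝ => M / α * s ^ α)
      (t⁻¹ * (M * t ^ α)) (Ioc 0 1) t := fun t ht => by
    have := (hasDerivWithinAt_rpow ht α).const_mul (M / α)
    rwa [show M / α * (t⁻¹ * (α * t ^ α)) = t⁻¹ * (M * t ^ α) by field_simp] at this
  have key : ∀ {s t : ℝ}, 0 < s → s ≤ t → t ≤ 1 →
      |X t - X s| ≤ M / α * t ^ α - M / α * s ^ α := fun hs hst ht => by
    refine abs_sub_le_of_abs_deriv_le hX hY (fun t ht => ?_) hs hst ht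
    rw [abs_mul, abs_of_pos (inv_pos.2 ht.1)]
    exact mul_le_mul_of_nonneg_left (h t ht) (inv_pos.2 ht.1).le
  have hMα : 0 ≤ M / α := by positivity
  -- Adding the primitive of the bound makes X monotone and bounded below near 0, so the limit
  -- exists; the primitive itself tends to 0.
  have hmono : MonotoneOn (fun t : ℝ => X t + M / α * t ^ α) (Ioo 0 1) := fun s hs t ht hst => by
    have := (abs_le.1 (key hs.1 hst ht.2.le)).1
    dsimp only
    linarith
  have hbdd : BddBelow ((fun t : ℝ => X t + M / α * t ^ α) '' Ioo 0 1) := by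
    refine ⟨X 1 - M / α, ?_⟩
    rintro _ ⟨t, ht, rfl⟩
    have := (abs_le.1 (key ht.1 ht.2.le le_rfl)).2
    rw [Real.one_rpow] at this
    dsimp only
    nlinarith [mul_nonneg hMα (Real.rpow_nonneg ht.1.le α)]
  have h1 := hmono.tendsto_nhdsWithin_Ioo_right (by simp) hbdd
  have h2 : Tendsto (fun t : ℝ => M / α * t ^ α) (𝓝[>] 0) (𝓝 (M / α * 0)) := by
    refine Tendsto.const_mul _ ?_
    have := (Real.continuousAt_rpow_const 0 α (Or.inr hα.le)).tendsto
    rw [Real.zero_rpow hα.ne'] at this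
    exact this.mono_left nhdsWithin_le_nhds
  have h3 := h1.sub h2
  simp only [add_sub_cancel_right] at h3
  refine ⟨_, h3, fun t ht => ?_⟩
  refine le_of_tendsto ((tendsto_const_nhds.sub h3).abs) ?_
  filter_upwards [Ioo_mem_nhdsGT ht.1] with s hs
  have := key hs.1 hs.2.le ht.2
  nlinarith [mul_nonneg hMα (Real.rpow_nonneg hs.1.le α)]

/-- A function with bounded logarithmic derivative grows at most logarithmically. -/
theorem abs_le_of_abs_deriv_le_log {X X' : ℝ → ℝ} {M : ℝ}
    (hX : ∀ t ∈ Ioc (0 : ℝ) 1, HasDerivWithinAt X (t⁻¹ * X' t) (Ioc 0 1) t)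
    (h : ∀ t ∈ Ioc (0 : ℝ) 1, |X' t| ≤ M) {t : ℝ} (ht : t ∈ Ioc (0 : ℝ) 1) :
    |X t| ≤ |X 1| + M * |Real.log t| := by
  have hY : ∀ t ∈ Ioc (0 : ℝ) 1, HasDerivWithinAt (fun s : ℝ => M * Real.log s)
      (M * t⁻¹) (Ioc 0 1) t := fun t ht =>
    ((Real.hasDerivAt_log ht.1.ne').const_mul M).hasDerivWithinAt
  have := abs_sub_le_of_abs_deriv_le hX hY (fun t ht => by
    rw [abs_mul, abs_of_pos (inv_pos.2 ht.1), mul_comm]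
    exact mul_le_mul_of_nonneg_right (h t ht) (inv_pos.2 ht.1).le) ht.1 ht.2 le_rfl
  rw [Real.log_one] at this
  rw [abs_of_nonpos (Real.log_nonpos ht.1.le ht.2)]
  have h3 := abs_sub_abs_le_abs_sub (X t) (X 1)
  rw [abs_sub_comm] at h3
  linarith

/-- A function whose logarithmic derivative is `O(t^{-ε})`, `ε > 0`, is itself `O(t^{-ε} / ε)`. -/
theorem abs_le_of_abs_deriv_le_rpow {X X' : ℝ → ℝ} {M ε : ℝ} (hε : 0 < ε) (hM : 0 ≤ M)
    (hX : ∀ t ∈ Ioc (0 : ℝ) 1, HasDerivWithinAt X (t⁻¹ * X' t) (Ioc 0 1) t)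
    (h : ∀ t ∈ Ioc (0 : ℝ) 1, |X' t| ≤ M * t ^ (-ε)) {t : ℝ} (ht : t ∈ Ioc (0 : ℝ) 1) :
    |X t| ≤ |X 1| + M / ε * t ^ (-ε) := by
  have hY : ∀ t ∈ Ioc (0 : ℝ) 1, HasDerivWithinAt (fun s : ℝ => -(M / ε) * s ^ (-ε))
      (t⁻¹ * (M * t ^ (-ε))) (Ioc 0 1) t := fun t ht => by
    have := (hasDerivWithinAt_rpow ht (-ε)).const_mul (-(M / ε))
    rwa [show -(M / ε) * (t⁻¹ * (-ε * t ^ (-ε))) = t⁻¹ * (M * t ^ (-ε)) by field_simp] at this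
  have := abs_sub_le_of_abs_deriv_le hX hY (fun t ht => by
    rw [abs_mul, abs_of_pos (inv_pos.2 ht.1)]
    exact mul_le_mul_of_nonneg_left (h t ht) (inv_pos.2 ht.1).le) ht.1 ht.2 le_rfl
  rw [Real.one_rpow] at this
  have h3 := abs_sub_abs_le_abs_sub (X t) (X 1)
  rw [abs_sub_comm] at h3
  have : 0 ≤ M / ε := by positivity
  linarith

/-! ### The equations of a single Fourier mode -/

namespace Kasner
variable (B : Kasner)

/-- The diagonal entries of the trace-free background form. -/
def κ (i : Fin 3) : ℝ := 1 / 3 - B.q i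

theorem sum_κ_sq : ∑ i, B.κ i ^ 2 = ∑ i, B.q i ^ 2 - 1 / 3 := by
  have := B.sum_q
  simp only [κ, Fin.sum_univ_three] at *
  linear_combination -(2 / 3) * this

theorem sigma_nonneg : 0 ≤ B.sigma := Real.sqrt_nonneg _

theorem abs_κ_le (i : Fin 3) : |B.κ i| ≤ B.sigma := by
  rw [sigma, ← sum_κ_sq]
  exact Real.abs_le_sqrt (Finset.single_le_sum (f := fun i => B.κ i ^ 2)
    (fun _ _ => sq_nonneg _) (Finset.mem_univ i))

/-- This is Cauchy–Schwarz for the exponents, Σq² ≥ 1/3 when Σq = 1, with equality for the isotropic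
background. -/
theorem A_sq_le : B.A ^ 2 ≤ 2 / 3 := by
  have h1 := B.sum_q_sq
  have h2 : 0 ≤ ∑ i, B.κ i ^ 2 := Finset.sum_nonneg fun _ _ => sq_nonneg _
  rw [sum_κ_sq] at h2
  linarith

theorem q_le_one (i : Fin 3) : B.q i ≤ 1 := by
  rw [← B.sum_q]
  exact Finset.single_le_sum (fun j _ => (B.q_pos j).le) (Finset.mem_univ i)

end Kasner

/-- A Fourier mode of the linearized variables; `f` is the mode of `t ∂_t φ`. -/
structure Mode where
  h : ℝ → Fin 3 → Fin 3 → ℝ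
  K : ℝ → Fin 3 → Fin 3 → ℝ
  φ : ℝ → ℝ
  f : ℝ → ℝ
  n : ℝ → ℝ

namespace Mode

variable (m : Mode) (B : Kasner) (ξ : Fin 3 → ℝ)

/-- The symbol of minus the background Laplacian. -/
def symb (t : ℝ) : ℝ := ∑ i, t ^ (-(2 * B.q i)) * ξ i ^ 2
/-- The trace of the metric perturbation. -/
def tr (t : ℝ) : ℝ := ∑ a, t ^ (-(2 * B.q a)) * m.h t a a
/-- The contraction of the metric perturbation with the frequency. -/
def w (t : ℝ) (i : Fin 3) : ℝ := ∑ e, t ^ (-(2 * B.q e)) * ξ e * m.h t i e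
/-- The logarithmic time derivative of `K`. -/
def rhsK (t : ℝ) (i j : Fin 3) : ℝ :=
  t ^ 2 * t ^ (-(2 * B.q i)) * (ξ i * ξ j * m.n t + 1 / 2 * (symb B ξ t * m.h t i j
    - ξ j * m.w B ξ t i - ξ i * m.w B ξ t j + ξ i * ξ j * m.tr B t))
    + if i = j then B.q i * m.n t else 0
/-- The logarithmic time derivative of `t ∂_t φ - A n`. -/
def rhsg (t : ℝ) : ℝ := -(t ^ 2 * symb B ξ t * m.φ t) - B.A * m.n t

/-- The linearized equations for a Fourier mode of frequency `ξ`. -/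
structure IsSol : Prop where
  symm : ∀ t ∈ Ioc (0 : ℝ) 1, ∀ i j, m.h t i j = m.h t j i
  tr_K : ∀ t ∈ Ioc (0 : ℝ) 1, ∑ a, m.K t a a = 0
  mom : ∀ t ∈ Ioc (0 : ℝ) 1, ∀ i, ∑ a, ξ a * m.K t a i = -(B.A * ξ i * m.φ t)
    + 1 / 2 * ξ i * ∑ a, (B.κ a - B.κ i) * t ^ (-(2 * B.q a)) * m.h t a a
  mom' : ∀ t ∈ Ioc (0 : ℝ) 1, ∀ i, ∑ a, t ^ (-(2 * B.q a)) * ξ a * m.K t i a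
    = -(B.A * t ^ (-(2 * B.q i)) * ξ i * m.φ t)
      + t ^ (-(2 * B.q i)) * ∑ a, t ^ (-(2 * B.q a)) * (B.κ i - B.κ a)
        * (ξ a * m.h t i a - 1 / 2 * ξ i * m.h t a a)
  lapse : ∀ t ∈ Ioc (0 : ℝ) 1, 2 * B.A * m.f t + 2 * ∑ a, B.κ a * m.K t a a
    = -(t ^ 2 * symb B ξ t * m.n t) + (2 * B.A ^ 2 - 1) * m.n t
  lapse' : ∀ t ∈ Ioc (0 : ℝ) 1, -(t ^ 2 * symb B ξ t * m.n t) - m.n t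
    = t ^ 2 * (symb B ξ t * m.tr B t - ∑ a, t ^ (-(2 * B.q a)) * ξ a * m.w B ξ t a)
  evol_h : ∀ t ∈ Ioc (0 : ℝ) 1, ∀ i j, HasDerivWithinAt (fun s => m.h s i j)
    (t⁻¹ * (2 * B.q j * m.h t i j - 2 * t ^ (2 * B.q i) * m.K t i j
      + if i = j then 2 * B.q i * t ^ (2 * B.q i) * m.n t else 0)) (Ioc 0 1) t
  evol_K : ∀ t ∈ Ioc (0 : ℝ) 1, ∀ i j, HasDerivWithinAt (fun s => m.K s i j)
    (t⁻¹ * m.rhsK B ξ t i j) (Ioc 0 1) t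
  dt_φ : ∀ t ∈ Ioc (0 : ℝ) 1, HasDerivWithinAt m.φ (t⁻¹ * m.f t) (Ioc 0 1) t
  wave : ∀ t ∈ Ioc (0 : ℝ) 1, HasDerivWithinAt (fun s => m.f s - B.A * m.n s)
    (t⁻¹ * m.rhsg B ξ t) (Ioc 0 1) t

/-- The mode in the orthonormal frame of the background. -/
def frame (t : ℝ) : FrameState where
  χ i j := t ^ (-(B.q i + B.q j)) * m.h t i j
  k i j := t ^ (B.q i - B.q j) * m.K t i j
  η i := t ^ (-B.q i) * ξ i
  κ := B.κ
  A := B.A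
  n := m.n t
  φ := m.φ t
  g := m.f t - B.A * m.n t
  x := t ^ 2

variable {m B ξ}

/-- This is the linearized symmetry of the second fundamental form. It is not imposed on K: it
follows because h is symmetric while its evolution equation is not manifestly so, and derivatives
within (0,1] are unique. -/
theorem IsSol.sub_K_eq (hm : m.IsSol B ξ) {t : ℝ} (ht : t ∈ Ioc (0 : ℝ) 1) (i j : Fin 3) :
    (B.q j - B.q i) * m.h t i j = t ^ (2 * B.q i) * m.K t i j - t ^ (2 * B.q j) * m.K t j i := by
  by_cases hij : i = j
  · subst hij; simp
  have h1 := hm.evol_h t ht i j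
  have h2 := hm.evol_h t ht j i
  have h3 := h2.congr (fun s hs => hm.symm s hs i j) (hm.symm t ht i j)
  have h4 := (uniqueDiffOn_Ioc 0 1 t ht).eq_deriv _ h1 h3
  have h5 := mul_left_cancel₀ (inv_ne_zero ht.1.ne') h4
  rw [if_neg hij, if_neg (Ne.symm hij), hm.symm t ht j i] at h5
  linarith

/-- All real powers of t that occur become monomials in r_i = t^(-q_i) and their inverses, after
which identities between frame and coordinate components are field arithmetic. -/
theorem rpow_relations (B : Kasner) {t : ℝ} (ht : 0 < t) :
    ∃ r : Fin 3 → ℝ, (∀ i, 0 < r i) ∧ (∀ i, t ^ (-B.q i) = r i) ∧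
      (∀ i, t ^ (-(2 * B.q i)) = r i ^ 2) ∧ (∀ i, t ^ (2 * B.q i) = (r i ^ 2)⁻¹) ∧
      (∀ i j, t ^ (-(B.q i + B.q j)) = r i * r j) ∧
      (∀ i j, t ^ (B.q i - B.q j) = (r i)⁻¹ * r j) := by
  refine ⟨fun i => t ^ (-B.q i), fun i => Real.rpow_pos_of_pos ht _, fun i => rfl, fun i => ?_,
    fun i => ?_, fun i j => ?_, fun i j => ?_⟩
  · rw [← Real.rpow_natCast, ← Real.rpow_mul ht.le]; congr 1; push_cast; ring
  · rw [← Real.rpow_natCast, ← Real.rpow_mul ht.le, ← Real.rpow_neg ht.le]; congr 1; push_cast; ring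
  · rw [← Real.rpow_add ht]; congr 1; ring
  · rw [← Real.rpow_neg ht.le, ← Real.rpow_add ht]; congr 1; ring

theorem freq_frame {t : ℝ} (ht : 0 < t) : (m.frame B ξ t).freq = symb B ξ t := by
  obtain ⟨r, hr, h1, h2, h3, h4, h5⟩ := rpow_relations B ht
  simp only [FrameState.freq, frame, symb, h1, h2, mul_pow]

theorem trχ_frame {t : ℝ} (ht : 0 < t) : (m.frame B ξ t).trχ = m.tr B t := by
  obtain ⟨r, hr, h1, h2, h3, h4, h5⟩ := rpow_relations B ht
  simp only [FrameState.trχ, frame, tr, h2, h4, sq]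

theorem div_frame {t : ℝ} (ht : 0 < t) (i : Fin 3) :
    (m.frame B ξ t).div i = t ^ (-B.q i) * m.w B ξ t i := by
  obtain ⟨r, hr, h1, h2, h3, h4, h5⟩ := rpow_relations B ht
  simp only [FrameState.div, frame, w, h1, h2, h4, Finset.mul_sum]
  exact Finset.sum_congr rfl fun e _ => by ring

theorem IsSol.constraints (hm : m.IsSol B ξ) {t : ℝ} (ht : t ∈ Ioc (0 : ℝ) 1) :
    (m.frame B ξ t).Constraints := by
  obtain ⟨r, hr, h1, h2, h3, h4, h5⟩ := rpow_relations B ht.1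
  have hr' : ∀ i, r i ≠ 0 := fun i => (hr i).ne'
  refine ⟨fun i j => ?_, ?_, fun i => ?_, fun i => ?_, ?_⟩
  · simp only [frame, h4, hm.symm t ht i j, mul_comm (r i)]
  · simpa [frame] using hm.tr_K t ht
  · have := hm.mom t ht i
    simp only [h2] at this
    simp only [frame, h1, h5, FrameState.trκχ, FrameState.trχ, h4]
    have e : ∑ a, r a * ξ a * ((r a)⁻¹ * r i * m.K t a i) = r i * ∑ a, ξ a * m.K t a i := by
      rw [Finset.mul_sum]
      exact Finset.sum_congr rfl fun a _ => by have := hr' a; field_simp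
    rw [e, this]
    simp only [Fin.sum_univ_three]
    ring
  · have := hm.mom' t ht i
    simp only [h2] at this
    simp only [frame, h1, h5, FrameState.trκχ, FrameState.trχ, h4]
    have e : ∑ a, r a * ξ a * ((r i)⁻¹ * r a * m.K t i a)
        = (r i)⁻¹ * ∑ a, r a ^ 2 * ξ a * m.K t i a := by
      rw [Finset.mul_sum]
      exact Finset.sum_congr rfl fun a _ => by ring
    rw [e, this]
    have := hr' i
    simp only [Fin.sum_univ_three]
    field_simp
    ring
  · have h := hm.lapse t ht
    rw [freq_frame ht.1]
    simp only [frame, FrameState.trκk, sub_self, Real.rpow_zero, one_mul]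
    linarith

theorem IsSol.hasDeriv_k (hm : m.IsSol B ξ) {t : ℝ} (ht : t ∈ Ioc (0 : ℝ) 1) (i j : Fin 3) :
    HasDerivWithinAt (fun s => (m.frame B ξ s).k i j) (t⁻¹ * (m.frame B ξ t).dk i j)
      (Ioc 0 1) t := by
  have h := (hasDerivWithinAt_rpow ht (B.q i - B.q j)).mul (hm.evol_K t ht i j)
  convert! h using 1
  rw [FrameState.dk, freq_frame ht.1, trχ_frame ht.1, div_frame ht.1, div_frame ht.1]
  obtain ⟨r, hr, h1, h2, h3, h4, h5⟩ := rpow_relations B ht.1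
  simp only [frame, rhsK, h1, h2, h4, h5, Kasner.κ]
  have := (hr i).ne'
  have := (hr j).ne'
  have := ht.1.ne'
  by_cases hij : i = j
  · subst hij
    simp only [if_true]
    field_simp
    ring
  · simp only [if_neg hij]
    field_simp
    ring

/-- The background term (q_j - q_i)χ_ij produced by the rescaling is exchanged for k_ij - k_ji by
`sub_K_eq`, so only the symmetric part of k drives χ. -/
theorem IsSol.hasDeriv_χ (hm : m.IsSol B ξ) {t : ℝ} (ht : t ∈ Ioc (0 : ℝ) 1) (i j : Fin 3) :
    HasDerivWithinAt (fun s => (m.frame B ξ s).χ i j) (t⁻¹ * (m.frame B ξ t).dχ i j)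
      (Ioc 0 1) t := by
  have h := (hasDerivWithinAt_rpow ht (-(B.q i + B.q j))).mul (hm.evol_h t ht i j)
  convert! h using 1
  have hK := hm.sub_K_eq ht i j
  obtain ⟨r, hr, h1, h2, h3, h4, h5⟩ := rpow_relations B ht.1
  simp only [h3] at hK
  simp only [frame, FrameState.dχ, h1, h3, h4, h5, Kasner.κ]
  have := (hr i).ne'
  have := (hr j).ne'
  have := ht.1.ne'
  by_cases hij : i = j
  · subst hij
    simp only [if_true]
    field_simp
    ring
  · simp only [if_neg hij]
    field_simp at hK ⊢
    linear_combination -hK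

theorem hasDeriv_xfreq {t : ℝ} (ht : t ∈ Ioc (0 : ℝ) 1) :
    HasDerivWithinAt (fun s => (m.frame B ξ s).x * (m.frame B ξ s).freq)
      (t⁻¹ * (m.frame B ξ t).dxfreq) (Ioc 0 1) t := by
  have h1 : HasDerivWithinAt (fun s => s ^ 2 * symb B ξ s)
      (2 * t * symb B ξ t + t ^ 2 * ∑ i, t⁻¹ * (-(2 * B.q i) * t ^ (-(2 * B.q i))) * ξ i ^ 2)
      (Ioc 0 1) t := by
    have h2 : HasDerivWithinAt (fun s => symb B ξ s)
        (∑ i, t⁻¹ * (-(2 * B.q i) * t ^ (-(2 * B.q i))) * ξ i ^ 2) (Ioc 0 1) t :=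
      HasDerivWithinAt.fun_sum fun i _ => (hasDerivWithinAt_rpow ht _).mul_const _
    have h3 : HasDerivWithinAt (fun s : ℝ => s ^ 2) (2 * t) (Ioc 0 1) t := by
      simpa using (hasDerivAt_pow 2 t).hasDerivWithinAt (s := Ioc 0 1)
    exact h3.mul h2
  have h4 := h1.congr (f₁ := fun s => (m.frame B ξ s).x * (m.frame B ξ s).freq)
    (fun s hs => by rw [freq_frame hs.1]; rfl) (by rw [freq_frame ht.1]; rfl)
  convert! h4 using 1
  rw [FrameState.dxfreq, freq_frame ht.1]
  obtain ⟨r, hr, h1, h2, h3, h4, h5⟩ := rpow_relations B ht.1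
  simp only [frame, FrameState.κη, symb, Fin.sum_univ_three, h1, h2, Kasner.κ]
  have := ht.1.ne'
  field_simp
  ring

theorem IsSol.hasDeriv_energy (hm : m.IsSol B ξ) {t : ℝ} (ht : t ∈ Ioc (0 : ℝ) 1) :
    HasDerivWithinAt (fun s => (m.frame B ξ s).energy) (t⁻¹ * (m.frame B ξ t).denergy)
      (Ioc 0 1) t := by
  have h1 : HasDerivWithinAt (fun s => (m.frame B ξ s).normk)
      (∑ i, ∑ j, 2 * (m.frame B ξ t).k i j * (t⁻¹ * (m.frame B ξ t).dk i j)) (Ioc 0 1) t :=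
    HasDerivWithinAt.fun_sum fun i _ => HasDerivWithinAt.fun_sum fun j _ => by
      simpa using (hm.hasDeriv_k ht i j).fun_pow 2
  have h2 : HasDerivWithinAt (fun s => (m.frame B ξ s).normχ)
      (∑ i, ∑ j, 2 * (m.frame B ξ t).χ i j * (t⁻¹ * (m.frame B ξ t).dχ i j)) (Ioc 0 1) t :=
    HasDerivWithinAt.fun_sum fun i _ => HasDerivWithinAt.fun_sum fun j _ => by
      simpa using (hm.hasDeriv_χ ht i j).fun_pow 2
  have hx := hasDeriv_xfreq (m := m) (B := B) (ξ := ξ) ht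
  have hg : HasDerivWithinAt (fun s => (m.frame B ξ s).g ^ 2)
      (2 * (m.frame B ξ t).g * (t⁻¹ * m.rhsg B ξ t)) (Ioc 0 1) t := by
    simpa [frame] using (hm.wave t ht).fun_pow 2
  have hφ : HasDerivWithinAt (fun s => (m.frame B ξ s).φ ^ 2)
      (2 * (m.frame B ξ t).φ * (t⁻¹ * m.f t)) (Ioc 0 1) t := by
    simpa [frame] using (hm.dt_φ t ht).fun_pow 2
  have h := (h1.add ((hx.const_mul (1 / 4)).mul h2)).add
    ((hg.add (hx.mul hφ)).const_mul 2000)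
  convert! h using 1
  have e1 : ∑ i, ∑ j, 2 * (m.frame B ξ t).k i j * (t⁻¹ * (m.frame B ξ t).dk i j)
      = t⁻¹ * ∑ i, ∑ j, 2 * (m.frame B ξ t).k i j * (m.frame B ξ t).dk i j := by
    simp only [Finset.mul_sum, mul_left_comm]
  have e2 : ∑ i, ∑ j, 2 * (m.frame B ξ t).χ i j * (t⁻¹ * (m.frame B ξ t).dχ i j)
      = t⁻¹ * ∑ i, ∑ j, 2 * (m.frame B ξ t).χ i j * (m.frame B ξ t).dχ i j := by
    simp only [Finset.mul_sum, mul_left_comm]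
  have e3 : m.rhsg B ξ t = -((m.frame B ξ t).x * (m.frame B ξ t).freq * (m.frame B ξ t).φ)
      - (m.frame B ξ t).A * (m.frame B ξ t).n := by
    rw [freq_frame ht.1]; rfl
  have e4 : m.f t = (m.frame B ξ t).g + (m.frame B ξ t).A * (m.frame B ξ t).n := by
    simp [frame]
  rw [e1, e2, e3, e4, FrameState.denergy]
  ring

/-- The energy of a mode grows at most like `t^{-cσ}`. -/
theorem IsSol.energy_le (hm : m.IsSol B ξ) (hσ : B.sigma ≤ 1) {t : ℝ} (ht : t ∈ Ioc (0 : ℝ) 1) :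
    (m.frame B ξ t).energy ≤ t ^ (-(1000000 * B.sigma)) * (m.frame B ξ 1).energy := by
  -- By `denergy_ge` the product t^(10⁶σ) E(t) is nondecreasing in t; comparison with t = 1 gives
  -- the bound.
  have hmono := monotoneOn_of_hasDerivWithinAt_nonneg
    (fun t ht => (hasDerivWithinAt_rpow ht (1000000 * B.sigma)).mul (hm.hasDeriv_energy ht))
    (fun t ht => by
      have h := FrameState.denergy_ge (hm.constraints ht) (sq_nonneg t) B.A_nonneg B.A_sq_le
        B.sigma_nonneg hσ B.abs_κ_le
      have h1 : 0 ≤ t⁻¹ := (inv_pos.2 ht.1).le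
      have h2 : 0 ≤ t ^ (1000000 * B.sigma) := Real.rpow_nonneg ht.1.le _
      have h3 := mul_nonneg (mul_nonneg h1 h2) (by linarith : 0 ≤ 1000000 * B.sigma
        * (m.frame B ξ t).energy + (m.frame B ξ t).denergy)
      nlinarith)
  have h := hmono ht ⟨one_pos, le_rfl⟩ ht.2
  simp only [Pi.mul_apply, Real.one_rpow, one_mul] at h
  rw [Real.rpow_neg ht.1.le, inv_mul_eq_div, le_div_iff₀ (Real.rpow_pos_of_pos ht.1 _), mul_comm]
  exact h

end Mode

/-! ### Estimates for a single Fourier mode -/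

theorem rpow_mul_rpow_le {t a b c : ℝ} (ht : t ∈ Ioc (0 : ℝ) 1) (h : c ≤ a + b) :
    t ^ a * t ^ b ≤ t ^ c := by
  rw [← Real.rpow_add ht.1]
  exact Real.rpow_le_rpow_of_exponent_ge ht.1 ht.2 h

theorem one_le_sigmaLoss {σ : ℝ} (h0 : 0 ≤ σ) (h1 : σ ≤ 1) (t : ℝ) : 1 ≤ sigmaLoss σ t := by
  unfold sigmaLoss
  split_ifs with h
  · linarith [abs_nonneg (Real.log t)]
  · exact one_le_one_div (lt_of_le_of_ne h0 (Ne.symm h)) h1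

theorem hasDerivWithinAt_metricCorrection (B : Kasner) {t : ℝ} (ht : t ∈ Ioc (0 : ℝ) 1)
    (i j : Fin 3) : HasDerivWithinAt (fun s => metricCorrection B s i j)
      (t⁻¹ * (2 * t ^ (2 * (B.q i - B.q j)))) (Ioc 0 1) t := by
  unfold metricCorrection
  split_ifs with h
  · rw [h, sub_self, mul_zero, Real.rpow_zero, mul_one, mul_comm]
    exact ((Real.hasDerivAt_log ht.1.ne').const_mul 2).hasDerivWithinAt
  · have := ((hasDerivWithinAt_rpow ht (2 * (B.q i - B.q j))).sub_const 1).div_const (B.q i - B.q j)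
    convert! this using 1
    have := sub_ne_zero.2 h
    field_simp

@[simp] theorem metricCorrection_one (B : Kasner) (i j : Fin 3) : metricCorrection B 1 i j = 0 := by
  unfold metricCorrection
  split_ifs <;> simp

namespace Mode

variable (m : Mode) (ξ : Fin 3 → ℝ)

/-- The squared size of the data of a mode at time `1`. -/
def dataSq : ℝ := (∑ i, ∑ j, m.K 1 i j ^ 2) + (∑ i, ξ i ^ 2) * (∑ i, ∑ j, m.h 1 i j ^ 2)
  + m.f 1 ^ 2 + (∑ i, ξ i ^ 2) * m.φ 1 ^ 2 + m.n 1 ^ 2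

/-- The size of the data of a mode at time `1`. -/
def data : ℝ := √(m.dataSq ξ)

/-- The length of the frequency. -/
def len : ℝ := √(∑ i, ξ i ^ 2)

theorem sum_sq_nonneg (f : Fin 3 → Fin 3 → ℝ) : 0 ≤ ∑ i, ∑ j, f i j ^ 2 :=
  Finset.sum_nonneg fun _ _ => Finset.sum_nonneg fun _ _ => sq_nonneg _

theorem len_sq : len ξ ^ 2 = ∑ i, ξ i ^ 2 :=
  Real.sq_sqrt (Finset.sum_nonneg fun _ _ => sq_nonneg _)

theorem len_nonneg : 0 ≤ len ξ := Real.sqrt_nonneg _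
theorem data_nonneg : 0 ≤ m.data ξ := Real.sqrt_nonneg _

theorem data_sq : m.data ξ ^ 2 = (∑ i, ∑ j, m.K 1 i j ^ 2)
    + len ξ ^ 2 * (∑ i, ∑ j, m.h 1 i j ^ 2) + m.f 1 ^ 2 + len ξ ^ 2 * m.φ 1 ^ 2 + m.n 1 ^ 2 := by
  have h1 := sum_sq_nonneg (m.K 1)
  have h2 := sum_sq_nonneg (m.h 1)
  rw [data, Real.sq_sqrt, dataSq, len_sq]
  rw [dataSq, ← len_sq]
  positivity

theorem abs_K_one_le (i j : Fin 3) : |m.K 1 i j| ≤ m.data ξ := by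
  refine abs_le_of_sq_le_sq ?_ (m.data_nonneg ξ)
  have h1 := FrameState.sq_le_sum_sq (m.K 1) i j
  have h2 := sum_sq_nonneg (m.h 1)
  rw [data_sq]
  have : 0 ≤ len ξ ^ 2 * (∑ i, ∑ j, m.h 1 i j ^ 2) := by positivity
  nlinarith [sq_nonneg (len ξ * m.φ 1), sq_nonneg (m.f 1), sq_nonneg (m.n 1)]

theorem len_mul_h_one_le : len ξ * √(∑ i, ∑ j, m.h 1 i j ^ 2) ≤ m.data ξ := by
  refine le_of_sq_le_sq ?_ (m.data_nonneg ξ)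
  have h1 := sum_sq_nonneg (m.K 1)
  rw [mul_pow, Real.sq_sqrt (sum_sq_nonneg (m.h 1)), data_sq]
  nlinarith [sq_nonneg (len ξ * m.φ 1), sq_nonneg (m.f 1), sq_nonneg (m.n 1)]

theorem len_mul_φ_one_le : len ξ * |m.φ 1| ≤ m.data ξ := by
  refine le_of_sq_le_sq ?_ (m.data_nonneg ξ)
  have h1 := sum_sq_nonneg (m.K 1)
  have h2 := mul_nonneg (sq_nonneg (len ξ)) (sum_sq_nonneg (m.h 1))
  rw [mul_pow, sq_abs, data_sq]
  nlinarith [sq_nonneg (m.f 1), sq_nonneg (m.n 1)]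

theorem abs_f_one_le : |m.f 1| ≤ m.data ξ := by
  refine abs_le_of_sq_le_sq ?_ (m.data_nonneg ξ)
  have h1 := sum_sq_nonneg (m.K 1)
  have h2 := mul_nonneg (sq_nonneg (len ξ)) (sum_sq_nonneg (m.h 1))
  rw [data_sq]
  nlinarith [sq_nonneg (len ξ * m.φ 1), sq_nonneg (m.n 1)]

variable {m ξ} {B : Kasner}

/-- The factor 4000 comes from 2000 (f - An)² ≤ 4000 (f² + A²n²). -/
theorem energy_one_le : (m.frame B ξ 1).energy ≤ 4000 * m.data ξ ^ 2 := by
  have hA := B.A_sq_le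
  have hf : (m.frame B ξ 1).freq = len ξ ^ 2 := by
    rw [freq_frame one_pos, len_sq]; simp [symb]
  rw [FrameState.energy, hf, data_sq]
  simp only [FrameState.normk, FrameState.normχ, frame, Real.one_rpow, one_mul, one_pow]
  have h1 := sum_sq_nonneg (m.K 1)
  have h2 := mul_nonneg (sq_nonneg (len ξ)) (sum_sq_nonneg (m.h 1))
  nlinarith [sq_nonneg (m.f 1 + B.A * m.n 1), mul_le_mul_of_nonneg_right hA (sq_nonneg (m.n 1)),
    sq_nonneg (len ξ * m.φ 1), sq_nonneg (m.n 1)]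

/-- The square root of the energy. -/
def sqrtE (m : Mode) (B : Kasner) (ξ : Fin 3 → ℝ) (t : ℝ) : ℝ := √(m.frame B ξ t).energy

/-- The square root of the squared frequency times `t²`. -/
def sqrtX (m : Mode) (B : Kasner) (ξ : Fin 3 → ℝ) (t : ℝ) : ℝ :=
  √((m.frame B ξ t).x * (m.frame B ξ t).freq)

theorem sqrtE_nonneg (t : ℝ) : 0 ≤ m.sqrtE B ξ t := Real.sqrt_nonneg _
theorem sqrtX_nonneg (t : ℝ) : 0 ≤ m.sqrtX B ξ t := Real.sqrt_nonneg _

theorem sqrtE_sq (t : ℝ) : m.sqrtE B ξ t ^ 2 = (m.frame B ξ t).energy :=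
  Real.sq_sqrt (FrameState.energy_nonneg (sq_nonneg t))

theorem sqrtX_sq (t : ℝ) : m.sqrtX B ξ t ^ 2 = (m.frame B ξ t).x * (m.frame B ξ t).freq :=
  Real.sq_sqrt (mul_nonneg (sq_nonneg t) (FrameState.freq_nonneg _))

/-- This is the source of every gain of t^(2/3): each t^(1-q_i) is at most t^(2/3-σ). A factor
`sqrtX` therefore costs one derivative and gains t^(2/3). -/
theorem sqrtX_le {t : ℝ} (ht : t ∈ Ioc (0 : ℝ) 1) :
    m.sqrtX B ξ t ≤ t ^ (2 / 3 - B.sigma) * len ξ := by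
  refine le_of_sq_le_sq ?_ (mul_nonneg (Real.rpow_nonneg ht.1.le _) (len_nonneg ξ))
  rw [sqrtX_sq, freq_frame ht.1, mul_pow, len_sq]
  simp only [symb, frame, Finset.mul_sum]
  refine Finset.sum_le_sum fun i _ => ?_
  rw [← mul_assoc]
  refine mul_le_mul_of_nonneg_right ?_ (sq_nonneg _)
  rw [← Real.rpow_natCast, ← Real.rpow_natCast, ← Real.rpow_mul ht.1.le]
  refine rpow_mul_rpow_le ht ?_
  have := (abs_le.1 (B.abs_κ_le i)).1
  simp only [Kasner.κ] at this
  push_cast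
  linarith

theorem sqrtX_mul_normχ_le (t : ℝ) :
    m.sqrtX B ξ t * √(m.frame B ξ t).normχ ≤ 2 * m.sqrtE B ξ t := by
  refine le_of_sq_le_sq ?_ (mul_nonneg two_pos.le (sqrtE_nonneg t))
  have h := FrameState.normχ_nonneg (m.frame B ξ t)
  have h2 := FrameState.normk_nonneg (m.frame B ξ t)
  have h3 := sqrtX_sq (m := m) (B := B) (ξ := ξ) t
  rw [mul_pow, mul_pow, Real.sq_sqrt h, sqrtE_sq, FrameState.energy, ← h3]
  nlinarith [sq_nonneg (m.frame B ξ t).g, sq_nonneg (m.sqrtX B ξ t * (m.frame B ξ t).φ)]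

theorem abs_k_le_sqrtE (t : ℝ) (i j : Fin 3) : |(m.frame B ξ t).k i j| ≤ m.sqrtE B ξ t := by
  refine (FrameState.abs_k_le _ i j).trans (Real.sqrt_le_sqrt ?_)
  have h := FrameState.normχ_nonneg (m.frame B ξ t)
  have h3 := sqrtX_sq (m := m) (B := B) (ξ := ξ) t
  rw [FrameState.energy, ← h3]
  nlinarith [sq_nonneg (m.frame B ξ t).g, sq_nonneg (m.sqrtX B ξ t * (m.frame B ξ t).φ),
    mul_nonneg (sq_nonneg (m.sqrtX B ξ t)) h]

theorem sqrtX_mul_φ_le (t : ℝ) : m.sqrtX B ξ t * |m.φ t| ≤ m.sqrtE B ξ t := by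
  refine le_of_sq_le_sq ?_ (sqrtE_nonneg t)
  have h := FrameState.normχ_nonneg (m.frame B ξ t)
  have h2 := FrameState.normk_nonneg (m.frame B ξ t)
  have h3 := sqrtX_sq (m := m) (B := B) (ξ := ξ) t
  rw [mul_pow, sq_abs, sqrtE_sq, FrameState.energy, ← h3]
  have h4 : (m.frame B ξ t).φ = m.φ t := rfl
  rw [h4]
  nlinarith [sq_nonneg (m.frame B ξ t).g, sq_nonneg (m.sqrtX B ξ t * m.φ t),
    mul_nonneg (sq_nonneg (m.sqrtX B ξ t)) h]

namespace IsSol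

variable (hm : m.IsSol B ξ) (hσ : B.sigma ≤ 1 / 10000000) {t : ℝ} (ht : t ∈ Ioc (0 : ℝ) 1)
include hm hσ ht

/-- Square root of `energy_le` with the data bound, since 64² ≥ 4000. -/
theorem sqrtE_le : m.sqrtE B ξ t ≤ 64 * m.data ξ * t ^ (-(500000 * B.sigma)) := by
  have hd := m.data_nonneg ξ
  refine le_of_sq_le_sq ?_ (mul_nonneg (by positivity) (Real.rpow_nonneg ht.1.le _))
  have h2 : (t ^ (-(500000 * B.sigma))) ^ 2 = t ^ (-(1000000 * B.sigma)) := by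
    rw [← Real.rpow_natCast, ← Real.rpow_mul ht.1.le]; congr 1; push_cast; ring
  rw [sqrtE_sq, mul_pow, h2]
  have h3 := hm.energy_le (by linarith) ht
  have h4 := energy_one_le (m := m) (B := B) (ξ := ξ)
  have h5 : 0 ≤ t ^ (-(1000000 * B.sigma)) := Real.rpow_nonneg ht.1.le _
  nlinarith [mul_le_mul_of_nonneg_left h4 h5, mul_nonneg h5 (sq_nonneg (m.data ξ))]

omit hm hσ in
theorem rpow_sub_le (i j : Fin 3) : t ^ (B.q i - B.q j) ≤ t ^ (-(2 * B.sigma)) := by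
  refine Real.rpow_le_rpow_of_exponent_ge ht.1 ht.2 ?_
  have h1 := (abs_le.1 (B.abs_κ_le i)).2
  have h2 := (abs_le.1 (B.abs_κ_le j)).1
  simp only [Kasner.κ] at h1 h2
  linarith

/-- Bounds by the energy lose at most a small power of `t`. -/
theorem rpow_mul_sqrtE_le {α β : ℝ} (h : β ≤ α + 490000 * B.sigma) :
    t ^ α * m.sqrtE B ξ t ≤ 64 * m.data ξ * t ^ (β - 1000000 * B.sigma) := by
  have hd := m.data_nonneg ξ
  calc t ^ α * m.sqrtE B ξ t ≤ t ^ α * (64 * m.data ξ * t ^ (-(500000 * B.sigma))) :=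
        mul_le_mul_of_nonneg_left (hm.sqrtE_le hσ ht) (Real.rpow_nonneg ht.1.le _)
    _ = 64 * m.data ξ * (t ^ α * t ^ (-(500000 * B.sigma))) := by ring
    _ ≤ _ := mul_le_mul_of_nonneg_left (rpow_mul_rpow_le ht (by linarith [B.sigma_nonneg]))
      (by positivity)

theorem sqrtX_mul_sqrtE_le {α : ℝ} (h : -400000 * B.sigma ≤ α) :
    t ^ α * (m.sqrtX B ξ t * m.sqrtE B ξ t)
      ≤ 64 * (len ξ * m.data ξ) * t ^ (2 / 3 - 1000000 * B.sigma) := by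
  have h1 := hm.rpow_mul_sqrtE_le hσ ht (α := α + (2 / 3 - B.sigma)) (β := 2 / 3)
    (by linarith [B.sigma_nonneg])
  have h2 := sqrtX_le (m := m) (B := B) (ξ := ξ) ht
  have he := sqrtE_nonneg (m := m) (B := B) (ξ := ξ) t
  have hα := Real.rpow_nonneg ht.1.le α
  calc t ^ α * (m.sqrtX B ξ t * m.sqrtE B ξ t)
      ≤ t ^ α * (t ^ (2 / 3 - B.sigma) * len ξ * m.sqrtE B ξ t) := by gcongr
    _ = len ξ * (t ^ (α + (2 / 3 - B.sigma)) * m.sqrtE B ξ t) := by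
      rw [Real.rpow_add ht.1]; ring
    _ ≤ len ξ * (64 * m.data ξ * t ^ (2 / 3 - 1000000 * B.sigma)) :=
      mul_le_mul_of_nonneg_left h1 (len_nonneg ξ)
    _ = _ := by ring

/-- This is the quantity that drives the rescaled metric. It exceeds a frame component by at most
t^(-2σ), which the slack between 500000σ and 1000000σ in the exponents absorbs. -/
theorem abs_K_le_rpow (i j : Fin 3) :
    |t ^ (2 * (B.q i - B.q j)) * m.K t i j| ≤ 64 * m.data ξ * t ^ (-(1000000 * B.sigma)) := by
  have h1 : t ^ (2 * (B.q i - B.q j)) * m.K t i j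
      = t ^ (B.q i - B.q j) * (m.frame B ξ t).k i j := by
    simp only [frame]
    rw [← mul_assoc, ← Real.rpow_add ht.1]
    congr 2
    ring
  have h2 := hm.rpow_mul_sqrtE_le hσ ht (α := -(2 * B.sigma)) (β := 0)
    (by linarith [B.sigma_nonneg])
  rw [zero_sub] at h2
  rw [h1, abs_mul, abs_of_nonneg (Real.rpow_nonneg ht.1.le _)]
  exact (mul_le_mul (rpow_sub_le ht i j) (abs_k_le_sqrtE t i j) (abs_nonneg _)
    (Real.rpow_nonneg ht.1.le _)).trans h2

/-- From the first form of the lapse equation: 8g² + 72|k|² ≤ 9²E. -/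
theorem one_add_mul_abs_n_le : (1 + m.sqrtX B ξ t ^ 2) * |m.n t| ≤ 9 * m.sqrtE B ξ t := by
  refine le_of_sq_le_sq ?_ (mul_nonneg (by norm_num) (sqrtE_nonneg t))
  have h := FrameState.lapse_sq_le (hm.constraints ht) B.A_nonneg B.A_sq_le
    (by linarith : B.sigma ≤ 1) B.abs_κ_le
  rw [← sqrtX_sq] at h
  have h1 : (m.frame B ξ t).n = m.n t := rfl
  rw [h1] at h
  rw [mul_pow, sq_abs, ← mul_pow, mul_pow 9, sqrtE_sq]
  refine h.trans ?_
  have h2 := FrameState.normχ_nonneg (m.frame B ξ t)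
  have h3 := FrameState.normk_nonneg (m.frame B ξ t)
  have h4 := sqrtX_sq (m := m) (B := B) (ξ := ξ) t
  rw [FrameState.energy, ← h4]
  nlinarith [sq_nonneg (m.frame B ξ t).g, sq_nonneg (m.sqrtX B ξ t * (m.frame B ξ t).φ),
    mul_nonneg (sq_nonneg (m.sqrtX B ξ t)) h2]

-- The second form of the lapse equation has curvature as its source, which carries the factor
-- t²|η|². Unlike the first form it shows that n decays as t → 0. The constant is 9 + 3, from the
-- double divergence and from the trace.
omit hσ in
theorem one_add_mul_abs_n_le' :
    (1 + m.sqrtX B ξ t ^ 2) * |m.n t| ≤ 12 * (m.sqrtX B ξ t ^ 2 * √(m.frame B ξ t).normχ) := by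
  have h := hm.lapse' t ht
  have hd : ∑ a, t ^ (-(2 * B.q a)) * ξ a * m.w B ξ t a
      = ∑ i, (m.frame B ξ t).η i * (m.frame B ξ t).div i := by
    refine Finset.sum_congr rfl fun i _ => ?_
    rw [div_frame ht.1, show -(2 * B.q i) = -B.q i + -B.q i by ring, Real.rpow_add ht.1]
    simp only [frame]
    ring
  rw [hd, ← freq_frame (m := m) ht.1, ← trχ_frame (ξ := ξ) ht.1] at h
  have h1 := FrameState.abs_η_div_le (m.frame B ξ t)
  have h2 := FrameState.abs_trχ_le (m.frame B ξ t)
  have h3 := FrameState.freq_nonneg (m.frame B ξ t)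
  have h4 : (m.frame B ξ t).x = t ^ 2 := rfl
  have h5 : 0 ≤ m.sqrtX B ξ t ^ 2 := sq_nonneg _
  rw [← abs_of_nonneg (by linarith : 0 ≤ 1 + m.sqrtX B ξ t ^ 2), ← abs_mul, sqrtX_sq, h4,
    show (1 + t ^ 2 * (m.frame B ξ t).freq) * m.n t
      = t ^ 2 * (∑ i, (m.frame B ξ t).η i * (m.frame B ξ t).div i
        - (m.frame B ξ t).freq * (m.frame B ξ t).trχ) by linarith,
    abs_mul, abs_of_nonneg (sq_nonneg t), mul_assoc, mul_left_comm 12]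
  refine mul_le_mul_of_nonneg_left ((abs_sub _ _).trans ?_) (sq_nonneg t)
  rw [abs_mul, abs_of_nonneg h3]
  nlinarith [mul_le_mul_of_nonneg_left h2 h3]

omit hσ in
theorem one_add_mul_abs_n_le_mul :
    (1 + m.sqrtX B ξ t ^ 2) * |m.n t| ≤ 24 * (m.sqrtX B ξ t * m.sqrtE B ξ t) := by
  have h1 := sqrtX_mul_normχ_le (m := m) (B := B) (ξ := ξ) t
  have h2 := hm.one_add_mul_abs_n_le' ht
  nlinarith [mul_le_mul_of_nonneg_left h1 (sqrtX_nonneg (m := m) (B := B) (ξ := ξ) t)]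

omit hm hσ ht in
theorem abs_n_le_one_add (t : ℝ) : |m.n t| ≤ (1 + m.sqrtX B ξ t ^ 2) * |m.n t| :=
  le_mul_of_one_le_left (abs_nonneg _) (by linarith [sq_nonneg (m.sqrtX B ξ t)])

theorem abs_n_le : |m.n t| ≤ 576 * m.data ξ * t ^ (-(1000000 * B.sigma)) := by
  have h2 := hm.rpow_mul_sqrtE_le hσ ht (α := 0) (β := 0) (by linarith [B.sigma_nonneg])
  rw [zero_sub, Real.rpow_zero, one_mul] at h2
  linarith [hm.one_add_mul_abs_n_le hσ ht, abs_n_le_one_add (m := m) (B := B) (ξ := ξ) t]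

theorem abs_n_le_len :
    |m.n t| ≤ 1536 * (len ξ * m.data ξ) * t ^ (2 / 3 - 1000000 * B.sigma) := by
  have h2 := hm.sqrtX_mul_sqrtE_le hσ ht (α := 0) (by linarith [B.sigma_nonneg])
  rw [Real.rpow_zero, one_mul] at h2
  linarith [hm.one_add_mul_abs_n_le_mul ht, abs_n_le_one_add (m := m) (B := B) (ξ := ξ) t]

/-- One factor `sqrtX` is combined with χ into the energy and the other one supplies t^(2/3)|ξ|.
This makes the logarithmic derivative of K integrable down to t = 0. -/
theorem abs_rhsK_le (i j : Fin 3) :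
    |m.rhsK B ξ t i j| ≤ 2200 * (len ξ * m.data ξ) * t ^ (2 / 3 - 1000000 * B.sigma) := by
  set s := m.frame B ξ t with hs
  -- Compared with `dk`, the term (κ_j - κ_i)k is absent: it comes only from the frame rescaling.
  -- Coordinate components of K, not frame components, are the ones that converge.
  have h1 : m.rhsK B ξ t i j = t ^ (B.q j - B.q i) * (s.x * (s.η i * s.η j * s.n
    + 1 / 2 * (s.freq * s.χ i j - s.η j * s.div i - s.η i * s.div j + s.η i * s.η j * s.trχ))
    + if i = j then B.q i * s.n else 0) := by
    rw [hs, freq_frame ht.1, trχ_frame ht.1, div_frame ht.1, div_frame ht.1]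
    obtain ⟨r, hr, h1, h2, h3, h4, h5⟩ := rpow_relations B ht.1
    simp only [frame, rhsK, h1, h2, h4, h5]
    have := (hr i).ne'
    have := (hr j).ne'
    by_cases hij : i = j
    · subst hij
      simp only [if_true]
      field_simp
    · simp only [if_neg hij]
      field_simp
      ring
  have hO := s.freq_nonneg
  have hO2 : s.freq = √s.freq ^ 2 := (Real.sq_sqrt hO).symm
  have hx : 0 ≤ s.x := sq_nonneg t
  have hX := sqrtX_sq (m := m) (B := B) (ξ := ξ) t
  rw [← hs] at hX
  have hχ := s.abs_χ_le
  have hη := s.abs_η_le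
  have hd := s.abs_div_le
  have hH := s.abs_trχ_le
  set a := √s.normχ
  set e := √s.freq
  have he : 0 ≤ e := Real.sqrt_nonneg _
  have ha : 0 ≤ a := Real.sqrt_nonneg _
  have b0 : |s.η i * s.η j| ≤ s.freq := by
    rw [abs_mul, hO2, sq]
    exact mul_le_mul (hη i) (hη j) (abs_nonneg _) he
  have b1 : |s.η i * s.η j * s.n| ≤ s.freq * |s.n| := by
    rw [abs_mul]
    exact mul_le_mul_of_nonneg_right b0 (abs_nonneg _)
  have b2 : |s.freq * s.χ i j| ≤ s.freq * a := by
    rw [abs_mul, abs_of_nonneg hO]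
    exact mul_le_mul_of_nonneg_left (hχ i j) hO
  have b3 : ∀ i j, |s.η j * s.div i| ≤ 3 * (s.freq * a) := fun i j => by
    rw [abs_mul, hO2]
    calc _ ≤ e * (3 * (e * a)) := mul_le_mul (hη j) (hd i) (abs_nonneg _) he
      _ = _ := by ring
  have b4 : |s.η i * s.η j * s.trχ| ≤ 3 * (s.freq * a) := by
    rw [abs_mul]
    calc _ ≤ s.freq * (3 * a) := mul_le_mul b0 hH (abs_nonneg _) hO
      _ = _ := by ring
  have b5 : |s.η i * s.η j * s.n
      + 1 / 2 * (s.freq * s.χ i j - s.η j * s.div i - s.η i * s.div j + s.η i * s.η j * s.trχ)|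
      ≤ s.freq * |s.n| + 5 * (s.freq * a) := by
    have c1 := abs_le.1 b1
    have c2 := abs_le.1 b2
    have c3 := abs_le.1 (b3 i j)
    have c4 := abs_le.1 (b3 j i)
    have c5 := abs_le.1 b4
    rw [abs_le]
    constructor <;> linarith
  have b6 : |if i = j then B.q i * s.n else 0| ≤ |s.n| := by
    split_ifs
    · rw [abs_mul, abs_of_pos (B.q_pos i)]
      exact mul_le_of_le_one_left (abs_nonneg _) (B.q_le_one i)
    · simp
  have b7 : |s.x * (s.η i * s.η j * s.n
      + 1 / 2 * (s.freq * s.χ i j - s.η j * s.div i - s.η i * s.div j + s.η i * s.η j * s.trχ))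
      + if i = j then B.q i * s.n else 0| ≤ 34 * (m.sqrtX B ξ t * m.sqrtE B ξ t) := by
    have c1 := hm.one_add_mul_abs_n_le_mul ht
    have c2 := mul_le_mul_of_nonneg_left (sqrtX_mul_normχ_le (m := m) (B := B) (ξ := ξ) t)
      (sqrtX_nonneg (m := m) (B := B) (ξ := ξ) t)
    have c3 := mul_le_mul_of_nonneg_left b5 hx
    refine (abs_add_le _ _).trans ?_
    rw [abs_mul, abs_of_nonneg hx]
    have c5 : m.sqrtX B ξ t * (m.sqrtX B ξ t * a) = s.x * s.freq * a := by rw [← hX]; ring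
    have c6 : m.sqrtX B ξ t * (m.sqrtX B ξ t * √(m.frame B ξ t).normχ) = s.x * s.freq * a := c5
    rw [c6] at c2
    rw [hX] at c1
    change (1 + s.x * s.freq) * |s.n| ≤ _ at c1
    linarith
  -- The factor t^(q_j - q_i) between frame and coordinates loses at most t^(-2σ); the final
  -- constant covers 34 · 64.
  have h2 := hm.sqrtX_mul_sqrtE_le hσ ht (α := -(2 * B.sigma)) (by linarith [B.sigma_nonneg])
  have h3 : 0 ≤ m.sqrtX B ξ t * m.sqrtE B ξ t := mul_nonneg (sqrtX_nonneg t) (sqrtE_nonneg t)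
  have h4 : 0 ≤ len ξ * m.data ξ * t ^ (2 / 3 - 1000000 * B.sigma) :=
    mul_nonneg (mul_nonneg (len_nonneg ξ) (m.data_nonneg ξ)) (Real.rpow_nonneg ht.1.le _)
  rw [h1, abs_mul, abs_of_nonneg (Real.rpow_nonneg ht.1.le _)]
  have h5 := mul_le_mul (rpow_sub_le (B := B) ht j i) b7 (abs_nonneg _) (Real.rpow_nonneg ht.1.le _)
  linarith

theorem abs_rhsg_le :
    |m.rhsg B ξ t| ≤ 1600 * (len ξ * m.data ξ) * t ^ (2 / 3 - 1000000 * B.sigma) := by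
  have hA : B.A ≤ 1 := by nlinarith [B.A_sq_le]
  have h1 := sqrtX_mul_φ_le (m := m) (B := B) (ξ := ξ) t
  have h2 := hm.sqrtX_mul_sqrtE_le hσ ht (α := 0) (by linarith [B.sigma_nonneg])
  rw [Real.rpow_zero, one_mul] at h2
  have h3 := hm.abs_n_le_len hσ ht
  have h4 : t ^ 2 * symb B ξ t = m.sqrtX B ξ t ^ 2 := by
    rw [sqrtX_sq, freq_frame ht.1]; rfl
  rw [rhsg, h4]
  have h5 : |m.sqrtX B ξ t ^ 2 * m.φ t| ≤ m.sqrtX B ξ t * m.sqrtE B ξ t := by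
    rw [abs_mul, abs_of_nonneg (sq_nonneg _), sq, mul_assoc]
    exact mul_le_mul_of_nonneg_left h1 (sqrtX_nonneg t)
  have h6 : |B.A * m.n t| ≤ |m.n t| := by
    rw [abs_mul, abs_of_nonneg B.A_nonneg]
    exact mul_le_of_le_one_left (abs_nonneg _) hA
  refine (abs_sub _ _).trans ?_
  rw [abs_neg]
  linarith

end IsSol

end Mode

/-! ### Decay of the metric and improved decay of the lapse. -/

namespace Mode

variable {m : Mode} {ξ : Fin 3 → ℝ} {B : Kasner}

namespace IsSol

variable (hm : m.IsSol B ξ) (hσ : B.sigma ≤ 1 / 10000000) {t : ℝ} (ht : t ∈ Ioc (0 : ℝ) 1)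
include hm ht

/-- The factor t^(-2q_j) removes the undifferentiated h from its evolution equation, so the rescaled
component is found by integrating K and n. -/
theorem hasDeriv_rescaled_h (i j : Fin 3) :
    HasDerivWithinAt (fun s => s ^ (-(2 * B.q j)) * m.h s i j)
      (t⁻¹ * (-(2 * (t ^ (2 * (B.q i - B.q j)) * m.K t i j))
        + if i = j then 2 * B.q i * m.n t else 0)) (Ioc 0 1) t := by
  have h := (hasDerivWithinAt_rpow ht (-(2 * B.q j))).mul (hm.evol_h t ht i j)
  convert! h using 1
  have e1 : t ^ (2 * (B.q i - B.q j)) = t ^ (-(2 * B.q j)) * t ^ (2 * B.q i) := by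
    rw [← Real.rpow_add ht.1]; congr 1; ring
  by_cases hij : i = j
  · subst hij
    have e2 : t ^ (-(2 * B.q i)) * t ^ (2 * B.q i) = 1 := by
      rw [← Real.rpow_add ht.1]; simp
    rw [e1, if_pos rfl, if_pos rfl]
    linear_combination (-2 * t⁻¹ * B.q i * m.n t) * e2
  · rw [e1, if_neg hij, if_neg hij]
    ring

omit hm ht in
theorem rpow_two_mul_le (B : Kasner) {t : ℝ} (ht : t ∈ Ioc (0 : ℝ) 1) (j : Fin 3) :
    t ^ (2 * B.q j) ≤ t ^ (2 / 3 - 2 * B.sigma) := by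
  refine Real.rpow_le_rpow_of_exponent_ge ht.1 ht.2 ?_
  have h1 := (abs_le.1 (B.abs_κ_le j)).2
  simp only [Kasner.κ] at h1
  linarith

omit hm ht in
theorem rpow_two_mul_sub_le (B : Kasner) {t : ℝ} (ht : t ∈ Ioc (0 : ℝ) 1) (i j : Fin 3) :
    t ^ (2 * (B.q i - B.q j)) ≤ t ^ (-(4 * B.sigma)) := by
  refine Real.rpow_le_rpow_of_exponent_ge ht.1 ht.2 ?_
  have h1 := (abs_le.1 (B.abs_κ_le i)).2
  have h2 := (abs_le.1 (B.abs_κ_le j)).1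
  simp only [Kasner.κ] at h1 h2
  linarith

omit hm ht in
theorem abs_diag_le (i j : Fin 3) (y : ℝ) : |if i = j then 2 * B.q i * y else 0| ≤ 2 * |y| := by
  split_ifs
  · rw [abs_mul, abs_mul, abs_two, abs_of_pos (B.q_pos i)]
    nlinarith [B.q_le_one i, abs_nonneg y]
  · simp

include hσ

theorem abs_h_le (i j : Fin 3) :
    |m.h t i j| ≤ 1280 * t ^ (2 / 3 - 2000000 * B.sigma)
      * (|m.h 1 i j| + sigmaLoss B.sigma t * m.data ξ) := by
  have hd := m.data_nonneg ξ
  have hX := fun t ht => hm.hasDeriv_rescaled_h (t := t) ht i j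
  have hX' : ∀ t ∈ Ioc (0 : ℝ) 1, |-(2 * (t ^ (2 * (B.q i - B.q j)) * m.K t i j))
        + if i = j then 2 * B.q i * m.n t else 0|
      ≤ 1280 * m.data ξ * t ^ (-(1000000 * B.sigma)) := fun t ht => by
    have h1 := hm.abs_K_le_rpow hσ ht i j
    have h2 := hm.abs_n_le hσ ht
    refine (abs_add_le _ _).trans ?_
    rw [abs_neg, abs_mul, abs_two]
    linarith [abs_diag_le (B := B) i j (m.n t)]
  have key : |t ^ (-(2 * B.q j)) * m.h t i j| ≤ 1280 * t ^ (-(1000000 * B.sigma))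
      * (|m.h 1 i j| + sigmaLoss B.sigma t * m.data ξ) := by
    -- The logarithmic derivative is O(t^(-10⁶σ)). Its integral is logarithmic for σ = 0 and
    -- O(t^(-10⁶σ)/σ) for σ > 0, which are the two cases of `sigmaLoss`. The constant 1280 is 2 · 64
    -- + 2 · 576, from K and n.
    rcases eq_or_ne B.sigma 0 with h0 | h0
    · rw [h0] at hX'
      simp only [mul_zero, neg_zero, Real.rpow_zero, mul_one] at hX'
      have := abs_le_of_abs_deriv_le_log hX hX' ht
      rw [Real.one_rpow, one_mul] at this
      rw [h0, sigmaLoss, if_pos rfl, mul_zero, neg_zero, Real.rpow_zero, mul_one]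
      nlinarith [abs_nonneg (m.h 1 i j), abs_nonneg (Real.log t)]
    · have hpos : 0 < B.sigma := lt_of_le_of_ne B.sigma_nonneg (Ne.symm h0)
      have := abs_le_of_abs_deriv_le_rpow (by positivity : 0 < 1000000 * B.sigma)
        (by positivity) hX hX' ht
      rw [Real.one_rpow, one_mul] at this
      rw [sigmaLoss, if_neg h0]
      have h1 : 1 ≤ t ^ (-(1000000 * B.sigma)) :=
        Real.one_le_rpow_of_pos_of_le_one_of_nonpos ht.1 ht.2 (by linarith)
      have h2 : 1280 * m.data ξ / (1000000 * B.sigma) ≤ 1280 * (1 / B.sigma * m.data ξ) := by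
        rw [div_le_iff₀ (by positivity)]
        field_simp
        nlinarith
      have h3 := mul_le_mul_of_nonneg_right h2 (by linarith : 0 ≤ t ^ (-(1000000 * B.sigma)))
      nlinarith [abs_nonneg (m.h 1 i j)]
  have e : m.h t i j = t ^ (2 * B.q j) * (t ^ (-(2 * B.q j)) * m.h t i j) := by
    rw [← mul_assoc, ← Real.rpow_add ht.1]; simp
  have hL : 0 ≤ |m.h 1 i j| + sigmaLoss B.sigma t * m.data ξ :=
    add_nonneg (abs_nonneg _) (mul_nonneg (zero_le_one.trans
      (one_le_sigmaLoss B.sigma_nonneg (by linarith) t)) hd)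
  rw [e, abs_mul, abs_of_nonneg (Real.rpow_nonneg ht.1.le _)]
  calc _ ≤ t ^ (2 / 3 - 2 * B.sigma) * (1280 * t ^ (-(1000000 * B.sigma))
        * (|m.h 1 i j| + sigmaLoss B.sigma t * m.data ξ)) :=
        mul_le_mul (rpow_two_mul_le B ht j) key (abs_nonneg _) (Real.rpow_nonneg ht.1.le _)
    _ = 1280 * (t ^ (2 / 3 - 2 * B.sigma) * t ^ (-(1000000 * B.sigma)))
        * (|m.h 1 i j| + sigmaLoss B.sigma t * m.data ξ) := by ring
    _ ≤ _ := by
      gcongr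
      exact rpow_mul_rpow_le ht (by linarith [B.sigma_nonneg])

/-- The datum |ξ||h(1)| is part of the mode's data, so only the contribution of K and n costs an
extra factor |ξ|. -/
theorem len_mul_abs_h_le (i j : Fin 3) :
    len ξ * |m.h t i j| ≤ 1280 * t ^ (2 / 3 - 2000000 * B.sigma)
      * (sigmaLoss B.sigma t * ((1 + len ξ) * m.data ξ)) := by
  have h1 := mul_le_mul_of_nonneg_left (hm.abs_h_le hσ ht i j) (len_nonneg ξ)
  have h2 : len ξ * |m.h 1 i j| ≤ m.data ξ :=
    (mul_le_mul_of_nonneg_left (Real.abs_le_sqrt (FrameState.sq_le_sum_sq (m.h 1) i j))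
      (len_nonneg ξ)).trans (m.len_mul_h_one_le ξ)
  have h3 := one_le_sigmaLoss B.sigma_nonneg (by linarith : B.sigma ≤ 1) t
  have h4 := m.data_nonneg ξ
  refine h1.trans ?_
  rw [mul_left_comm]
  refine mul_le_mul_of_nonneg_left ?_ (mul_nonneg (by norm_num) (Real.rpow_nonneg ht.1.le _))
  nlinarith [mul_le_mul_of_nonneg_right h3 h4]

/-- The improved metric bound is inserted into the second lapse equation. Of the factor |ξ|² in
t²|η|² ≤ t^(4/3-2σ)|ξ|², one power is used to estimate χ, so two derivatives are lost in total. The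
powers t^(-2/3) from the frame and t^(2/3) from h cancel, which leaves t^(4/3). -/
theorem abs_n_le_sigmaLoss : |m.n t| ≤ 100000 * (sigmaLoss B.sigma t
    * ((1 + len ξ ^ 2) * m.data ξ)) * t ^ (4 / 3 - 3000000 * B.sigma) := by
  have hL := one_le_sigmaLoss B.sigma_nonneg (by linarith : B.sigma ≤ 1) t
  have hd := m.data_nonneg ξ
  have hz := len_nonneg ξ
  set P := t ^ (-(2 / 3) - 2 * B.sigma) with hP
  have hP0 : 0 ≤ P := Real.rpow_nonneg ht.1.le _
  set Q := t ^ (2 / 3 - 2000000 * B.sigma) with hQ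
  have hQ0 : 0 ≤ Q := Real.rpow_nonneg ht.1.le _
  set V := sigmaLoss B.sigma t * ((1 + len ξ) * m.data ξ) with hV
  have hV0 : 0 ≤ V := by positivity
  have h1 : ∀ i j, len ξ * |(m.frame B ξ t).χ i j| ≤ P * (1280 * Q * V) := fun i j => by
    simp only [frame]
    rw [abs_mul, abs_of_nonneg (Real.rpow_nonneg ht.1.le _), mul_left_comm]
    refine mul_le_mul ?_ (hm.len_mul_abs_h_le hσ ht i j) (mul_nonneg hz (abs_nonneg _)) hP0
    refine Real.rpow_le_rpow_of_exponent_ge ht.1 ht.2 ?_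
    have h1 := (abs_le.1 (B.abs_κ_le i)).1
    have h2 := (abs_le.1 (B.abs_κ_le j)).1
    simp only [Kasner.κ] at h1 h2
    linarith
  have h2 : len ξ * √(m.frame B ξ t).normχ ≤ 3 * (P * (1280 * Q * V)) := by
    refine le_of_sq_le_sq ?_ (by positivity)
    rw [mul_pow, Real.sq_sqrt (FrameState.normχ_nonneg _), FrameState.normχ, Finset.mul_sum]
    have : ∀ i j, len ξ ^ 2 * (m.frame B ξ t).χ i j ^ 2 ≤ (P * (1280 * Q * V)) ^ 2 := fun i j => by
      rw [← sq_abs ((m.frame B ξ t).χ i j), ← mul_pow]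
      exact pow_le_pow_left₀ (mul_nonneg hz (abs_nonneg _)) (h1 i j) 2
    simp only [Fin.sum_univ_three]
    linarith [this 0 0, this 0 1, this 0 2, this 1 0, this 1 1, this 1 2, this 2 0, this 2 1,
      this 2 2]
  have h3 := hm.one_add_mul_abs_n_le' ht
  have h4 := abs_n_le_one_add (m := m) (B := B) (ξ := ξ) t
  have h5 := sqrtX_le (m := m) (B := B) (ξ := ξ) ht
  set R := t ^ (2 / 3 - B.sigma) with hR
  have hR0 : 0 ≤ R := Real.rpow_nonneg ht.1.le _
  have h6 : m.sqrtX B ξ t ^ 2 ≤ R ^ 2 * len ξ ^ 2 := by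
    rw [← mul_pow]
    exact pow_le_pow_left₀ (sqrtX_nonneg t) h5 2
  have h7 : m.sqrtX B ξ t ^ 2 * √(m.frame B ξ t).normχ
      ≤ R ^ 2 * len ξ * (3 * (P * (1280 * Q * V))) := by
    calc _ ≤ R ^ 2 * len ξ ^ 2 * √(m.frame B ξ t).normχ :=
          mul_le_mul_of_nonneg_right h6 (Real.sqrt_nonneg _)
      _ = R ^ 2 * len ξ * (len ξ * √(m.frame B ξ t).normχ) := by ring
      _ ≤ _ := mul_le_mul_of_nonneg_left h2 (by positivity)
  have h8 : R ^ 2 * (P * Q) ≤ t ^ (4 / 3 - 3000000 * B.sigma) := by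
    rw [hR, hP, hQ, ← Real.rpow_natCast, ← Real.rpow_mul ht.1.le, ← Real.rpow_add ht.1]
    refine rpow_mul_rpow_le ht ?_
    push_cast
    linarith [B.sigma_nonneg]
  have h9 : len ξ * V ≤ 2 * (sigmaLoss B.sigma t * ((1 + len ξ ^ 2) * m.data ξ)) := by
    have : len ξ * (1 + len ξ) ≤ 2 * (1 + len ξ ^ 2) := by nlinarith [sq_nonneg (len ξ - 1)]
    have := mul_le_mul_of_nonneg_right this (by positivity : 0 ≤ sigmaLoss B.sigma t * m.data ξ)
    rw [hV]
    linarith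
  have h10 := mul_le_mul h8 h9 (by positivity) (Real.rpow_nonneg ht.1.le _)
  have h11 : 0 ≤ t ^ (4 / 3 - 3000000 * B.sigma)
      * (sigmaLoss B.sigma t * ((1 + len ξ ^ 2) * m.data ξ)) :=
    mul_nonneg (Real.rpow_nonneg ht.1.le _) (by positivity)
  linarith

end IsSol

/-! ### Limits of a mode at the singularity. -/

/-- The asymptotic state of a mode at the singularity. -/
structure Asymptotics (m : Mode) (B : Kasner) (ξ : Fin 3 → ℝ) where
  K : Fin 3 → Fin 3 → ℝ
  h : Fin 3 → Fin 3 → ℝ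
  Ψ : ℝ
  tendsto_K : ∀ i j, Tendsto (fun t => m.K t i j) (𝓝[>] 0) (𝓝 (K i j))
  tendsto_h : ∀ i j, Tendsto (fun t => t ^ (-(2 * B.q j)) * m.h t i j
    + metricCorrection B t i j * K i j) (𝓝[>] 0) (𝓝 (h i j))
  tendsto_Ψ : Tendsto (fun t => m.f t - B.A * m.n t) (𝓝[>] 0) (𝓝 Ψ)
  abs_sub_K_le : ∀ t ∈ Ioc (0 : ℝ) 1, ∀ i j, |m.K t i j - K i j|
    ≤ 4400 * (len ξ * m.data ξ) * t ^ (2 / 3 - 1000000 * B.sigma)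
  abs_sub_Ψ_le : ∀ t ∈ Ioc (0 : ℝ) 1, |m.f t - Ψ|
    ≤ 4800 * (len ξ * m.data ξ) * t ^ (2 / 3 - 1000000 * B.sigma)
  abs_sub_h_le : ∀ t ∈ Ioc (0 : ℝ) 1, ∀ i j, |t ^ (-(2 * B.q j)) * m.h t i j
    + metricCorrection B t i j * K i j - h i j|
    ≤ 36000 * (len ξ * m.data ξ) * t ^ (2 / 3 - 2000000 * B.sigma)
  abs_φ_sub_le : ∀ t ∈ Ioc (0 : ℝ) 1, |m.φ t - Real.log t * Ψ|
    ≤ |m.φ 1| + 20000 * (len ξ * m.data ξ)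
  symm_h : ∀ i j, h i j = h j i
  tr_K : ∑ a, K a a = 0

namespace IsSol
variable (hm : m.IsSol B ξ) (hσ : B.sigma ≤ 1 / 10000000)
include hm hσ

/-- After subtracting the explicit leading behaviour each quantity has logarithmic derivative
bounded by a positive power of t, so `exists_tendsto_of_abs_deriv_le` applies. -/
theorem nonempty_asymptotics : Nonempty (Asymptotics m B ξ) := by
  have hd := m.data_nonneg ξ
  have hz := len_nonneg ξ
  have hzd : 0 ≤ len ξ * m.data ξ := mul_nonneg hz hd
  have hs0 := B.sigma_nonneg
  have hα : 1 / 2 ≤ 2 / 3 - 1000000 * B.sigma := by linarith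
  have hα' : 0 < 2 / 3 - 1000000 * B.sigma := by linarith
  have hβ : 1 / 3 ≤ 2 / 3 - 2000000 * B.sigma := by linarith
  have hβ' : 0 < 2 / 3 - 2000000 * B.sigma := by linarith
  -- The smallness of σ keeps the two exponents above 1/2 and 1/3, so integration costs at most the
  -- factors 2 and 3.
  have div_le : ∀ {M : ℝ}, 0 ≤ M → M / (2 / 3 - 1000000 * B.sigma) ≤ 2 * M := fun hM => by
    rw [div_le_iff₀ hα']; nlinarith
  have div_le' : ∀ {M : ℝ}, 0 ≤ M → M / (2 / 3 - 2000000 * B.sigma) ≤ 3 * M := fun hM => by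
    rw [div_le_iff₀ hβ']; nlinarith
  have hK := fun i j => exists_tendsto_of_abs_deriv_le hα' (by positivity)
    (fun t ht => hm.evol_K t ht i j) (fun t ht => hm.abs_rhsK_le hσ ht i j)
  choose K tK bK using hK
  have bK' : ∀ t ∈ Ioc (0 : ℝ) 1, ∀ i j, |m.K t i j - K i j|
      ≤ 4400 * (len ξ * m.data ξ) * t ^ (2 / 3 - 1000000 * B.sigma) := fun t ht i j => by
    refine (bK i j t ht).trans (mul_le_mul_of_nonneg_right ?_ (Real.rpow_nonneg ht.1.le _))
    refine (div_le (by positivity)).trans_eq (by ring)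
  obtain ⟨Ψ, tΨ, bΨ⟩ := exists_tendsto_of_abs_deriv_le hα' (by positivity) hm.wave
    (fun t ht => hm.abs_rhsg_le hσ ht)
  have bΨ' : ∀ t ∈ Ioc (0 : ℝ) 1, |m.f t - Ψ|
      ≤ 4800 * (len ξ * m.data ξ) * t ^ (2 / 3 - 1000000 * B.sigma) := fun t ht => by
    have hA : B.A ≤ 1 := by nlinarith [B.A_sq_le]
    have h1 := (bΨ t ht).trans (mul_le_mul_of_nonneg_right (div_le (by positivity))
      (Real.rpow_nonneg ht.1.le _))
    have h2 := hm.abs_n_le_len hσ ht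
    have h3 : |B.A * m.n t| ≤ |m.n t| := by
      rw [abs_mul, abs_of_nonneg B.A_nonneg]
      exact mul_le_of_le_one_left (abs_nonneg _) hA
    have h4 : 0 ≤ len ξ * m.data ξ * t ^ (2 / 3 - 1000000 * B.sigma) :=
      mul_nonneg hzd (Real.rpow_nonneg ht.1.le _)
    rw [show m.f t - Ψ = (m.f t - B.A * m.n t - Ψ) + B.A * m.n t by ring]
    refine (abs_add_le _ _).trans ?_
    linarith
  -- The correction term replaces K by K minus its limit in the derivative. The constant 12000
  -- covers 2 · 4400 from this difference and 2 · 1536 from n; the factor t^(2(q_i - q_j)) ≤ t^(-4σ)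
  -- accounts for the larger loss in the exponent.
  have hh := fun i j => exists_tendsto_of_abs_deriv_le (M := 12000 * (len ξ * m.data ξ)) hβ'
    (by positivity)
    (X := fun t => t ^ (-(2 * B.q j)) * m.h t i j + metricCorrection B t i j * K i j)
    (X' := fun t => -(2 * (t ^ (2 * (B.q i - B.q j)) * (m.K t i j - K i j)))
        + if i = j then 2 * B.q i * m.n t else 0)
    (fun t ht => by
      convert! (hm.hasDeriv_rescaled_h ht i j).add
        ((hasDerivWithinAt_metricCorrection B ht i j).mul_const (K i j)) using 1
      ring)
    (fun t ht => by
      have h1 := bK' t ht i j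
      have h2 := hm.abs_n_le_len hσ ht
      have h3 := rpow_two_mul_sub_le B ht i j
      have h4 := abs_diag_le (B := B) i j (m.n t)
      have h5 : t ^ (2 / 3 - 1000000 * B.sigma) ≤ t ^ (2 / 3 - 2000000 * B.sigma) :=
        Real.rpow_le_rpow_of_exponent_ge ht.1 ht.2 (by linarith)
      have h6 : |t ^ (2 * (B.q i - B.q j)) * (m.K t i j - K i j)|
          ≤ 4400 * (len ξ * m.data ξ) * t ^ (2 / 3 - 2000000 * B.sigma) := by
        rw [abs_mul, abs_of_nonneg (Real.rpow_nonneg ht.1.le _)]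
        calc _ ≤ t ^ (-(4 * B.sigma)) * (4400 * (len ξ * m.data ξ)
              * t ^ (2 / 3 - 1000000 * B.sigma)) :=
              mul_le_mul h3 h1 (abs_nonneg _) (Real.rpow_nonneg ht.1.le _)
          _ = 4400 * (len ξ * m.data ξ)
              * (t ^ (-(4 * B.sigma)) * t ^ (2 / 3 - 1000000 * B.sigma)) := by ring
          _ ≤ _ := mul_le_mul_of_nonneg_left (rpow_mul_rpow_le ht (by linarith)) (by positivity)
      refine (abs_add_le _ _).trans ?_
      rw [abs_neg, abs_mul, abs_two]
      have h7 := mul_le_mul_of_nonneg_left h5 hzd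
      have h8 : 0 ≤ len ξ * m.data ξ * t ^ (2 / 3 - 2000000 * B.sigma) :=
        mul_nonneg hzd (Real.rpow_nonneg ht.1.le _)
      linarith)
  choose h th bh using hh
  have bφ : ∀ t ∈ Ioc (0 : ℝ) 1, |m.φ t - Real.log t * Ψ|
      ≤ |m.φ 1| + 20000 * (len ξ * m.data ξ) := fun t ht => by
    obtain ⟨L, -, bL⟩ := exists_tendsto_of_abs_deriv_le hα' (by positivity)
      (X := fun t => m.φ t - Real.log t * Ψ) (X' := fun t => m.f t - Ψ)
      (fun t ht => by
        convert! (hm.dt_φ t ht).sub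
          ((Real.hasDerivAt_log ht.1.ne').mul_const Ψ).hasDerivWithinAt using 1
        ring) bΨ'
    have h1 := bL t ht
    have h2 := bL 1 ⟨one_pos, le_rfl⟩
    have h3 : t ^ (2 / 3 - 1000000 * B.sigma) ≤ 1 := Real.rpow_le_one ht.1.le ht.2 hα'.le
    have h4 := div_le (by positivity : 0 ≤ 4800 * (len ξ * m.data ξ))
    have h5 : (0 : ℝ) ≤ 4800 * (len ξ * m.data ξ) / (2 / 3 - 1000000 * B.sigma) := by positivity
    rw [Real.one_rpow, mul_one, Real.log_one, zero_mul, sub_zero] at h2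
    have h6 := mul_le_of_le_one_right h5 h3
    have h7 := abs_le.1 h1
    have h8 := abs_le.1 h2
    have h9 := neg_abs_le (m.φ 1)
    have h10 := le_abs_self (m.φ 1)
    rw [abs_le]
    constructor <;> linarith
  refine ⟨⟨K, h, Ψ, tK, th, tΨ, bK', bΨ', fun t ht i j => ?_, bφ, fun i j => ?_, ?_⟩⟩
  · refine (bh i j t ht).trans (mul_le_mul_of_nonneg_right ?_ (Real.rpow_nonneg ht.1.le _))
    exact (div_le' (by positivity)).trans_eq (by ring)
  -- Symmetry of the limiting metric is not immediate, because h_ij is rescaled by t^(-2q_j) and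
  -- h_ji by t^(-2q_i).
  · by_cases hq : B.q i = B.q j
    · have eK : K i j = K j i := by
        refine tendsto_nhds_unique_of_eventuallyEq (tK i j) (tK j i) ?_
        filter_upwards [Ioc_mem_nhdsGT one_pos] with t ht
        have := hm.sub_K_eq ht i j
        rw [hq, sub_self, zero_mul, eq_comm, sub_eq_zero] at this
        exact mul_left_cancel₀ (Real.rpow_pos_of_pos ht.1 _).ne' this
      refine tendsto_nhds_unique_of_eventuallyEq (th i j) (th j i) ?_
      filter_upwards [Ioc_mem_nhdsGT one_pos] with t ht
      rw [hm.symm t ht i j, eK, metricCorrection, metricCorrection, if_pos hq, if_pos hq.symm, hq]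
    -- For distinct exponents the limit of `sub_K_eq` determines h_ij from the limit of K by a
    -- formula that is symmetric in i and j.
    · have key : ∀ i j, B.q i ≠ B.q j → (B.q j - B.q i) * h i j = K i j - K j i := by
        intro i j hq
        have hlim : Tendsto (fun t => t ^ (2 * (B.q i - B.q j)) * (m.K t i j - K i j))
            (𝓝[>] 0) (𝓝 0) := by
          have h0 : Tendsto (fun t : ℝ => 4400 * (len ξ * m.data ξ)
              * t ^ (2 / 3 - 2000000 * B.sigma)) (𝓝[>] 0) (𝓝 (4400 * (len ξ * m.data ξ) * 0)) := by
            refine Tendsto.const_mul _ ?_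
            have := (Real.continuousAt_rpow_const 0 (2 / 3 - 2000000 * B.sigma)
              (Or.inr hβ'.le)).tendsto
            rw [Real.zero_rpow hβ'.ne'] at this
            exact this.mono_left nhdsWithin_le_nhds
          rw [mul_zero] at h0
          refine squeeze_zero_norm' ?_ h0
          filter_upwards [Ioc_mem_nhdsGT one_pos] with t ht
          rw [Real.norm_eq_abs, abs_mul, abs_of_nonneg (Real.rpow_nonneg ht.1.le _)]
          calc _ ≤ t ^ (-(4 * B.sigma)) * (4400 * (len ξ * m.data ξ)
                * t ^ (2 / 3 - 1000000 * B.sigma)) :=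
                mul_le_mul (rpow_two_mul_sub_le B ht i j) (bK' t ht i j) (abs_nonneg _)
                  (Real.rpow_nonneg ht.1.le _)
            _ = 4400 * (len ξ * m.data ξ)
                * (t ^ (-(4 * B.sigma)) * t ^ (2 / 3 - 1000000 * B.sigma)) := by ring
            _ ≤ _ := mul_le_mul_of_nonneg_left (rpow_mul_rpow_le ht (by linarith)) (by positivity)
        have hlim2 := (hlim.sub (tK j i)).add_const (K i j)
        have hlim3 := (th i j).const_mul (B.q j - B.q i)
        have := tendsto_nhds_unique_of_eventuallyEq hlim3 hlim2 (by
          filter_upwards [Ioc_mem_nhdsGT one_pos] with t ht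
          have e := hm.sub_K_eq ht i j
          have e1 : t ^ (2 * (B.q i - B.q j)) = t ^ (-(2 * B.q j)) * t ^ (2 * B.q i) := by
            rw [← Real.rpow_add ht.1]; congr 1; ring
          have e2 : t ^ (-(2 * B.q j)) * t ^ (2 * B.q j) = 1 := by
            rw [← Real.rpow_add ht.1]; simp
          have e3 : (B.q j - B.q i) * metricCorrection B t i j
              = -(t ^ (2 * (B.q i - B.q j)) - 1) := by
            rw [metricCorrection, if_neg hq]
            have := sub_ne_zero.2 hq
            field_simp
            ring
          rw [mul_add, ← mul_assoc _ (metricCorrection B t i j), e3, e1]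
          linear_combination t ^ (-(2 * B.q j)) * e - m.K t j i * e2)
        linarith
      have h1 := key i j hq
      have h2 := key j i (Ne.symm hq)
      have h3 : (B.q j - B.q i) * h i j = (B.q j - B.q i) * h j i := by linarith
      exact mul_left_cancel₀ (sub_ne_zero.2 (Ne.symm hq)) h3
  · refine tendsto_nhds_unique_of_eventuallyEq
      (tendsto_finsetSum Finset.univ fun a _ => tK a a) tendsto_const_nhds ?_
    filter_upwards [Ioc_mem_nhdsGT one_pos] with t ht
    exact hm.tr_K t ht

end IsSol
end Mode

/-! ### Fourier analysis on the torus -/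

/-- Mathlib's Haar probability measure on the torus. -/
def haarT3 : Measure T3 := Measure.pi fun _ => AddCircle.haarAddCircle

theorem volume_eq_haarT3 : (volume : Measure T3) = haarT3 := by
  rw [volume_pi, haarT3]
  congr 1
  funext i
  rw [AddCircle.volume_eq_smul_haarAddCircle, ENNReal.ofReal_one, one_smul]

open UnitAddTorus ComplexConjugate

theorem hasSum_conj_mul (f u : T3 → ℂ) (hf : MemLp f 2 volume) (hu : MemLp u 2 volume) :
    HasSum (fun k : Fin 3 → ℤ => conj (∫ x, mFourier (-k) x * f x) * ∫ x, mFourier (-k) x * u x)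
      (∫ x, conj (f x) * u x) := by
  rw [volume_eq_haarT3] at *
  have h := hasSum_prod_mFourierCoeff (d := Fin 3) (hf.toLp f) (hu.toLp u)
  have e1 : ∀ {v : T3 → ℂ} (hv : MemLp v 2 haarT3) (k : Fin 3 → ℤ),
      mFourierCoeff (hv.toLp v) k = ∫ x, mFourier (-k) x * v x ∂haarT3 := fun hv k =>
    integral_congr_ae (μ := haarT3) (by
      filter_upwards [hv.coeFn_toLp] with x hx
      rw [hx, smul_eq_mul])
  have e2 := integral_congr_ae (μ := haarT3)
    (f := fun t => conj (hf.toLp f t) * hu.toLp u t) (g := fun x => conj (f x) * u x) (by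
      filter_upwards [hf.coeFn_toLp, hu.coeFn_toLp] with x hx hx'
      rw [hx, hx'])
  rw [← e2]
  refine h.congr_fun fun k => ?_
  exact (congrArg₂ (fun a b => conj a * b) (e1 hf k) (e1 hu k)).symm

theorem exists_memLp_of_summable (c : (Fin 3 → ℤ) → ℂ) (hc : Summable fun k => ‖c k‖ ^ 2) :
    ∃ f : T3 → ℂ, MemLp f 2 volume ∧ ∀ k, ∫ x, mFourier (-k) x * f x = c k := by
  rw [volume_eq_haarT3]
  have hmem : Memℓp c 2 := by
    rw [memℓp_gen_iff (by norm_num)]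
    simpa using hc
  let F := (mFourierBasis (d := Fin 3)).repr.symm ⟨c, hmem⟩
  refine ⟨F, Lp.memLp F, fun k => ?_⟩
  have h := mFourierBasis_repr F k
  rw [LinearIsometryEquiv.apply_symm_apply] at h
  exact h.symm

/-- The positive and negative parts of f are densities of two finite measures with equal integrals
of bounded continuous functions. Such measures coincide, hence so do the densities. -/
theorem ae_eq_zero_of_forall_integral_continuous {f : T3 → ℝ} (hf : Integrable f)
    (h : ∀ u : C(T3, ℝ), ∫ x, f x * u x = 0) : f =ᵐ[volume] 0 := by
  have hm : AEMeasurable (fun x => ENNReal.ofReal (f x)) volume := hf.aemeasurable.ennreal_ofReal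
  have hm' : AEMeasurable (fun x => ENNReal.ofReal (-f x)) volume :=
    hf.aemeasurable.neg.ennreal_ofReal
  have hfin : ∫⁻ x, ENNReal.ofReal (f x) ≠ ⊤ := hf.lintegral_lt_top.ne
  have hfin' : ∫⁻ x, ENNReal.ofReal (-f x) ≠ ⊤ := hf.neg.lintegral_lt_top.ne
  have := isFiniteMeasure_withDensity hfin
  have := isFiniteMeasure_withDensity hfin'
  have hb : ∀ u : BoundedContinuousFunction T3 ℝ, ∀ v : T3 → ℝ, Integrable v →
      Integrable fun x => v x * u x := fun u v hv =>
    hv.mul_bdd (c := ‖u‖) u.continuous.aestronglyMeasurable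
      (ae_of_all _ fun x => u.norm_coe_le_norm x)
  have e : volume.withDensity (fun x => ENNReal.ofReal (f x))
      = volume.withDensity (fun x => ENNReal.ofReal (-f x)) := by
    refine ext_of_forall_integral_eq_of_IsFiniteMeasure fun u => ?_
    rw [integral_withDensity_eq_integral_toReal_smul₀ hm (ae_of_all _ fun x => ENNReal.ofReal_lt_top),
      integral_withDensity_eq_integral_toReal_smul₀ hm' (ae_of_all _ fun x => ENNReal.ofReal_lt_top)]
    have h1 := h u.toContinuousMap
    simp only [smul_eq_mul, ENNReal.toReal_ofReal']
    rw [← sub_eq_zero, ← integral_sub (hb u _ hf.pos_part) (hb u (fun x => max (-f x) 0) hf.neg.pos_part)]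
    refine Eq.trans ?_ h1
    refine integral_congr_ae (ae_of_all _ fun x => ?_)
    change max (f x) 0 * u x - max (-f x) 0 * u x = f x * u x
    rw [← sub_mul, max_zero_sub_eq_self]
  have e2 := (withDensity_eq_iff hm hm' hfin).1 e
  filter_upwards [e2] with x hx
  rcases le_total 0 (f x) with h0 | h0
  · rw [ENNReal.ofReal_of_nonpos (neg_nonpos.2 h0), ENNReal.ofReal_eq_zero] at hx
    exact le_antisymm hx h0
  · rw [ENNReal.ofReal_of_nonpos h0, eq_comm, ENNReal.ofReal_eq_zero] at hx
    exact le_antisymm h0 (neg_nonpos.1 hx)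

/-- Integration against an L¹ function is a continuous functional on the continuous functions, in
which the characters span a dense subspace. L¹ uniqueness is needed since the fields are only
integrable. -/
theorem ae_eq_zero_of_forall_fourier {f : T3 → ℝ} (hf : Integrable f)
    (h : ∀ k : Fin 3 → ℤ, ∫ x, mFourier k x * (f x : ℂ) = 0) : f =ᵐ[volume] 0 := by
  refine ae_eq_zero_of_forall_integral_continuous hf fun u => ?_
  have hi : ∀ v : C(T3, ℂ), Integrable fun x => v x * (f x : ℂ) := fun v =>
    hf.ofReal.bdd_mul (c := ‖v‖) v.continuous.aestronglyMeasurable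
      (ae_of_all _ fun x => v.norm_coe_le_norm x)
  let L : C(T3, ℂ) →ₗ[ℂ] ℂ :=
    { toFun := fun v => ∫ x, v x * (f x : ℂ)
      map_add' := fun v w => by
        rw [← integral_add (hi v) (hi w)]
        simp only [ContinuousMap.add_apply, add_mul]
      map_smul' := fun c v => by
        simp only [ContinuousMap.smul_apply, smul_eq_mul, mul_assoc, integral_const_mul,
          RingHom.id_apply] }
  have hL : ∀ v, ‖L v‖ ≤ (∫ x, ‖f x‖) * ‖v‖ := fun v => by
    refine (norm_integral_le_integral_norm _).trans ?_
    rw [← integral_mul_const]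
    refine integral_mono_ae (hi v).norm (hf.norm.mul_const _) (ae_of_all _ fun x => ?_)
    change ‖v x * (f x : ℂ)‖ ≤ ‖f x‖ * ‖v‖
    rw [norm_mul, Complex.norm_real, mul_comm]
    exact mul_le_mul_of_nonneg_left (v.norm_coe_le_norm x) (norm_nonneg _)
  let L' := L.mkContinuous _ hL
  have hker : (Submodule.span ℂ (range (mFourier (d := Fin 3)))).topologicalClosure
      ≤ LinearMap.ker L'.toLinearMap := by
    refine Submodule.topologicalClosure_minimal _ ?_ L'.isClosed_ker
    rw [Submodule.span_le]
    rintro _ ⟨k, rfl⟩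
    exact h k
  rw [span_mFourier_closure_eq_top] at hker
  have h1 : L' ⟨fun x => (u x : ℂ), Complex.continuous_ofReal.comp u.continuous⟩ = 0 :=
    hker Submodule.mem_top
  have h2 : ∫ x, ((f x * u x : ℝ) : ℂ) = 0 := by
    rw [← h1]
    refine integral_congr_ae (ae_of_all _ fun x => ?_)
    change ((f x * u x : ℝ) : ℂ) = (u x : ℂ) * (f x : ℂ)
    push_cast
    ring
  rw [integral_complex_ofReal] at h2
  exact_mod_cast h2

/-! ### Real characters of the torus and their derivatives. -/

/-- The indices of the real trigonometric functions on the torus. -/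
abbrev Idx : Type := (Fin 3 → ℤ) × Bool

/-- The real trigonometric functions `cos (2π k·x)` and `sin (2π k·x)`. -/
def trig (m : Idx) (x : T3) : ℝ :=
  if m.2 then (mFourier m.1 x).im else (mFourier m.1 x).re

/-- The partner of an index under differentiation. -/
def Idx.flip (m : Idx) : Idx := (m.1, !m.2)

/-- The sign in the derivative of a trigonometric function. -/
def Idx.sgn (m : Idx) : ℝ := if m.2 then 1 else -1

/-- The frequency vector. -/
def Idx.freq (m : Idx) (a : Fin 3) : ℝ := 2 * Real.pi * m.1 a

@[simp] theorem Idx.flip_flip (m : Idx) : m.flip.flip = m := by simp [flip]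
@[simp] theorem Idx.freq_flip (m : Idx) : m.flip.freq = m.freq := rfl
@[simp] theorem Idx.sgn_flip (m : Idx) : m.flip.sgn = -m.sgn := by
  rcases m with ⟨k, _ | _⟩ <;> simp [flip, sgn]
@[simp] theorem Idx.sgn_mul_sgn (m : Idx) : m.sgn * m.sgn = 1 := by
  rcases m with ⟨k, _ | _⟩ <;> simp [sgn]

theorem fourier_add_apply (n : ℤ) (x y : UnitAddCircle) :
    fourier n (x + y) = fourier n x * fourier n y := by
  simp only [fourier_apply, smul_add, AddCircle.toCircle_add, Circle.coe_mul]

theorem mFourier_add_single (k : Fin 3 → ℤ) (x : T3) (a : Fin 3) (s : ℝ) :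
    mFourier k (x + Pi.single a (s : UnitAddCircle))
      = mFourier k x * Complex.exp (2 * Real.pi * Complex.I * k a * s) := by
  have h : ∏ i, fourier (k i) ((Pi.single a (s : UnitAddCircle) : T3) i)
      = Complex.exp (2 * Real.pi * Complex.I * k a * s) := by
    rw [Finset.prod_eq_single a (fun i _ hi => by rw [Pi.single_eq_of_ne hi]; simp) (by simp),
      Pi.single_eq_same, fourier_coe_apply]
    simp
  rw [← h]
  simp only [mFourier, ContinuousMap.coe_mk, Pi.add_apply, fourier_add_apply,
    Finset.prod_mul_distrib]

/-- Differentiation exchanges sine and cosine at the same frequency, which is why `flip` and `sgn`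
accompany every first derivative. -/
theorem pd_trig (a : Fin 3) (m : Idx) :
    pd a (trig m) = fun x => m.sgn * m.freq a * trig m.flip x := by
  funext x
  have h : HasDerivAt (fun s : ℝ => mFourier m.1 (x + Pi.single a (s : UnitAddCircle)))
      (mFourier m.1 x * (2 * Real.pi * Complex.I * m.1 a)) 0 := by
    simp only [mFourier_add_single]
    refine HasDerivAt.const_mul _ ?_
    have h1 : HasDerivAt (fun s : ℝ => 2 * Real.pi * Complex.I * (m.1 a : ℂ) * (s : ℂ))
        (2 * Real.pi * Complex.I * (m.1 a : ℂ) * 1) 0 :=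
      (Complex.ofRealCLM.hasDerivAt (x := 0)).const_mul _
    have h2 := h1.cexp
    simpa using h2
  have hre := Complex.reCLM.hasFDerivAt.comp_hasDerivAt (0 : ℝ) h
  have him := Complex.imCLM.hasFDerivAt.comp_hasDerivAt (0 : ℝ) h
  rcases m with ⟨k, _ | _⟩
  · have : pd a (trig (k, false)) x = _ := hre.deriv
    rw [this]
    simp [trig, Idx.flip, Idx.sgn, Idx.freq, Complex.mul_re, Complex.mul_im]
    ring
  · have : pd a (trig (k, true)) x = _ := him.deriv
    rw [this]
    simp [trig, Idx.flip, Idx.sgn, Idx.freq, Complex.mul_re, Complex.mul_im]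
    ring

theorem isTest_trig (m : Idx) : IsTest (trig m) := by
  have h : ContDiff ℝ ∞ (fun x : Fin 3 → ℝ =>
      mFourier m.1 (fun i => (x i : UnitAddCircle))) := by
    simp only [mFourier, ContinuousMap.coe_mk, fourier_coe_apply]
    refine contDiff_prod fun i _ => ?_
    refine ContDiff.cexp ?_
    refine ContDiff.div_const (contDiff_const.mul ?_) _
    exact Complex.ofRealCLM.contDiff.comp (contDiff_apply ℝ ℝ i)
  rcases m with ⟨k, _ | _⟩
  · exact Complex.reCLM.contDiff.comp h
  · exact Complex.imCLM.contDiff.comp h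

theorem trig_neg_false (k : Fin 3 → ℤ) : trig (-k, false) = trig (k, false) := by
  funext x; simp [trig, mFourier_neg]

theorem trig_neg_true (k : Fin 3 → ℤ) : trig (-k, true) = fun x => -trig (k, true) x := by
  funext x; simp [trig, mFourier_neg]

/-! ### Test functions -/

/-- The covering map from `ℝ³` to the torus. -/
def cover (x : Fin 3 → ℝ) : T3 := fun i => (x i : UnitAddCircle)

theorem isOpenQuotientMap_cover : IsOpenQuotientMap cover :=
  IsOpenQuotientMap.piMap fun _ => QuotientAddGroup.isOpenQuotientMap_mk

theorem cover_add_single (y : Fin 3 → ℝ) (a : Fin 3) (s : ℝ) :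
    cover y + Pi.single a (s : UnitAddCircle) = cover (y + s • Pi.single a 1) := by
  funext i
  by_cases hi : i = a
  · subst hi; simp [cover]
  · simp [cover, hi]

/-- Differentiation under the integral sign of a constant integral; applied to translates, it gives
∫ ∂_aψ = 0 and then integration by parts. -/
theorem integral_deriv_eq_zero {α : Type*} [MeasurableSpace α] {μ : Measure α} [IsFiniteMeasure μ]
    (F F' : ℝ → α → ℝ) (m1 : ∀ s, AEStronglyMeasurable (F s) μ) (m2 : Integrable (F 0) μ)
    (m3 : AEStronglyMeasurable (F' 0) μ) {c : ℝ} (hc : ∀ s x, ‖F' s x‖ ≤ c)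
    (hd : ∀ s x, HasDerivAt (fun s => F s x) (F' s x) s) {I : ℝ} (hI : ∀ s, ∫ x, F s x ∂μ = I) :
    ∫ x, F' 0 x ∂μ = 0 := by
  have h := (hasDerivAt_integral_of_dominated_loc_of_deriv_le (μ := μ) (F := F) (F' := F')
    (x₀ := 0) (bound := fun _ => c) (s := univ) univ_mem (Eventually.of_forall m1) m2 m3
    (ae_of_all _ fun x s _ => hc s x) (integrable_const c)
    (ae_of_all _ fun x s _ => hd s x)).2
  simp only [hI] at h
  exact h.unique (hasDerivAt_const (0 : ℝ) _)

/-- The translation of the torus along a coordinate axis. -/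
def shift (a : Fin 3) (s : ℝ) (x : T3) : T3 := x + Pi.single a (s : UnitAddCircle)

theorem continuous_shift (a : Fin 3) (s : ℝ) : Continuous (shift a s) := continuous_add_const _

theorem shift_zero (a : Fin 3) (x : T3) : shift a 0 x = x := by simp [shift]

theorem integral_shift (ψ : T3 → ℝ) (a : Fin 3) (s : ℝ) : ∫ x, ψ (shift a s x) = ∫ x, ψ x :=
  integral_add_right_eq_self ψ _

namespace IsTest

variable {ψ v : T3 → ℝ}

theorem continuous (hψ : IsTest ψ) : Continuous ψ :=
  (isOpenQuotientMap_cover.isQuotientMap.continuous_iff).2 (ContDiff.continuous hψ)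

theorem exists_bound (hψ : IsTest ψ) : ∃ c, ∀ x, ‖ψ x‖ ≤ c := by
  obtain ⟨c, hc⟩ := isCompact_univ.exists_bound_of_continuousOn hψ.continuous.continuousOn
  exact ⟨c, fun x => hc x (mem_univ x)⟩

theorem integrable_mul {f : T3 → ℝ} (hψ : IsTest ψ) (hf : Integrable f) :
    Integrable fun x => f x * ψ x := by
  obtain ⟨c, hc⟩ := hψ.exists_bound
  exact hf.mul_bdd hψ.continuous.aestronglyMeasurable (ae_of_all _ hc)

theorem memLp (hψ : IsTest ψ) (p : ℝ≥0∞) : MemLp ψ p volume := by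
  obtain ⟨c, hc⟩ := hψ.exists_bound
  exact MemLp.of_bound hψ.continuous.aestronglyMeasurable c (ae_of_all _ hc)

theorem integrable (hψ : IsTest ψ) : Integrable ψ := memLp_one_iff_integrable.1 (hψ.memLp 1)

theorem hasDerivAt_cover (hψ : IsTest ψ) (a : Fin 3) (y : Fin 3 → ℝ) :
    HasDerivAt (fun s : ℝ => ψ (cover y + Pi.single a (s : UnitAddCircle)))
      (fderiv ℝ (fun x => ψ (cover x)) y (Pi.single a 1)) 0 := by
  simp only [cover_add_single]
  have h1 : HasFDerivAt (fun x => ψ (cover x)) (fderiv ℝ (fun x => ψ (cover x)) y)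
      (y + (0 : ℝ) • Pi.single a 1) := by
    rw [zero_smul, add_zero]
    exact (ContDiff.differentiable hψ (by simp) y).hasFDerivAt
  have h2 : HasDerivAt (fun s : ℝ => y + s • (Pi.single a 1 : Fin 3 → ℝ))
      (Pi.single a 1) 0 := by
    simpa using ((hasDerivAt_id (0 : ℝ)).smul_const (Pi.single a 1 : Fin 3 → ℝ)).const_add y
  exact h1.comp_hasDerivAt (0 : ℝ) h2

theorem pd_cover (hψ : IsTest ψ) (a : Fin 3) (y : Fin 3 → ℝ) :
    pd a ψ (cover y) = fderiv ℝ (fun x => ψ (cover x)) y (Pi.single a 1) :=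
  (hψ.hasDerivAt_cover a y).deriv

theorem hasDerivAt_zero (hψ : IsTest ψ) (a : Fin 3) (x : T3) :
    HasDerivAt (fun s : ℝ => ψ (x + Pi.single a (s : UnitAddCircle))) (pd a ψ x) 0 := by
  obtain ⟨y, rfl⟩ := isOpenQuotientMap_cover.surjective x
  rw [hψ.pd_cover]
  exact hψ.hasDerivAt_cover a y

theorem hasDerivAt (hψ : IsTest ψ) (a : Fin 3) (x : T3) (s : ℝ) :
    HasDerivAt (fun s : ℝ => ψ (x + Pi.single a (s : UnitAddCircle)))
      (pd a ψ (x + Pi.single a (s : UnitAddCircle))) s := by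
  have h := hψ.hasDerivAt_zero a (x + Pi.single a (s : UnitAddCircle))
  rw [← sub_self s] at h
  have h3 := HasDerivAt.comp_sub_const s s h
  refine h3.congr_of_eventuallyEq (Eventually.of_forall fun r => ?_)
  simp only [add_assoc, ← Pi.single_add, ← AddCircle.coe_add,
    add_sub_cancel]

theorem pd (hψ : IsTest ψ) (a : Fin 3) : IsTest (KasnerLin.pd a ψ) := by
  have h : ContDiff ℝ ∞ (fun y => fderiv ℝ (fun x => ψ (cover x)) y (Pi.single a 1)) :=
    (ContDiff.fderiv_right (m := ∞) hψ (by simp)).clm_apply contDiff_const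
  change ContDiff ℝ ∞ fun y => KasnerLin.pd a ψ (cover y)
  simpa only [hψ.pd_cover a] using h

theorem mul (hψ : IsTest ψ) (hv : IsTest v) : IsTest fun x => ψ x * v x := ContDiff.mul hψ hv

theorem pd_mul (hψ : IsTest ψ) (hv : IsTest v) (a : Fin 3) (x : T3) :
    KasnerLin.pd a (fun x => ψ x * v x) x = KasnerLin.pd a ψ x * v x + ψ x * KasnerLin.pd a v x := by
  have h := ((hψ.hasDerivAt_zero a x).mul (hv.hasDerivAt_zero a x)).deriv
  simp only [AddCircle.coe_zero, Pi.single_zero, add_zero] at h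
  exact h

theorem integral_pd (hψ : IsTest ψ) (a : Fin 3) : ∫ x, KasnerLin.pd a ψ x = 0 := by
  obtain ⟨c, hc⟩ := (hψ.pd a).exists_bound
  have h := integral_deriv_eq_zero (α := T3) (μ := volume)
    (fun s x => ψ (shift a s x)) (fun s x => KasnerLin.pd a ψ (shift a s x))
    (fun s => (hψ.continuous.comp (continuous_shift a s)).aestronglyMeasurable)
    (by simpa only [shift_zero] using hψ.integrable)
    ((hψ.pd a).continuous.comp (continuous_shift a 0)).aestronglyMeasurable
    (fun s x => hc _) (fun s x => hψ.hasDerivAt a x s)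
    (I := ∫ x, ψ x) (fun s => integral_shift ψ a s)
  simpa only [shift_zero] using h

theorem integral_pd_mul (hψ : IsTest ψ) (hv : IsTest v) (a : Fin 3) :
    ∫ x, KasnerLin.pd a ψ x * v x = -∫ x, ψ x * KasnerLin.pd a v x := by
  have h := (hψ.mul hv).integral_pd a
  simp only [hψ.pd_mul hv] at h
  rw [integral_add (hv.integrable_mul (hψ.pd a).integrable)
    ((hv.pd a).integrable_mul hψ.integrable)] at h
  linarith

end IsTest

/-! ### Real Fourier coefficients -/

/-- The real Fourier coefficients of a function. -/
def coef (f : T3 → ℝ) (m : Idx) : ℝ := ∫ x, f x * trig m x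

theorem toDistr_trig (f : T3 → ℝ) (m : Idx) : toDistr f (trig m) = coef f m := rfl

theorem coef_congr {f g : T3 → ℝ} (h : f =ᵐ[volume] g) : coef f = coef g := by
  funext m
  exact integral_congr_ae (by filter_upwards [h] with x hx; rw [hx])

theorem coef_sub {f g : T3 → ℝ} (hf : Integrable f) (hg : Integrable g) (m : Idx) :
    coef (fun x => f x - g x) m = coef f m - coef g m := by
  simp only [coef, sub_mul]
  exact integral_sub ((isTest_trig m).integrable_mul hf) ((isTest_trig m).integrable_mul hg)

theorem coef_add {f g : T3 → ℝ} (hf : Integrable f) (hg : Integrable g) (m : Idx) :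
    coef (fun x => f x + g x) m = coef f m + coef g m := by
  simp only [coef, add_mul]
  exact integral_add ((isTest_trig m).integrable_mul hf) ((isTest_trig m).integrable_mul hg)

theorem coef_const_mul (c : ℝ) (f : T3 → ℝ) (m : Idx) :
    coef (fun x => c * f x) m = c * coef f m := by
  simp only [coef, mul_assoc]
  exact integral_const_mul c _

theorem integral_mFourier_mul {f : T3 → ℝ} (hf : Integrable f) (k : Fin 3 → ℤ) :
    ∫ x, mFourier (-k) x * (f x : ℂ)
      = (coef f (k, false) : ℂ) - (coef f (k, true) : ℂ) * Complex.I := by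
  have e : ∀ x, mFourier (-k) x * (f x : ℂ) = ((f x * trig (k, false) x : ℝ) : ℂ)
      - ((f x * trig (k, true) x : ℝ) : ℂ) * Complex.I := fun x => by
    rw [mFourier_neg]
    simp only [trig, if_true, Bool.false_eq_true, if_false]
    apply Complex.ext <;> simp [mul_comm]
  simp only [e]
  rw [integral_sub ((isTest_trig _).integrable_mul hf).ofReal
    (((isTest_trig _).integrable_mul hf).ofReal.mul_const _), integral_mul_const,
    integral_complex_ofReal, integral_complex_ofReal]
  rfl

theorem integrable_of_memLp_two {f : T3 → ℝ} (hf : MemLp f 2 volume) : Integrable f :=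
  hf.integrable one_le_two

theorem summable_idx_iff {a : Idx → ℝ} (ha : ∀ m, 0 ≤ a m) :
    Summable a ↔ Summable fun k => a (k, false) + a (k, true) := by
  rw [summable_prod_of_nonneg ha]
  simp only [tsum_fintype, Fintype.sum_bool]
  constructor
  · rintro ⟨-, h⟩
    exact h.congr fun k => add_comm _ _
  · intro h
    exact ⟨fun k => (hasSum_fintype _).summable, h.congr fun k => add_comm _ _⟩

theorem hasSum_re_parseval {f u : T3 → ℝ} (hf : MemLp f 2 volume) (hu : MemLp u 2 volume) :
    HasSum (fun k : Fin 3 → ℤ => coef f (k, false) * coef u (k, false)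
      + coef f (k, true) * coef u (k, true)) (∫ x, f x * u x) := by
  have h := hasSum_conj_mul (fun x => (f x : ℂ)) (fun x => (u x : ℂ)) hf.ofReal hu.ofReal
  have h2 := Complex.hasSum_re h
  simp only [integral_mFourier_mul (integrable_of_memLp_two hf),
    integral_mFourier_mul (integrable_of_memLp_two hu)] at h2
  have e : (∫ x, conj (f x : ℂ) * (u x : ℂ)).re = ∫ x, f x * u x := by
    have : ∀ x, conj (f x : ℂ) * (u x : ℂ) = ((f x * u x : ℝ) : ℂ) := fun x => by
      rw [Complex.conj_ofReal]; push_cast; rfl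
    simp only [this]
    rw [integral_complex_ofReal, Complex.ofReal_re]
  rw [e] at h2
  convert! h2 using 2 with k
  simp [Complex.mul_re]

theorem summable_coef_sq {f : T3 → ℝ} (hf : MemLp f 2 volume) :
    Summable fun m => coef f m ^ 2 := by
  rw [summable_idx_iff fun m => sq_nonneg _]
  exact (hasSum_re_parseval hf hf).summable.congr fun k => by ring

/-- **Parseval's identity** for the real Fourier coefficients. -/
theorem hasSum_coef_mul {f u : T3 → ℝ} (hf : MemLp f 2 volume) (hu : MemLp u 2 volume) :
    HasSum (fun m => coef f m * coef u m) (∫ x, f x * u x) := by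
  have hs : Summable fun m => coef f m * coef u m := by
    refine Summable.of_norm_bounded ((summable_coef_sq hf).add (summable_coef_sq hu)) fun m => ?_
    rw [Real.norm_eq_abs, abs_le]
    constructor <;> nlinarith [sq_nonneg (coef f m + coef u m), sq_nonneg (coef f m - coef u m),
      sq_nonneg (coef f m), sq_nonneg (coef u m)]
  have h := hs.hasSum.prod_fiberwise fun k => hasSum_fintype _
  simp only [Fintype.sum_bool] at h
  have h2 := h.unique ((hasSum_re_parseval hf hu).congr_fun fun k => add_comm _ _)
  rw [← h2]
  exact hs.hasSum

/-- The index set is redundant: k and -k give the same functions up to sign. The two parity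
conditions are therefore exactly what a family must satisfy to come from a real function; they also
force the sine coefficient at k = 0 to vanish. -/
theorem exists_memLp_coef_eq {a : Idx → ℝ} (ha : Summable fun m => a m ^ 2)
    (h0 : ∀ k, a (-k, false) = a (k, false)) (h1 : ∀ k, a (-k, true) = -a (k, true)) :
    ∃ f : T3 → ℝ, MemLp f 2 volume ∧ ∀ m, coef f m = a m := by
  obtain ⟨F, hF, hFc⟩ := exists_memLp_of_summable
    (fun k => (a (k, false) : ℂ) - (a (k, true) : ℂ) * Complex.I) (by
      rw [summable_idx_iff fun m => sq_nonneg _] at ha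
      refine ha.congr fun k => ?_
      rw [← Complex.normSq_eq_norm_sq]
      simp [Complex.normSq_apply]
      ring)
  have hi : Integrable F := hF.integrable one_le_two
  have hre : MemLp (fun x => (F x).re) 2 volume := hF.re
  refine ⟨fun x => (F x).re, hre, ?_⟩
  have hb : ∀ k : Fin 3 → ℤ, ∀ G : T3 → ℂ, Integrable G →
      Integrable fun x => mFourier k x * G x := fun k G hG =>
    hG.bdd_mul (c := ‖mFourier k‖) (mFourier k).continuous.aestronglyMeasurable
      (ae_of_all _ fun x => (mFourier k).norm_coe_le_norm x)
  have hci : Integrable fun x => conj (F x) :=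
    Complex.conjCLE.toContinuousLinearMap.integrable_comp hi
  -- Parity says that F and its conjugate have the same coefficients, so the real part of F keeps
  -- them.
  have hconj : ∀ k, ∫ x, mFourier (-k) x * conj (F x)
      = (a (k, false) : ℂ) - (a (k, true) : ℂ) * Complex.I := fun k => by
    have e : ∀ x, mFourier (-k) x * conj (F x) = conj (mFourier (- -k) x * F x) := fun x => by
      rw [map_mul, mFourier_neg, mFourier_neg (n := -k), mFourier_neg, Complex.conj_conj]
    simp only [e]
    rw [integral_conj, hFc, h0, h1]
    simp [sub_eq_add_neg]
  have key : ∀ k, (coef (fun x => (F x).re) (k, false) : ℂ)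
      - (coef (fun x => (F x).re) (k, true) : ℂ) * Complex.I
      = (a (k, false) : ℂ) - (a (k, true) : ℂ) * Complex.I := fun k => by
    rw [← integral_mFourier_mul (integrable_of_memLp_two hre)]
    have e : ∀ x, mFourier (-k) x * ((F x).re : ℂ)
        = 2⁻¹ * (mFourier (-k) x * F x + mFourier (-k) x * conj (F x)) := fun x => by
      rw [← mul_add, Complex.add_conj]; push_cast; ring
    simp only [e]
    rw [integral_const_mul, integral_add (hb _ _ hi) (hb _ _ hci), hFc, hconj]
    ring
  rintro ⟨k, _ | _⟩
  · simpa using congrArg Complex.re (key k)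
  · simpa using congrArg Complex.im (key k)

theorem coef_neg_false (f : T3 → ℝ) (k : Fin 3 → ℤ) : coef f (-k, false) = coef f (k, false) := by
  rw [coef, trig_neg_false]; rfl

theorem coef_neg_true (f : T3 → ℝ) (k : Fin 3 → ℤ) : coef f (-k, true) = -coef f (k, true) := by
  rw [coef, trig_neg_true]
  simp only [mul_neg]
  exact integral_neg _

theorem ae_eq_of_coef_eq {f g : T3 → ℝ} (hf : Integrable f) (hg : Integrable g)
    (h : coef f = coef g) : f =ᵐ[volume] g := by
  have hfg : Integrable fun x => f x - g x := hf.sub hg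
  have h0 := ae_eq_zero_of_forall_fourier hfg fun k => by
    have := integral_mFourier_mul hfg (-k)
    rw [neg_neg] at this
    rw [this, coef_sub hf hg, coef_sub hf hg, h]
    simp
  filter_upwards [h0] with x hx
  exact sub_eq_zero.1 hx

/-- The L² function synthesized from the coefficients agrees with f by uniqueness in L¹. -/
theorem memLp_two_of_summable {f : T3 → ℝ} (hf : Integrable f)
    (h : Summable fun m => coef f m ^ 2) : MemLp f 2 volume := by
  obtain ⟨g, hg, hgc⟩ := exists_memLp_coef_eq h (coef_neg_false f) (coef_neg_true f)
  exact hg.ae_eq (ae_eq_of_coef_eq (integrable_of_memLp_two hg) hf (funext hgc))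

theorem memLp_two_iff_lintegral {f : T3 → ℝ} (hf : Integrable f) :
    MemLp f 2 volume ↔ ∫⁻ x, ENNReal.ofReal (f x ^ 2) ≠ ⊤ := by
  rw [memLp_two_iff_integrable_sq hf.aestronglyMeasurable]
  constructor
  · exact fun h => h.lintegral_lt_top.ne
  · intro h
    refine ⟨hf.aestronglyMeasurable.pow 2, ?_⟩
    rw [hasFiniteIntegral_iff_ofReal (ae_of_all _ fun x => sq_nonneg _)]
    exact lt_top_iff_ne_top.2 h

theorem tsum_ofReal_ne_top_iff {ι : Type*} {a : ι → ℝ} (ha : ∀ m, 0 ≤ a m) :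
    ∑' m, ENNReal.ofReal (a m) ≠ ⊤ ↔ Summable a := by
  refine ⟨fun h => ?_, fun h => h.tsum_ofReal_ne_top⟩
  have := ENNReal.summable_toReal h
  exact this.congr fun m => ENNReal.toReal_ofReal (ha m)

/-- **Parseval's identity** for integrable functions, both sides possibly infinite. -/
theorem tsum_coef_sq {f : T3 → ℝ} (hf : Integrable f) :
    ∑' m, ENNReal.ofReal (coef f m ^ 2) = ∫⁻ x, ENNReal.ofReal (f x ^ 2) := by
  by_cases h : MemLp f 2 volume
  · have h1 := hasSum_coef_mul h h
    simp only [← sq] at h1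
    rw [← ENNReal.ofReal_tsum_of_nonneg (fun m => sq_nonneg _) h1.summable, h1.tsum_eq]
    exact ofReal_integral_eq_lintegral_ofReal h.integrable_sq (ae_of_all _ fun x => sq_nonneg _)
  · have h1 : ∫⁻ x, ENNReal.ofReal (f x ^ 2) = ⊤ := by
      by_contra h2
      exact h ((memLp_two_iff_lintegral hf).2 h2)
    rw [h1]
    by_contra h2
    exact h (memLp_two_of_summable hf ((tsum_ofReal_ne_top_iff fun m => sq_nonneg _).1 h2))

/-! ### Distributions given by their Fourier series -/

theorem pd_const_mul (a : Fin 3) (c : ℝ) (ψ : T3 → ℝ) :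
    pd a (fun x => c * ψ x) = fun x => c * pd a ψ x := by
  funext x
  exact deriv_const_mul_field c

/-- Homogeneous functionals. -/
def IsHomog (u : Distr) : Prop := ∀ (c : ℝ) (ψ : T3 → ℝ), u (fun x => c * ψ x) = c * u ψ

theorem isHomog_toDistr (f : T3 → ℝ) : IsHomog (toDistr f) := fun c ψ => by
  simp only [toDistr, mul_left_comm _ c]
  exact integral_const_mul c _

theorem IsHomog.D {u : Distr} (hu : IsHomog u) (a : Fin 3) : IsHomog (D a u) := fun c ψ => by
  rw [KasnerLin.D, KasnerLin.D, pd_const_mul, hu]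
  ring

theorem IsHomog.D_trig {u : Distr} (hu : IsHomog u) (a : Fin 3) (m : Idx) :
    KasnerLin.D a u (trig m) = -(m.sgn * m.freq a) * u (trig m.flip) := by
  rw [KasnerLin.D, pd_trig, hu]
  ring

theorem IsHomog.D_D_trig {u : Distr} (hu : IsHomog u) (a b : Fin 3) (m : Idx) :
    KasnerLin.D a (KasnerLin.D b u) (trig m) = -(m.freq a * m.freq b) * u (trig m) := by
  rw [(hu.D b).D_trig, hu.D_trig, Idx.flip_flip, Idx.sgn_flip, Idx.freq_flip]
  linear_combination (-m.freq a * m.freq b * u (trig m)) * m.sgn_mul_sgn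

theorem IsHomog.trig_neg_true {u : Distr} (hu : IsHomog u) (k : Fin 3 → ℤ) :
    u (trig (-k, true)) = -u (trig (k, true)) := by
  rw [KasnerLin.trig_neg_true]
  simpa using hu (-1) (trig (k, true))

/-- Functionals whose values on test functions are given by their Fourier series. -/
structure IsFourier (u : Distr) : Prop where
  homog : IsHomog u
  hasSum : ∀ ψ, IsTest ψ → HasSum (fun m => u (trig m) * coef ψ m) (u ψ)

namespace IsFourier

variable {u v : Distr}

theorem toDistr {f : T3 → ℝ} (hf : MemLp f 2 volume) : IsFourier (toDistr f) :=
  ⟨isHomog_toDistr f, fun _ hψ => hasSum_coef_mul hf (hψ.memLp 2)⟩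

theorem add (hu : IsFourier u) (hv : IsFourier v) : IsFourier (u + v) :=
  ⟨fun c ψ => by simp only [Pi.add_apply, hu.homog c ψ, hv.homog c ψ, mul_add],
   fun ψ hψ => by simpa only [Pi.add_apply, add_mul] using (hu.hasSum ψ hψ).add (hv.hasSum ψ hψ)⟩

theorem smul (hu : IsFourier u) (c : ℝ) : IsFourier (c • u) :=
  ⟨fun d ψ => by simp only [Pi.smul_apply, smul_eq_mul, hu.homog d ψ, mul_left_comm],
   fun ψ hψ => by
    simpa only [Pi.smul_apply, smul_eq_mul, mul_assoc] using (hu.hasSum ψ hψ).mul_left c⟩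

theorem neg (hu : IsFourier u) : IsFourier (-u) := by
  simpa using hu.smul (-1)

theorem sub (hu : IsFourier u) (hv : IsFourier v) : IsFourier (u - v) := by
  rw [sub_eq_add_neg]
  exact hu.add hv.neg

theorem zero : IsFourier 0 :=
  ⟨fun c ψ => by simp, fun ψ _ => by simp⟩

theorem sum {ι : Type*} (s : Finset ι) {u : ι → Distr} (hu : ∀ i, IsFourier (u i)) :
    IsFourier (∑ i ∈ s, u i) := by
  classical
  induction s using Finset.induction_on with
  | empty => simpa using zero
  | insert i s hi ih => rw [Finset.sum_insert hi]; exact (hu i).add ih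

/-- Flipping the index as a permutation. -/
def flipEquiv : Idx ≃ Idx := ⟨Idx.flip, Idx.flip, Idx.flip_flip, Idx.flip_flip⟩

/-- The series for u at ∂_aψ is transformed by integrating by parts in the coefficients and
reindexing by `flip`. -/
theorem D (hu : IsFourier u) (a : Fin 3) : IsFourier (D a u) := by
  refine ⟨hu.homog.D a, fun ψ hψ => ?_⟩
  have h := (hu.hasSum _ (hψ.pd a)).neg
  have hc : ∀ m, coef (pd a ψ) m = -(m.sgn * m.freq a) * coef ψ m.flip := fun m => by
    rw [coef, hψ.integral_pd_mul (isTest_trig m), pd_trig]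
    have := isHomog_toDistr ψ (m.sgn * m.freq a) (trig m.flip)
    simp only [KasnerLin.toDistr] at this
    rw [this, coef]
    ring
  rw [← flipEquiv.hasSum_iff] at h
  refine h.congr_fun fun m => ?_
  simp only [Function.comp_apply, flipEquiv, Equiv.coe_fn_mk]
  rw [hu.homog.D_trig, hc, Idx.flip_flip, Idx.sgn_flip, Idx.freq_flip]
  ring

/-- The passage from identities between modes to identities between distributions. -/
theorem eqDistr (hu : IsFourier u) (hv : IsFourier v) (h : ∀ m, u (trig m) = v (trig m)) :
    EqDistr u v := fun ψ hψ => by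
  have h1 := hu.hasSum ψ hψ
  simp only [h] at h1
  exact h1.unique (hv.hasSum ψ hψ)

theorem exists_memLp (hu : IsFourier u) (h : Summable fun m => u (trig m) ^ 2) :
    ∃ g : T3 → ℝ, MemLp g 2 volume ∧ EqDistr u (KasnerLin.toDistr g) := by
  obtain ⟨g, hg, hgc⟩ := exists_memLp_coef_eq h (fun k => by rw [trig_neg_false])
    (fun k => hu.homog.trig_neg_true k)
  exact ⟨g, hg, hu.eqDistr (toDistr hg) fun m => (hgc m).symm⟩

end IsFourier

/-! ### Weak derivatives and Sobolev norms in terms of Fourier coefficients -/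

/-- The distributional derivative `∂_I u`. -/
def DMulti (I : Fin 3 → ℕ) (u : Distr) : Distr :=
  (D 2)^[I 2] ((D 1)^[I 1] ((D 0)^[I 0] u))

theorem D_iterate_apply (a : Fin 3) (n : ℕ) (u : Distr) (ψ : T3 → ℝ) :
    (D a)^[n] u ψ = (-1) ^ n * u ((pd a)^[n] ψ) := by
  induction n generalizing ψ with
  | zero => simp
  | succ n ih => rw [Function.iterate_succ_apply', D, ih, Function.iterate_succ_apply, pow_succ]; ring

theorem DMulti_apply (I : Fin 3 → ℕ) (u : Distr) (ψ : T3 → ℝ) :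
    DMulti I u ψ = (-1) ^ (∑ i, I i) * u (pdMulti I ψ) := by
  rw [DMulti, D_iterate_apply, D_iterate_apply, D_iterate_apply, Fin.sum_univ_three, pdMulti,
    pow_add, pow_add]
  ring

theorem hasWeakDeriv_iff {I : Fin 3 → ℕ} {f g : T3 → ℝ} : HasWeakDeriv I f g ↔
    Integrable f ∧ Integrable g ∧ EqDistr (DMulti I (toDistr f)) (toDistr g) := by
  have h1 : ((-1 : ℝ) ^ (∑ i, I i)) * (-1) ^ (∑ i, I i) = 1 := by
    rw [← mul_pow]; simp
  refine and_congr_right fun _ => and_congr_right fun _ => forall_congr' fun ψ =>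
    imp_congr_right fun _ => ?_
  rw [DMulti_apply]
  change (toDistr f (pdMulti I ψ) = (-1) ^ (∑ i, I i) * toDistr g ψ) ↔ _
  constructor
  · intro h; rw [h, ← mul_assoc, h1, one_mul]
  · intro h; rw [← h, ← mul_assoc, h1, one_mul]

theorem IsHomog.iterate_D {u : Distr} (hu : IsHomog u) (a : Fin 3) (n : ℕ) :
    IsHomog ((KasnerLin.D a)^[n] u) := by
  induction n with
  | zero => exact hu
  | succ n ih => rw [Function.iterate_succ_apply']; exact ih.D a

theorem IsFourier.iterate_D {u : Distr} (hu : IsFourier u) (a : Fin 3) (n : ℕ) :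
    IsFourier ((KasnerLin.D a)^[n] u) := by
  induction n with
  | zero => exact hu
  | succ n ih => rw [Function.iterate_succ_apply']; exact ih.D a

theorem IsFourier.DMulti {u : Distr} (hu : IsFourier u) (I : Fin 3 → ℕ) :
    IsFourier (DMulti I u) := ((hu.iterate_D 0 _).iterate_D 1 _).iterate_D 2 _

theorem tsum_flip (F : (Fin 3 → ℝ) → ℝ → ℝ≥0∞) (a : Idx → ℝ) :
    ∑' m : Idx, F m.freq (a m.flip) = ∑' m : Idx, F m.freq (a m) :=
  IsFourier.flipEquiv.tsum_eq fun m : Idx => F m.freq (a m)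

theorem Idx.sgn_sq (m : Idx) : m.sgn ^ 2 = 1 := by rw [sq, sgn_mul_sgn]

/-- Each derivative permutes sine and cosine, which leaves a sum over all indices unchanged, and
multiplies squares by ξ_a². The general F allows the weights from other directions to be carried
along. -/
theorem tsum_iterate_D {u : Distr} (hu : IsHomog u) (a : Fin 3) (n : ℕ)
    (F : (Fin 3 → ℝ) → ℝ → ℝ≥0∞) :
    ∑' m : Idx, F m.freq ((D a)^[n] u (trig m) ^ 2)
      = ∑' m : Idx, F m.freq (m.freq a ^ (2 * n) * u (trig m) ^ 2) := by
  induction n generalizing F with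
  | zero => simp
  | succ n ih =>
    have h1 : ∀ m : Idx, F m.freq ((D a)^[n + 1] u (trig m) ^ 2)
        = F m.freq (m.freq a ^ 2 * (D a)^[n] u (trig m.flip) ^ 2) := fun m => by
      rw [Function.iterate_succ_apply', (hu.iterate_D a n).D_trig]
      congr 1
      linear_combination (m.freq a ^ 2 * (D a)^[n] u (trig m.flip) ^ 2) * m.sgn_sq
    simp only [h1]
    have h2 := tsum_flip (fun ξ y => F ξ (ξ a ^ 2 * y)) fun m => (D a)^[n] u (trig m) ^ 2
    rw [h2, ih fun ξ y => F ξ (ξ a ^ 2 * y)]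
    refine tsum_congr fun m => ?_
    congr 1
    ring

/-- The weight `ξ^{2I}`. -/
def wt (I : Fin 3 → ℕ) (m : Idx) : ℝ := ∏ i, m.freq i ^ (2 * I i)

theorem wt_nonneg (I : Fin 3 → ℕ) (m : Idx) : 0 ≤ wt I m :=
  Finset.prod_nonneg fun i _ => by rw [pow_mul]; positivity

theorem tsum_DMulti {u : Distr} (hu : IsHomog u) (I : Fin 3 → ℕ) :
    ∑' m : Idx, ENNReal.ofReal (DMulti I u (trig m) ^ 2)
      = ∑' m : Idx, ENNReal.ofReal (wt I m * u (trig m) ^ 2) := by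
  rw [DMulti, tsum_iterate_D ((hu.iterate_D 0 _).iterate_D 1 _) 2 (I 2)
      (fun _ y => ENNReal.ofReal y),
    tsum_iterate_D (hu.iterate_D 0 _) 1 (I 1)
      (fun ξ y => ENNReal.ofReal (ξ 2 ^ (2 * I 2) * y)),
    tsum_iterate_D hu 0 (I 0)
      (fun ξ y => ENNReal.ofReal (ξ 2 ^ (2 * I 2) * (ξ 1 ^ (2 * I 1) * y)))]
  refine tsum_congr fun m => ?_
  rw [wt, Fin.prod_univ_three]
  congr 1
  ring

/-- The `L²` norm of `∂_I` of a field whose squared Fourier coefficients are `w`. -/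
def wnorm (I : Fin 3 → ℕ) (w : Idx → ℝ) : ℝ≥0∞ :=
  (∑' m, ENNReal.ofReal (wt I m * w m)) ^ (1 / 2 : ℝ)

/-- The Sobolev norm of a field whose squared Fourier coefficients are `w`. -/
def sobolev (M : ℕ) (w : Idx → ℝ) : ℝ≥0∞ := ∑ I ∈ multiIndices M, wnorm I w

section Norms
variable {ι : Type} [Fintype ι]

/-- The squared Fourier coefficients of a tensorfield. -/
def coefSq (T : ι → T3 → ℝ) (m : Idx) : ℝ := ∑ c, coef (T c) m ^ 2

theorem coefSq_nonneg (T : ι → T3 → ℝ) (m : Idx) : 0 ≤ coefSq T m :=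
  Finset.sum_nonneg fun _ _ => sq_nonneg _

theorem tsum_ofReal_sum_mul (a : Idx → ℝ) (ha : ∀ m, 0 ≤ a m) (f : ι → Idx → ℝ) :
    ∑' m, ENNReal.ofReal (a m * ∑ c, f c m ^ 2)
      = ∑ c, ∑' m, ENNReal.ofReal (a m * f c m ^ 2) := by
  rw [← Summable.tsum_finsetSum fun _ _ => ENNReal.summable]
  refine tsum_congr fun m => ?_
  rw [Finset.mul_sum, ENNReal.ofReal_sum_of_nonneg]
  exact fun c _ => mul_nonneg (ha m) (sq_nonneg _)

theorem eLpNorm_sqrt_sum {G : ι → T3 → ℝ} (hG : ∀ c, Integrable (G c)) :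
    eLpNorm (fun x => Real.sqrt (∑ c, (G c x) ^ 2)) 2 volume
      = (∑' m, ENNReal.ofReal (coefSq G m)) ^ (1 / 2 : ℝ) := by
  have h1 := tsum_ofReal_sum_mul (fun _ => 1) (fun _ => zero_le_one) (fun c => coef (G c))
  simp only [one_mul] at h1
  simp only [coefSq]
  rw [h1, eLpNorm_eq_lintegral_rpow_enorm_toReal (by norm_num) (by norm_num)]
  simp only [tsum_coef_sq (hG _)]
  congr 1
  rw [← lintegral_finsetSum' _ fun c _ => ((hG c).aemeasurable.pow_const 2).ennreal_ofReal]
  refine lintegral_congr fun x => ?_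
  have h0 : 0 ≤ ∑ c, G c x ^ 2 := Finset.sum_nonneg fun _ _ => sq_nonneg _
  rw [← ENNReal.ofReal_sum_of_nonneg fun c _ => sq_nonneg _, ← ofReal_norm,
    Real.norm_of_nonneg (Real.sqrt_nonneg _), ENNReal.ofReal_rpow_of_nonneg (Real.sqrt_nonneg _)
      (by norm_num)]
  congr 1
  simp [Real.sq_sqrt h0]

/-- The right-hand side does not depend on G, so the infimum in `frameNorm` runs over a single value
as soon as weak derivatives exist. -/
theorem eLpNorm_of_hasWeakDeriv {I : Fin 3 → ℕ} {T G : ι → T3 → ℝ}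
    (h : ∀ c, HasWeakDeriv I (T c) (G c)) :
    eLpNorm (fun x => Real.sqrt (∑ c, (G c x) ^ 2)) 2 volume = wnorm I (coefSq T) := by
  simp only [hasWeakDeriv_iff] at h
  rw [eLpNorm_sqrt_sum fun c => (h c).2.1, wnorm]
  congr 1
  simp only [coefSq]
  have h1 := tsum_ofReal_sum_mul (fun _ => 1) (fun _ => zero_le_one) (fun c => coef (G c))
  simp only [one_mul] at h1
  rw [h1, tsum_ofReal_sum_mul (wt I) (wt_nonneg I) fun c => coef (T c)]
  refine Finset.sum_congr rfl fun c _ => ?_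
  have h2 := tsum_DMulti (isHomog_toDistr (T c)) I
  simp only [toDistr_trig] at h2
  rw [← h2]
  refine tsum_congr fun m => ?_
  rw [(h c).2.2 _ (isTest_trig m), toDistr_trig]

theorem wt_zero (m : Idx) : wt 0 m = 1 := by simp [wt]

theorem zero_mem_multiIndices (M : ℕ) : (0 : Fin 3 → ℕ) ∈ multiIndices M := by
  simp [multiIndices]

theorem wnorm_le_sobolev {M : ℕ} {I : Fin 3 → ℕ} (hI : I ∈ multiIndices M) (w : Idx → ℝ) :
    wnorm I w ≤ sobolev M w := Finset.single_le_sum (f := fun I => wnorm I w)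
      (fun _ _ => zero_le) hI

theorem wnorm_ne_top_iff {I : Fin 3 → ℕ} {w : Idx → ℝ} (hw : ∀ m, 0 ≤ w m) :
    wnorm I w ≠ ⊤ ↔ Summable fun m => wt I m * w m := by
  rw [← tsum_ofReal_ne_top_iff fun m => mul_nonneg (wt_nonneg I m) (hw m), wnorm, Ne, Ne,
    ENNReal.rpow_eq_top_iff_of_pos (by norm_num)]

theorem summable_of_sobolev {M : ℕ} {w : Idx → ℝ} (hw : ∀ m, 0 ≤ w m) (h : sobolev M w ≠ ⊤) :
    Summable w := by
  have h1 : wnorm 0 w ≠ ⊤ := ne_top_of_le_ne_top h (wnorm_le_sobolev (zero_mem_multiIndices M) w)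
  simpa only [wt_zero, one_mul] using (wnorm_ne_top_iff hw).1 h1

theorem memLp_of_summable_coefSq {T : ι → T3 → ℝ} (hT : ∀ c, Integrable (T c))
    (h : Summable (coefSq T)) (c : ι) : MemLp (T c) 2 volume :=
  memLp_two_of_summable (hT c) (h.of_nonneg_of_le (fun _ => sq_nonneg _) fun m =>
    Finset.single_le_sum (f := fun c => coef (T c) m ^ 2) (fun _ _ => sq_nonneg _)
      (Finset.mem_univ c))

theorem exists_hasWeakDeriv {I : Fin 3 → ℕ} {f : T3 → ℝ} (hf : MemLp f 2 volume)
    (h : Summable fun m => wt I m * coef f m ^ 2) : ∃ g, HasWeakDeriv I f g := by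
  have hF := IsFourier.toDistr hf
  have hs : Summable fun m => DMulti I (toDistr f) (trig m) ^ 2 := by
    rw [← tsum_ofReal_ne_top_iff fun m => sq_nonneg _, tsum_DMulti hF.homog]
    exact (tsum_ofReal_ne_top_iff fun m => mul_nonneg (wt_nonneg I m) (sq_nonneg _)).2 h
  obtain ⟨g, hg, hgf⟩ := (hF.DMulti I).exists_memLp hs
  exact ⟨g, hasWeakDeriv_iff.2 ⟨integrable_of_memLp_two hf, integrable_of_memLp_two hg, hgf⟩⟩

/-- Both sides may be infinite. If the sum is finite, the weak derivatives are synthesized from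
their coefficients; the other inequality holds for every admissible choice of weak derivatives. -/
theorem frameNorm_eq {T : ι → T3 → ℝ} (hT : ∀ c, Integrable (T c)) (M : ℕ) :
    frameNorm M T = sobolev M (coefSq T) := by
  refine le_antisymm ?_ ?_
  · by_cases h : sobolev M (coefSq T) = ⊤
    · rw [h]; exact le_top
    have hL := memLp_of_summable_coefSq hT (summable_of_sobolev (coefSq_nonneg T) h)
    refine Finset.sum_le_sum fun I hI => ?_
    have h1 := (wnorm_ne_top_iff (coefSq_nonneg T)).1
      (ne_top_of_le_ne_top h (wnorm_le_sobolev hI _))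
    have h2 : ∀ c, ∃ g, HasWeakDeriv I (T c) g := fun c => by
      refine exists_hasWeakDeriv (hL c) (h1.of_nonneg_of_le
        (fun m => mul_nonneg (wt_nonneg I m) (sq_nonneg _)) fun m =>
          mul_le_mul_of_nonneg_left ?_ (wt_nonneg I m))
      exact Finset.single_le_sum (f := fun c => coef (T c) m ^ 2) (fun _ _ => sq_nonneg _)
        (Finset.mem_univ c)
    choose G hG using h2
    exact (iInf₂_le G hG).trans_eq (eLpNorm_of_hasWeakDeriv hG)
  · exact Finset.sum_le_sum fun I _ => le_iInf₂ fun G hG => (eLpNorm_of_hasWeakDeriv hG).ge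

theorem frameNorm_eq_of_eqDistr {G : ι → T3 → ℝ} (hG : ∀ c, Integrable (G c)) {u : ι → Distr}
    (hu : ∀ c, EqDistr (u c) (toDistr (G c))) (M : ℕ) :
    frameNorm M G = sobolev M fun m => ∑ c, u c (trig m) ^ 2 := by
  rw [frameNorm_eq hG]
  congr 1
  funext m
  exact Finset.sum_congr rfl fun c _ => by rw [hu c _ (isTest_trig m), toDistr_trig]

/-- Square summable families of Fourier distributions are given by functions. -/
theorem exists_functions {u : ι → Distr} (hu : ∀ c, IsFourier (u c)) {M : ℕ}
    (h : sobolev M (fun m => ∑ c, u c (trig m) ^ 2) ≠ ⊤) :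
    ∃ G : ι → T3 → ℝ, (∀ c, MemLp (G c) 2 volume) ∧ ∀ c, EqDistr (u c) (toDistr (G c)) := by
  have hs := summable_of_sobolev (fun m => Finset.sum_nonneg fun _ _ => sq_nonneg _) h
  have : ∀ c, ∃ g : T3 → ℝ, MemLp g 2 volume ∧ EqDistr (u c) (toDistr g) := fun c =>
    (hu c).exists_memLp (hs.of_nonneg_of_le (fun _ => sq_nonneg _) fun m =>
      Finset.single_le_sum (f := fun c => u c (trig m) ^ 2) (fun _ _ => sq_nonneg _)
        (Finset.mem_univ c))
  choose G h1 h2 using this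
  exact ⟨G, h1, h2⟩

theorem sobolev_congr_flip (M : ℕ) (w : Idx → ℝ) :
    sobolev M (fun m => w m.flip) = sobolev M w := by
  refine Finset.sum_congr rfl fun I _ => ?_
  rw [wnorm, wnorm]
  congr 1
  exact IsFourier.flipEquiv.tsum_eq fun m : Idx => ENNReal.ofReal (wt I m * w m)

theorem DMulti_single (a : Fin 3) (u : Distr) : DMulti (Pi.single a 1) u = D a u := by
  fin_cases a <;> simp [DMulti]

theorem one_le_len_freq {m : Idx} (h : m.1 ≠ 0) : 1 ≤ ∑ a, m.freq a ^ 2 := by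
  obtain ⟨a, ha⟩ := Function.ne_iff.1 h
  have h1 : (1 : ℝ) ≤ (m.1 a : ℝ) ^ 2 := by
    have : (1 : ℤ) ≤ m.1 a ^ 2 := by
      have h0 : m.1 a ≠ 0 := by simpa using ha
      have := sq_pos_of_ne_zero h0
      omega
    exact_mod_cast this
  have h2 : 1 ≤ m.freq a ^ 2 := by
    rw [Idx.freq, mul_pow]
    nlinarith [Real.pi_gt_three]
  exact h2.trans (Finset.single_le_sum (f := fun a => m.freq a ^ 2) (fun _ _ => sq_nonneg _)
    (Finset.mem_univ a))

/-- Only the two indices with k = 0 have zero frequency; all others satisfy |ξ| ≥ 1. Square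
integrability of the gradient thus implies that of the function. -/
theorem summable_of_summable_freq {w : Idx → ℝ} (hw : ∀ m, 0 ≤ w m)
    (h : Summable fun m : Idx => (∑ a, m.freq a ^ 2) * w m) : Summable w := by
  have hfin : (Function.support fun m : Idx => if m.1 = 0 then w m else 0).Finite := by
    refine (Set.Finite.prod (Set.finite_singleton (0 : Fin 3 → ℤ)) (Set.toFinite univ)).subset ?_
    intro m hm
    simp only [Function.mem_support, ne_eq, ite_eq_right_iff, not_forall] at hm
    exact ⟨hm.1, mem_univ _⟩
  refine (h.add (summable_of_hasFiniteSupport hfin)).of_nonneg_of_le hw fun m => ?_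
  by_cases hm : m.1 = 0
  · simp only [if_pos hm]
    exact le_add_of_nonneg_left (mul_nonneg (Finset.sum_nonneg fun _ _ => sq_nonneg _) (hw m))
  · simp only [if_neg hm, add_zero]
    exact le_mul_of_one_le_left (hw m) (one_le_len_freq hm)

theorem sobolev_gradient (T : ι → T3 → ℝ) (M : ℕ) :
    sobolev M (fun m => ∑ p : Fin 3 × ι, D p.1 (toDistr (T p.2)) (trig m) ^ 2)
      = sobolev M fun m => (∑ a, m.freq a ^ 2) * coefSq T m := by
  rw [← sobolev_congr_flip M fun m => (∑ a, m.freq a ^ 2) * coefSq T m]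
  congr 1
  funext m
  simp only [(isHomog_toDistr _).D_trig, Fintype.sum_prod_type, coefSq, Finset.sum_mul_sum,
    Idx.freq_flip, toDistr_trig]
  refine Finset.sum_congr rfl fun a _ => Finset.sum_congr rfl fun c _ => ?_
  linear_combination (m.freq a ^ 2 * coef (T c) m.flip ^ 2) * m.sgn_sq

theorem gradNorm_eq {T : ι → T3 → ℝ} (hT : ∀ c, Integrable (T c)) (M : ℕ) :
    gradNorm M T = sobolev M fun m => (∑ a, m.freq a ^ 2) * coefSq T m := by
  have hn : ∀ m : Idx, 0 ≤ (∑ a, m.freq a ^ 2) * coefSq T m := fun m =>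
    mul_nonneg (Finset.sum_nonneg fun _ _ => sq_nonneg _) (coefSq_nonneg T m)
  refine le_antisymm ?_ (le_iInf₂ fun G hG => ?_)
  · by_cases h : sobolev M (fun m => (∑ a, m.freq a ^ 2) * coefSq T m) = ⊤
    · rw [h]; exact le_top
    have hL := memLp_of_summable_coefSq hT (summable_of_summable_freq (coefSq_nonneg T)
      (summable_of_sobolev hn h))
    rw [← sobolev_gradient] at h ⊢
    obtain ⟨G, h1, h2⟩ := exists_functions
      (fun p : Fin 3 × ι => (IsFourier.toDistr (hL p.2)).D p.1) h
    refine (iInf₂_le G fun a c => ?_).trans_eq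
      (frameNorm_eq_of_eqDistr (fun p => integrable_of_memLp_two (h1 p)) h2 M)
    rw [hasWeakDeriv_iff, DMulti_single]
    exact ⟨hT c, integrable_of_memLp_two (h1 (a, c)), h2 (a, c)⟩
  · simp only [hasWeakDeriv_iff, DMulti_single] at hG
    rw [← sobolev_gradient, frameNorm_eq_of_eqDistr (fun p => (hG p.1 p.2).2.1)
      (u := fun p : Fin 3 × ι => D p.1 (toDistr (T p.2))) (fun p => (hG p.1 p.2).2.2) M]

/-- If the coefficient sum is finite, the distribution v is an L² function, which is then admissible
in the infimum. -/
theorem timeDerivNorm_le {T : ℝ → ι → T3 → ℝ} {v : ι → Distr} {t : ℝ}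
    (hv : ∀ c, IsFourier (v c)) (h : ∀ c, HasTimeDeriv (fun s => toDistr (T s c)) (v c) t)
    (M : ℕ) : timeDerivNorm M T t ≤ sobolev M fun m => ∑ c, v c (trig m) ^ 2 := by
  by_cases hs : sobolev M (fun m => ∑ c, v c (trig m) ^ 2) = ⊤
  · rw [hs]; exact le_top
  obtain ⟨G, h1, h2⟩ := exists_functions hv hs
  have hi := fun c => integrable_of_memLp_two (h1 c)
  refine (iInf₂_le G fun c => ⟨hi c, fun ψ hψ => ?_⟩).trans_eq (frameNorm_eq_of_eqDistr hi h2 M)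
  rw [← h2 c ψ hψ]
  exact h c ψ hψ

end Norms

/-! ### The Fourier modes of a solution -/

namespace Kasner

variable (B : Kasner) (t : ℝ) (i : Fin 3) (X : Fin 3 → ℝ)

theorem sum_ginv_mul : ∑ a, B.ginv t i a * X a = t ^ (-(2 * B.q i)) * X i := by simp [ginv]
theorem sum_g_mul : ∑ a, B.g t i a * X a = t ^ (2 * B.q i) * X i := by simp [g]
theorem sum_bigK_mul : ∑ a, B.bigK a i * X a = -(B.q i * X i) := by simp [bigK]
theorem hatK_eq (j : Fin 3) : B.hatK i j = if i = j then B.κ i else 0 := by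
  by_cases h : i = j <;> simp [h, hatK, bigK, κ]; ring
theorem sum_hatK_mul : ∑ a, B.hatK i a * X a = B.κ i * X i := by simp [hatK_eq]
theorem sum_hatK_mul_left : ∑ a, B.hatK a i * X a = B.κ i * X i := by simp [hatK_eq]

end Kasner

/-- Homogeneity is all that is needed to differentiate the Christoffel distributions once more on
trigonometric functions. -/
theorem isHomog_christ (B : Kasner) (F : Fields) (t : ℝ) (a i b : Fin 3) :
    IsHomog (christ B F t a i b) := fun c ψ => by
  have hD (e p) := (isHomog_toDistr (F.h t p)).D e c ψ
  simp only [christ, Pi.smul_apply, Finset.sum_apply, Pi.add_apply, Pi.sub_apply, smul_eq_mul, hD,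
    Finset.mul_sum]
  exact Finset.sum_congr rfl fun e _ => by ring

theorem christ_trig (B : Kasner) (F : Fields) (t : ℝ) (a i b : Fin 3) (m : Idx) :
    christ B F t a i b (trig m) = -m.sgn * (1 / 2 * (t ^ (-(2 * B.q i)) *
      (m.freq a * coef (F.h t (i, b)) m.flip + m.freq b * coef (F.h t (a, i)) m.flip
        - m.freq i * coef (F.h t (a, b)) m.flip))) := by
  simp only [christ, Pi.smul_apply, Finset.sum_apply, Pi.add_apply, Pi.sub_apply, smul_eq_mul,
    (isHomog_toDistr _).D_trig, toDistr_trig, Kasner.sum_ginv_mul]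
  ring

theorem D_christ_trig (B : Kasner) (F : Fields) (t : ℝ) (e a i b : Fin 3) (m : Idx) :
    D e (christ B F t a i b) (trig m) = -(1 / 2 * (t ^ (-(2 * B.q i)) * m.freq e *
      (m.freq a * coef (F.h t (i, b)) m + m.freq b * coef (F.h t (a, i)) m
        - m.freq i * coef (F.h t (a, b)) m))) := by
  rw [(isHomog_christ B F t a i b).D_trig, christ_trig, Idx.flip_flip, Idx.freq_flip, Idx.sgn_flip]
  linear_combination (-(1 / 2 * (t ^ (-(2 * B.q i)) * m.freq e *
      (m.freq a * coef (F.h t (i, b)) m + m.freq b * coef (F.h t (a, i)) m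
        - m.freq i * coef (F.h t (a, b)) m)))) * m.sgn_mul_sgn

/-- The Fourier mode of the linearized variables with index `m`. -/
def Fields.mode (F : Fields) (m : Idx) : Mode where
  h t i j := coef (F.h t (i, j)) m
  K t i j := coef (F.K t (i, j)) m
  φ t := coef (F.φ t) m
  f t := t * coef (F.dtφ t) m
  n t := coef (F.n t) m

theorem Idx.sgn_ne_zero (m : Idx) : m.sgn ≠ 0 := fun h => by simpa [h] using m.sgn_mul_sgn

namespace IsLinearizedSolution

variable {B : Kasner} {F : Fields} {t : ℝ}

theorem lap_trig (B : Kasner) (t : ℝ) (f : T3 → ℝ) (m : Idx) :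
    lap B t (toDistr f) (trig m) = -(Mode.symb B m.freq t * coef f m) := by
  simp only [lap, Finset.sum_apply, Pi.smul_apply, smul_eq_mul, (isHomog_toDistr _).D_D_trig,
    toDistr_trig, Kasner.sum_ginv_mul, Mode.symb, Finset.sum_mul, ← Finset.sum_neg_distrib]
  exact Finset.sum_congr rfl fun _ _ => by ring

theorem hatKK_trig (B : Kasner) (F : Fields) (t : ℝ) (m : Idx) :
    hatKK B F t (trig m) = ∑ a, B.κ a * (F.mode m).K t a a := by
  simp only [hatKK, Finset.sum_apply, Pi.smul_apply, smul_eq_mul, toDistr_trig,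
    Kasner.sum_hatK_mul, Fields.mode]

theorem coef_symm (hF : IsLinearizedSolution B F) (ht : t ∈ Ioc (0 : ℝ) 1) (m : Idx) (i j : Fin 3) :
    coef (F.h t (i, j)) m = coef (F.h t (j, i)) m := congrFun (coef_congr (hF.symm_h t ht i j)) m

theorem scalCurv_trig (hF : IsLinearizedSolution B F) (ht : t ∈ Ioc (0 : ℝ) 1) (m : Idx) :
    scalCurv B F t (trig m) = Mode.symb B m.freq t * (F.mode m).tr B t
      - ∑ a, t ^ (-(2 * B.q a)) * m.freq a * (F.mode m).w B m.freq t a := by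
  simp only [scalCurv, Pi.add_apply, Pi.neg_apply, Finset.sum_apply, Pi.smul_apply, smul_eq_mul,
    (isHomog_toDistr _).D_D_trig, D_christ_trig, toDistr_trig, mul_assoc, ← Finset.mul_sum,
    Kasner.sum_ginv_mul, Mode.symb, Mode.tr, Mode.w, Fields.mode]
  simp only [Fin.sum_univ_three, hF.coef_symm ht m 1 0, hF.coef_symm ht m 2 0,
    hF.coef_symm ht m 2 1]
  ring

theorem ric_trig (hF : IsLinearizedSolution B F) (ht : t ∈ Ioc (0 : ℝ) 1) (m : Idx)
    (i j : Fin 3) :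
    ric B F t i j (trig m) = t ^ (-(2 * B.q i)) * (1 / 2 * (Mode.symb B m.freq t *
      (F.mode m).h t i j - m.freq j * (F.mode m).w B m.freq t i
      - m.freq i * (F.mode m).w B m.freq t j + m.freq i * m.freq j * (F.mode m).tr B t)) := by
  have h1 : t ^ (2 * B.q j) * t ^ (-(2 * B.q j)) = 1 := by
    rw [← Real.rpow_add ht.1]; simp
  simp only [ric, Pi.add_apply, Pi.neg_apply, Finset.sum_apply, Pi.smul_apply, smul_eq_mul,
    (isHomog_toDistr _).D_D_trig, D_christ_trig, toDistr_trig, mul_assoc, ← Finset.mul_sum,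
    Kasner.sum_ginv_mul, Kasner.sum_g_mul, Mode.symb, Mode.tr, Mode.w, Fields.mode]
  simp only [Fin.sum_univ_three, hF.coef_symm ht m 0 i, hF.coef_symm ht m 1 i,
    hF.coef_symm ht m 2 i, hF.coef_symm ht m 0 j, hF.coef_symm ht m 1 j, hF.coef_symm ht m 2 j,
    hF.coef_symm ht m j i]
  linear_combination (-(1 / 2 * t ^ (-(2 * B.q i)) * (m.freq i * (1 / 2 *
    (t ^ (-(2 * B.q 0)) * (2 * m.freq 0 * coef (F.h t (j, 0)) m - m.freq j * coef (F.h t (0, 0)) m)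
    + t ^ (-(2 * B.q 1)) * (2 * m.freq 1 * coef (F.h t (j, 1)) m - m.freq j * coef (F.h t (1, 1)) m)
    + t ^ (-(2 * B.q 2)) * (2 * m.freq 2 * coef (F.h t (j, 2)) m
      - m.freq j * coef (F.h t (2, 2)) m)))))) * h1

theorem evol_K_trig (hF : IsLinearizedSolution B F) (ht : t ∈ Ioc (0 : ℝ) 1) (m : Idx)
    (i j : Fin 3) :
    (-(t • ∑ a, B.ginv t i a • D a (D j (toDistr (F.n t))))
        - (t⁻¹ * B.bigK i j) • toDistr (F.n t) + t • ric B F t i j) (trig m)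
      = t⁻¹ * (F.mode m).rhsK B m.freq t i j := by
  have := ht.1.ne'
  simp only [Pi.add_apply, Pi.sub_apply, Pi.neg_apply, Finset.sum_apply, Pi.smul_apply, smul_eq_mul,
    (isHomog_toDistr _).D_D_trig, hF.ric_trig ht, toDistr_trig, Kasner.sum_ginv_mul, Mode.rhsK]
  rw [Kasner.bigK]
  split_ifs <;> simp only [Fields.mode] <;> field_simp <;> ring

theorem wave_trig (B : Kasner) (F : Fields) (ht : t ∈ Ioc (0 : ℝ) 1) (m : Idx) :
    (t • lap B t (toDistr (F.φ t)) - (B.A * t⁻¹) • toDistr (F.n t)) (trig m)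
      = t⁻¹ * (F.mode m).rhsg B m.freq t := by
  have := ht.1.ne'
  simp only [Pi.sub_apply, Pi.smul_apply, smul_eq_mul, lap_trig, toDistr_trig, Mode.rhsg,
    Fields.mode]
  field_simp

theorem momentum_trig (hF : IsLinearizedSolution B F) (ht : t ∈ Ioc (0 : ℝ) 1) (m : Idx)
    (i : Fin 3) : ∑ a, m.freq a * (F.mode m).K t a i = -(B.A * m.freq i * (F.mode m).φ t)
    + 1 / 2 * m.freq i * ∑ a, (B.κ a - B.κ i) * t ^ (-(2 * B.q a)) * (F.mode m).h t a a := by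
  -- Every term has one derivative, so testing against the flipped index makes all coefficients
  -- appear at m itself, up to the common sign that is cancelled below.
  have h := hF.momentum t ht i _ (isTest_trig m.flip)
  simp only [Pi.add_apply, Pi.sub_apply, Pi.neg_apply, Finset.sum_apply, Pi.smul_apply, smul_eq_mul,
    (isHomog_toDistr _).D_trig, christ_trig, toDistr_trig, Kasner.sum_hatK_mul,
    Kasner.sum_hatK_mul_left, Idx.flip_flip, Idx.freq_flip, Idx.sgn_flip] at h
  simp only [Fields.mode]
  simp only [Fin.sum_univ_three] at h ⊢
  refine sub_eq_zero.1 ((mul_eq_zero.1 ?_).resolve_left m.sgn_ne_zero)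
  linear_combination h

theorem momentum'_trig (hF : IsLinearizedSolution B F) (ht : t ∈ Ioc (0 : ℝ) 1) (m : Idx)
    (i : Fin 3) : ∑ a, t ^ (-(2 * B.q a)) * m.freq a * (F.mode m).K t i a
    = -(B.A * t ^ (-(2 * B.q i)) * m.freq i * (F.mode m).φ t)
      + t ^ (-(2 * B.q i)) * ∑ a, t ^ (-(2 * B.q a)) * (B.κ i - B.κ a)
        * (m.freq a * (F.mode m).h t i a - 1 / 2 * m.freq i * (F.mode m).h t a a) := by
  have h := hF.momentum' t ht i _ (isTest_trig m.flip)
  simp only [Pi.add_apply, Pi.sub_apply, Pi.neg_apply, Finset.sum_apply, Pi.smul_apply, smul_eq_mul,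
    (isHomog_toDistr _).D_trig, christ_trig, toDistr_trig, mul_assoc, ← Finset.mul_sum,
    Kasner.sum_hatK_mul, Kasner.sum_ginv_mul,
    Kasner.sum_hatK_mul_left, Idx.flip_flip, Idx.freq_flip, Idx.sgn_flip] at h
  simp only [Fields.mode]
  simp only [Fin.sum_univ_three, hF.coef_symm ht m 0 i, hF.coef_symm ht m 1 i,
    hF.coef_symm ht m 2 i] at h ⊢
  refine sub_eq_zero.1 ((mul_eq_zero.1 ?_).resolve_left m.sgn_ne_zero)
  linear_combination h

theorem mode_isSol (hF : IsLinearizedSolution B F) (m : Idx) : (F.mode m).IsSol B m.freq where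
  symm t ht i j := hF.coef_symm ht m i j
  tr_K t ht := by
    have h : ∑ a, coef (F.K t (a, a)) m = coef (fun x => ∑ a, F.K t (a, a) x) m := by
      simp only [coef, Finset.sum_mul]
      exact (integral_finsetSum _ fun a _ => (isTest_trig m).integrable_mul (hF.int_K t ht _)).symm
    exact h.trans (by rw [coef_congr (g := fun _ => 0) (hF.cmc t ht)]; simp [coef])
  mom t ht i := hF.momentum_trig ht m i
  mom' t ht i := hF.momentum'_trig ht m i
  lapse t ht := by
    have h := hF.lapse t ht _ (isTest_trig m)
    simp only [Pi.add_apply, Pi.smul_apply, smul_eq_mul, lap_trig, hatKK_trig, toDistr_trig] at h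
    simp only [Fields.mode] at h ⊢
    linear_combination h
  lapse' t ht := by
    have h := hF.lapse' t ht _ (isTest_trig m)
    simp only [Pi.sub_apply, Pi.smul_apply, smul_eq_mul, lap_trig, hF.scalCurv_trig ht,
      toDistr_trig] at h
    rw [← h]
    simp only [Fields.mode]
    ring
  evol_h t ht i j := by
    refine (hF.evol_h t ht i j _ (isTest_trig m)).congr_deriv ?_
    simp only [Pi.sub_apply, Pi.neg_apply, Finset.sum_apply, Pi.smul_apply, smul_eq_mul,
      toDistr_trig, mul_assoc, Kasner.sum_g_mul, Kasner.sum_bigK_mul]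
    rw [Kasner.bigK]
    split_ifs <;> simp only [Fields.mode] <;> ring
  evol_K t ht i j := by
    rw [← hF.evol_K_trig ht]
    exact hF.evol_K t ht i j _ (isTest_trig m)
  dt_φ t ht := by
    have h := hF.dt_φ t ht _ (isTest_trig m)
    exact h.congr_deriv (inv_mul_cancel_left₀ ht.1.ne' _).symm
  wave t ht := by
    rw [← wave_trig B F ht]
    exact hF.wave t ht _ (isTest_trig m)

end IsLinearizedSolution

/-! ### Inequalities between weighted norms of Fourier coefficients -/

theorem wnorm_mono (I : Fin 3 → ℕ) {w w' : Idx → ℝ} (h : ∀ m, w m ≤ w' m) :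
    wnorm I w ≤ wnorm I w' :=
  ENNReal.rpow_le_rpow (ENNReal.tsum_le_tsum fun m => ENNReal.ofReal_le_ofReal
    (mul_le_mul_of_nonneg_left (h m) (wt_nonneg I m))) (by norm_num)

theorem wnorm_add_le (I : Fin 3 → ℕ) (w w' : Idx → ℝ) :
    wnorm I (fun m => w m + w' m) ≤ wnorm I w + wnorm I w' := by
  refine le_trans (ENNReal.rpow_le_rpow ?_ (by norm_num))
    (ENNReal.rpow_add_le_add_rpow _ _ (by norm_num) (by norm_num))
  rw [← ENNReal.tsum_add]
  exact ENNReal.tsum_le_tsum fun m => by rw [mul_add]; exact ENNReal.ofReal_add_le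

theorem wnorm_sq_mul (I : Fin 3 → ℕ) {c : ℝ} (hc : 0 ≤ c) (w : Idx → ℝ) :
    wnorm I (fun m => c ^ 2 * w m) = ENNReal.ofReal c * wnorm I w := by
  have h : ∀ m, ENNReal.ofReal (wt I m * (c ^ 2 * w m))
      = ENNReal.ofReal (c ^ 2) * ENNReal.ofReal (wt I m * w m) := fun m => by
    rw [← ENNReal.ofReal_mul (sq_nonneg c)]
    congr 1
    ring
  rw [wnorm, wnorm]
  simp only [h, ENNReal.tsum_mul_left]
  rw [ENNReal.mul_rpow_of_nonneg _ _ (by norm_num), ENNReal.ofReal_rpow_of_nonneg (sq_nonneg c)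
    (by norm_num), ← Real.sqrt_eq_rpow, Real.sqrt_sq hc]

theorem wt_add_single (I : Fin 3 → ℕ) (a : Fin 3) (m : Idx) :
    wt (I + Pi.single a 1) m = m.freq a ^ 2 * wt I m := by
  fin_cases a <;> simp [wt, Fin.prod_univ_three] <;> ring

theorem wnorm_freq_le (I : Fin 3 → ℕ) (w : Idx → ℝ) :
    wnorm I (fun m => (∑ a, m.freq a ^ 2) * w m) ≤ ∑ a, wnorm (I + Pi.single a 1) w := by
  have h : ∀ a, wnorm I (fun m => m.freq a ^ 2 * w m) = wnorm (I + Pi.single a 1) w := fun a => by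
    simp only [wnorm, wt_add_single]
    congr! 4
    ring
  simp only [Fin.sum_univ_three, ← h, add_mul]
  exact (wnorm_add_le I _ _).trans (add_le_add_left (wnorm_add_le I _ _) _)

theorem mem_multiIndices {M : ℕ} {I : Fin 3 → ℕ} : I ∈ multiIndices M ↔ ∑ i, I i ≤ M := by
  simp only [multiIndices, Finset.mem_filter, Fintype.mem_piFinset, Finset.mem_range,
    and_iff_right_iff_imp]
  exact fun h i => Nat.lt_succ_of_le ((Finset.single_le_sum (fun _ _ => Nat.zero_le _)
    (Finset.mem_univ i)).trans h)

theorem sobolev_mono (M : ℕ) {w w' : Idx → ℝ} (h : ∀ m, w m ≤ w' m) :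
    sobolev M w ≤ sobolev M w' := Finset.sum_le_sum fun I _ => wnorm_mono I h

theorem sobolev_mono_order {M M' : ℕ} (h : M ≤ M') (w : Idx → ℝ) : sobolev M w ≤ sobolev M' w :=
  Finset.sum_le_sum_of_subset fun _ hI => mem_multiIndices.2 ((mem_multiIndices.1 hI).trans h)

theorem sobolev_add_le (M : ℕ) (w w' : Idx → ℝ) :
    sobolev M (fun m => w m + w' m) ≤ sobolev M w + sobolev M w' := by
  rw [sobolev, sobolev, sobolev, ← Finset.sum_add_distrib]
  exact Finset.sum_le_sum fun I _ => wnorm_add_le I w w'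

theorem sobolev_sq_mul (M : ℕ) {c : ℝ} (hc : 0 ≤ c) (w : Idx → ℝ) :
    sobolev M (fun m => c ^ 2 * w m) = ENNReal.ofReal c * sobolev M w := by
  rw [sobolev, sobolev, Finset.mul_sum]
  exact Finset.sum_congr rfl fun I _ => wnorm_sq_mul I hc w

/-- Raising one entry of a multi-index is injective, so the constant is 3 for every M. This keeps
the final constant independent of N. -/
theorem sobolev_freq_le (M : ℕ) (w : Idx → ℝ) :
    sobolev M (fun m => (∑ a, m.freq a ^ 2) * w m) ≤ 3 * sobolev (M + 1) w := by
  have h : ∀ a : Fin 3, ∑ I ∈ multiIndices M, wnorm (I + Pi.single a 1) w ≤ sobolev (M + 1) w := by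
    intro a
    rw [← Finset.sum_image (f := fun J => wnorm J w) (g := fun I => I + Pi.single a 1)
      fun _ _ _ _ h => add_right_cancel h]
    refine Finset.sum_le_sum_of_subset fun J hJ => ?_
    obtain ⟨I, hI, rfl⟩ := Finset.mem_image.1 hJ
    have := mem_multiIndices.1 hI
    simpa [mem_multiIndices, Finset.sum_add_distrib] using this
  calc sobolev M (fun m => (∑ a, m.freq a ^ 2) * w m)
      ≤ ∑ I ∈ multiIndices M, ∑ a, wnorm (I + Pi.single a 1) w :=
        Finset.sum_le_sum fun I _ => wnorm_freq_le I w
    _ = ∑ a, ∑ I ∈ multiIndices M, wnorm (I + Pi.single a 1) w := Finset.sum_comm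
    _ ≤ ∑ _a : Fin 3, sobolev (M + 1) w := Finset.sum_le_sum fun a _ => h a
    _ = 3 * sobolev (M + 1) w := by simp

theorem sobolev_one_add_freq_le (M : ℕ) (w : Idx → ℝ) :
    sobolev M (fun m => (1 + ∑ a, m.freq a ^ 2) * w m) ≤ 4 * sobolev (M + 1) w := by
  simp only [add_mul, one_mul]
  refine (sobolev_add_le M _ _).trans ((add_le_add (sobolev_mono_order M.le_succ w)
    (sobolev_freq_le M w)).trans_eq ?_)
  ring

/-- A function whose gradient lies in `H^M` and which is square integrable lies in `H^{M+1}`. -/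
theorem sobolev_succ_ne_top {M : ℕ} {w : Idx → ℝ} (hw : ∀ m, 0 ≤ w m) (h0 : sobolev 0 w ≠ ⊤)
    (h1 : sobolev M (fun m => (∑ a, m.freq a ^ 2) * w m) ≠ ⊤) : sobolev (M + 1) w ≠ ⊤ := by
  refine ENNReal.sum_ne_top.2 fun I hI => ?_
  by_cases hI0 : I = 0
  · subst hI0
    exact ((wnorm_le_sobolev (zero_mem_multiIndices 0) w).trans_lt h0.lt_top).ne
  obtain ⟨a, ha⟩ := Function.ne_iff.1 hI0
  have hJ : I - Pi.single a 1 + Pi.single a 1 = I := by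
    refine tsub_add_cancel_of_le fun b => ?_
    by_cases hb : b = a
    · subst hb; simpa using Nat.one_le_iff_ne_zero.2 ha
    · simp [hb]
  have hmem : I - Pi.single a 1 ∈ multiIndices M := by
    have := mem_multiIndices.1 hI
    rw [← hJ] at this
    simpa [mem_multiIndices, Finset.sum_add_distrib] using this
  refine ((le_trans ?_ (wnorm_le_sobolev hmem _)).trans_lt h1.lt_top).ne
  refine ENNReal.rpow_le_rpow (ENNReal.tsum_le_tsum fun m => ENNReal.ofReal_le_ofReal ?_)
    (by norm_num)
  rw [← hJ, wt_add_single, hJ]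
  have h2 : m.freq a ^ 2 ≤ ∑ b, m.freq b ^ 2 :=
    Finset.single_le_sum (f := fun b => m.freq b ^ 2) (fun _ _ => sq_nonneg _) (Finset.mem_univ a)
  calc m.freq a ^ 2 * wt (I - Pi.single a 1) m * w m
      = m.freq a ^ 2 * (wt (I - Pi.single a 1) m * w m) := by ring
    _ ≤ (∑ b, m.freq b ^ 2) * (wt (I - Pi.single a 1) m * w m) :=
        mul_le_mul_of_nonneg_right h2 (mul_nonneg (wt_nonneg _ _) (hw m))
    _ = _ := by ring

theorem sobolev_sum_sq_le {ι : Type} [Fintype ι] (M : ℕ) {a : ι → Idx → ℝ} {W : Idx → ℝ}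
    {c : ℝ} (hc : 0 ≤ c) (h : ∀ p m, |a p m| ≤ c * W m) :
    sobolev M (fun m => ∑ p, a p m ^ 2)
      ≤ ENNReal.ofReal (Fintype.card ι * c) * sobolev M fun m => W m ^ 2 := by
  rw [← sobolev_sq_mul M (by positivity)]
  refine sobolev_mono M fun m => ?_
  calc ∑ p, a p m ^ 2 ≤ ∑ _p : ι, (c * W m) ^ 2 :=
        Finset.sum_le_sum fun p _ => sq_le_sq.2 ((h p m).trans (le_abs_self _))
    _ = (Fintype.card ι : ℝ) * (c * W m) ^ 2 := by simp
    -- Using the square avoids a square root of the number of components in the resulting norm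
    -- bound.
    _ ≤ (Fintype.card ι : ℝ) ^ 2 * (c * W m) ^ 2 := by
        refine mul_le_mul_of_nonneg_right ?_ (sq_nonneg _)
        exact_mod_cast Nat.le_self_pow two_ne_zero _
    _ = _ := by ring

/-! ### From estimates for the modes to estimates for the solution -/

/-- The size at time `1` of the Fourier mode with index `m`. -/
def Fields.data (F : Fields) (m : Idx) : ℝ := (F.mode m).data m.freq

theorem Fields.data_nonneg (F : Fields) (m : Idx) : 0 ≤ F.data m := Mode.data_nonneg _ _

theorem scalarNorm_eq {f : T3 → ℝ} (hf : Integrable f) (M : ℕ) :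
    scalarNorm M f = sobolev M fun m => coef f m ^ 2 := by
  rw [scalarNorm, frameNorm_eq (fun _ => hf)]
  congr 1
  funext m
  simp [coefSq]

theorem scalarGradNorm_eq {f : T3 → ℝ} (hf : Integrable f) (M : ℕ) :
    scalarGradNorm M f = sobolev M fun m => (∑ a, m.freq a ^ 2) * coef f m ^ 2 := by
  rw [scalarGradNorm, gradNorm_eq (fun _ => hf)]
  simp [coefSq]

/-- The weight `1 + |ξ|`. -/
def Idx.wgt (m : Idx) : ℝ := 1 + Mode.len m.freq

theorem Idx.one_le_wgt (m : Idx) : 1 ≤ m.wgt := by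
  rw [wgt]
  linarith [Mode.len_nonneg m.freq]

/-- Each weight costs 8 = 2 · 4: the 2 from (1 + |ξ|)² ≤ 4 (1 + |ξ|²), the 4 from
`sobolev_one_add_freq_le`. -/
theorem sobolev_wgt_le (N k : ℕ) (w : Idx → ℝ) :
    sobolev N (fun m => (m.wgt ^ k * w m) ^ 2)
      ≤ ENNReal.ofReal (8 ^ k) * sobolev (N + k) fun m => w m ^ 2 := by
  induction k generalizing N with
  | zero => simp
  | succ k ih =>
    calc sobolev N (fun m => (m.wgt ^ (k + 1) * w m) ^ 2)
      _ ≤ sobolev N (fun m => 2 ^ 2 * ((1 + ∑ a, m.freq a ^ 2) * (m.wgt ^ k * w m) ^ 2)) := by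
          refine sobolev_mono N fun m => ?_
          rw [← mul_assoc, ← Mode.len_sq,
            show (m.wgt ^ (k + 1) * w m) ^ 2 = m.wgt ^ 2 * (m.wgt ^ k * w m) ^ 2 by ring]
          refine mul_le_mul_of_nonneg_right ?_ (sq_nonneg _)
          rw [Idx.wgt]
          nlinarith [sq_nonneg (Mode.len m.freq - 1)]
      _ ≤ ENNReal.ofReal 2 * (4 * (ENNReal.ofReal (8 ^ k) *
            sobolev (N + 1 + k) fun m => w m ^ 2)) := by
          rw [sobolev_sq_mul N (by norm_num)]
          exact mul_le_mul_right ((sobolev_one_add_freq_le N _).trans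
            (mul_le_mul_right (ih (N + 1)) _)) _
      _ = _ := by
          rw [← mul_assoc, ← mul_assoc, add_assoc, add_comm 1 k, pow_succ,
            ENNReal.ofReal_mul (by positivity), mul_comm (ENNReal.ofReal (8 ^ k))]
          congr 2
          norm_num

namespace IsLinearizedSolution

variable {B : Kasner} {F : Fields} {t : ℝ} {N : ℕ}

theorem one_mem : (1 : ℝ) ∈ Ioc (0 : ℝ) 1 := ⟨one_pos, le_rfl⟩

theorem sobolev_data_le (hF : IsLinearizedSolution B F) (N : ℕ) :
    sobolev N (fun m => F.data m ^ 2) ≤ highNorm F N 1 := by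
  have h : ∀ m, F.data m ^ 2 = coefSq (F.K 1) m + (∑ a, m.freq a ^ 2) * coefSq (F.h 1) m
      + coef (fun x => 1 * F.dtφ 1 x) m ^ 2 + (∑ a, m.freq a ^ 2) * coef (F.φ 1) m ^ 2
      + coef (F.n 1) m ^ 2 := fun m => by
    rw [Fields.data, Mode.data_sq, Mode.len_sq]
    simp [Fields.mode, coefSq, Fintype.sum_prod_type]
  simp only [h]
  rw [highNorm, frameNorm_eq (hF.int_K 1 one_mem), gradNorm_eq (hF.int_h 1 one_mem),
    scalarNorm_eq (by simpa using hF.int_dtφ 1 one_mem), scalarGradNorm_eq (hF.int_φ 1 one_mem)]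
  refine (sobolev_add_le N _ _).trans (add_le_add ((sobolev_add_le N _ _).trans (add_le_add
    ((sobolev_add_le N _ _).trans (add_le_add_left (sobolev_add_le N _ _) _)) (by simp))) ?_)
  -- Of the three lapse terms in `highNorm` only the one with p = 0 is needed.
  refine le_trans ?_ (Finset.single_le_sum (f := fun p : ℕ => ENNReal.ofReal
    ((1 : ℝ) ^ ((2 / 3 : ℝ) * (p : ℝ))) * scalarNorm (N + p) (F.n 1)) (fun _ _ => zero_le)
    (Finset.mem_range.2 (by norm_num : 0 < 3)))
  simp [scalarNorm_eq (hF.int_n 1 one_mem)]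

section Components

variable {ι : Type} [Fintype ι] {a : ι → Idx → ℝ} {T : ι → T3 → ℝ} {c C : ℝ} {M k : ℕ}

/-- The number k counts the derivatives given up. The factor 576 is 9 · 8², for at most nine
components and two derivatives. -/
theorem sobolev_le (hF : IsLinearizedSolution B F) (hN : M + k = N) (hk : k ≤ 2)
    (hι : Fintype.card ι ≤ 9) (hc : 0 ≤ c) (hC : 576 * c ≤ C)
    (h : ∀ p m, |a p m| ≤ c * (m.wgt ^ k * F.data m)) :
    sobolev M (fun m => ∑ p, a p m ^ 2) ≤ ENNReal.ofReal C * highNorm F N 1 := by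
  subst hN
  refine (sobolev_sum_sq_le M hc h).trans ((mul_le_mul_right ((sobolev_wgt_le M k _).trans
    (mul_le_mul_right (hF.sobolev_data_le (M + k)) _)) _).trans ?_)
  rw [← mul_assoc, ← ENNReal.ofReal_mul (by positivity)]
  refine mul_le_mul_left (ENNReal.ofReal_le_ofReal ?_) _
  have h1 : (Fintype.card ι : ℝ) ≤ 9 := by exact_mod_cast hι
  have h2 : (8 : ℝ) ^ k ≤ 8 ^ 2 := pow_le_pow_right₀ (by norm_num) hk
  calc (Fintype.card ι : ℝ) * c * 8 ^ k ≤ 9 * c * 8 ^ 2 := by gcongr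
    _ ≤ C := by linarith

theorem frameNorm_le (hF : IsLinearizedSolution B F) (hN : M + k = N) (hk : k ≤ 2)
    (hι : Fintype.card ι ≤ 9) (hc : 0 ≤ c) (hC : 576 * c ≤ C) (hT : ∀ p, Integrable (T p))
    (h : ∀ p m, |coef (T p) m| ≤ c * (m.wgt ^ k * F.data m)) :
    frameNorm M T ≤ ENNReal.ofReal C * highNorm F N 1 := by
  rw [frameNorm_eq hT]
  exact hF.sobolev_le hN hk hι hc hC h

theorem gradNorm_le (hF : IsLinearizedSolution B F) (hN : M + k = N) (hk : k ≤ 2)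
    (hι : Fintype.card ι ≤ 9) (hc : 0 ≤ c) (hC : 576 * c ≤ C) (hT : ∀ p, Integrable (T p))
    (h : ∀ p m, Mode.len m.freq * |coef (T p) m| ≤ c * (m.wgt ^ k * F.data m)) :
    gradNorm M T ≤ ENNReal.ofReal C * highNorm F N 1 := by
  rw [gradNorm_eq hT]
  have := hF.sobolev_le (a := fun p m => Mode.len m.freq * coef (T p) m) hN hk hι hc hC fun p m => by
    rw [abs_mul, abs_of_nonneg (Mode.len_nonneg _)]
    exact h p m
  simpa only [mul_pow, ← Finset.mul_sum, Mode.len_sq, coefSq] using this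

end Components

theorem isFourier_christ (hh : ∀ p, MemLp (F.h t p) 2 volume) (B : Kasner) (a i b : Fin 3) :
    IsFourier (christ B F t a i b) :=
  (IsFourier.sum _ fun _ => ((((IsFourier.toDistr (hh _)).D _).add
    ((IsFourier.toDistr (hh _)).D _)).sub ((IsFourier.toDistr (hh _)).D _)).smul _).smul _

theorem isFourier_ric (hh : ∀ p, MemLp (F.h t p) 2 volume) (B : Kasner) (i j : Fin 3) :
    IsFourier (ric B F t i j) := by
  refine ((IsFourier.smul (IsFourier.sum _ fun _ => IsFourier.sum _ fun _ => IsFourier.sum _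
    fun _ => (((IsFourier.toDistr (hh _)).D _).D _).smul _) _).neg.add
    (IsFourier.smul (IsFourier.sum _ fun _ => IsFourier.sum _ fun _ =>
      ((isFourier_christ hh B _ _ _).D _).smul _) _)).add
    (IsFourier.smul (IsFourier.sum _ fun _ => IsFourier.sum _ fun _ => IsFourier.sum _ fun _ =>
      IsFourier.sum _ fun _ => ((isFourier_christ hh B _ _ _).D _).smul _) _)

theorem isFourier_lap {f : T3 → ℝ} (hf : MemLp f 2 volume) (B : Kasner) (t : ℝ) :
    IsFourier (lap B t (toDistr f)) :=
  IsFourier.sum _ fun _ => IsFourier.sum _ fun _ => (((IsFourier.toDistr hf).D _).D _).smul _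

/-! #### The estimates below top order -/

theorem len_mul_data_le (F : Fields) (m : Idx) :
    Mode.len m.freq * F.data m ≤ m.wgt ^ 1 * F.data m := by
  refine mul_le_mul_of_nonneg_right ?_ (F.data_nonneg m)
  rw [pow_one, Idx.wgt]
  linarith

theorem data_le (F : Fields) (m : Idx) : F.data m ≤ m.wgt ^ 1 * F.data m :=
  le_mul_of_one_le_left (F.data_nonneg m) (one_le_pow₀ m.one_le_wgt)

/-- Brings the various mode estimates to the common constant 100000 and the common loss 3000000σ. -/
theorem rpow_bound {α c σ y D W b : ℝ} (ht : t ∈ Ioc (0 : ℝ) 1) (hσ : 0 ≤ σ) (hb : b ≤ 100000) (hc : c ≤ 3000000) (hD : 0 ≤ D) (h : y ≤ b * D * t ^ (α - c * σ))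
    (hW : D ≤ W) : y ≤ 100000 * t ^ (α - 3000000 * σ) * W := by
  have h2 : t ^ (α - c * σ) ≤ t ^ (α - 3000000 * σ) :=
    Real.rpow_le_rpow_of_exponent_ge ht.1 ht.2 (by nlinarith)
  have hx := Real.rpow_nonneg ht.1.le (α - 3000000 * σ)
  calc y ≤ b * D * t ^ (α - c * σ) := h
    _ ≤ 100000 * W * t ^ (α - 3000000 * σ) := by
        have := hD.trans hW
        have := Real.rpow_nonneg ht.1.le (α - c * σ)
        gcongr
    _ = _ := by ring

theorem sigmaLoss_nonneg (hσ : B.sigma ≤ 1 / 10000000) (t : ℝ) : 0 ≤ sigmaLoss B.sigma t :=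
  zero_le_one.trans (one_le_sigmaLoss B.sigma_nonneg (hσ.trans (by norm_num)) t)

/-- The asymptotic data of the Fourier mode with index `m`. -/
def asymp (hF : IsLinearizedSolution B F) (hσ : B.sigma ≤ 1 / 10000000) (m : Idx) :
    Mode.Asymptotics (F.mode m) B m.freq :=
  ((hF.mode_isSol m).nonempty_asymptotics hσ).some

section Estimates

variable (hF : IsLinearizedSolution B F) (hσ : B.sigma ≤ 1 / 10000000) (ht : t ∈ Ioc (0 : ℝ) 1)
include hF hσ ht

theorem scalarNorm_n_le (N : ℕ) : scalarNorm N (F.n t)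
    ≤ ENNReal.ofReal (57600000 * t ^ (-(3000000 * B.sigma))) * highNorm F N 1 := by
  have hx := Real.rpow_nonneg ht.1.le (-(3000000 * B.sigma))
  refine hF.frameNorm_le (k := 0) (c := 100000 * t ^ (-(3000000 * B.sigma))) rfl (by norm_num)
    (by simp) (by positivity) (by linarith) (fun _ => hF.int_n t ht) fun _ m => ?_
  rw [pow_zero, one_mul, ← zero_sub]
  have h := (hF.mode_isSol m).abs_n_le hσ ht
  rw [← zero_sub] at h
  exact rpow_bound ht B.sigma_nonneg (by norm_num) (by norm_num)
    (F.data_nonneg m) h le_rfl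

theorem scalarNorm_n_le_one (N : ℕ) : scalarNorm N (F.n t)
    ≤ ENNReal.ofReal (57600000 * t ^ (2 / 3 - 3000000 * B.sigma)) * highNorm F (N + 1) 1 := by
  have hx := Real.rpow_nonneg ht.1.le (2 / 3 - 3000000 * B.sigma)
  refine hF.frameNorm_le (k := 1) (c := 100000 * t ^ (2 / 3 - 3000000 * B.sigma)) rfl (by norm_num)
    (by simp) (by positivity) (by linarith) (fun _ => hF.int_n t ht) fun _ m => ?_
  exact rpow_bound ht B.sigma_nonneg (by norm_num) (by norm_num)
    (mul_nonneg (Mode.len_nonneg _) (F.data_nonneg m)) ((hF.mode_isSol m).abs_n_le_len hσ ht) (len_mul_data_le F m)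

theorem scalarNorm_n_le_two (N : ℕ) : scalarNorm N (F.n t)
    ≤ ENNReal.ofReal (57600000 * sigmaLoss B.sigma t * t ^ (4 / 3 - 3000000 * B.sigma))
      * highNorm F (N + 2) 1 := by
  have hx := Real.rpow_nonneg ht.1.le (4 / 3 - 3000000 * B.sigma)
  have hL := sigmaLoss_nonneg hσ t
  refine hF.frameNorm_le (k := 2) rfl le_rfl (by simp)
    (c := 100000 * sigmaLoss B.sigma t * t ^ (4 / 3 - 3000000 * B.sigma)) (by positivity)
    (by linarith) (fun _ => hF.int_n t ht) fun _ m => ?_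
  have h1 := (hF.mode_isSol m).abs_n_le_sigmaLoss hσ ht
  have h2 : (1 + Mode.len m.freq ^ 2) * F.data m ≤ m.wgt ^ 2 * F.data m := by
    refine mul_le_mul_of_nonneg_right ?_ (F.data_nonneg m)
    rw [Idx.wgt]
    nlinarith [Mode.len_nonneg m.freq]
  refine h1.trans ?_
  rw [← mul_assoc, mul_right_comm]
  exact mul_le_mul_of_nonneg_left h2 (by positivity)

theorem gradNorm_h_le (N : ℕ) : gradNorm N (F.h t)
    ≤ ENNReal.ofReal (57600000 * sigmaLoss B.sigma t * t ^ (2 / 3 - 3000000 * B.sigma))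
      * highNorm F (N + 1) 1 := by
  have hx := Real.rpow_nonneg ht.1.le (2 / 3 - 3000000 * B.sigma)
  have hL := sigmaLoss_nonneg hσ t
  refine hF.gradNorm_le (k := 1) rfl (by norm_num) (by simp)
    (c := 100000 * sigmaLoss B.sigma t * t ^ (2 / 3 - 3000000 * B.sigma)) (by positivity)
    (by linarith) (hF.int_h t ht) fun p m => ?_
  have h1 := (hF.mode_isSol m).len_mul_abs_h_le hσ ht p.1 p.2
  refine (rpow_bound (W := sigmaLoss B.sigma t * (m.wgt ^ 1 * F.data m)) (b := 1280)
    (c := 2000000) ht B.sigma_nonneg (by norm_num) (by norm_num) ?_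
    (h1.trans_eq (mul_right_comm _ _ _)) ?_).trans_eq (by ring)
  · exact mul_nonneg hL (mul_nonneg (zero_le_one.trans m.one_le_wgt) (F.data_nonneg m))
  · rw [pow_one]; exact le_rfl

theorem frameNorm_h_le (N : ℕ) : frameNorm 0 (F.h t)
    ≤ ENNReal.ofReal (57600000 * t ^ (2 / 3 - 3000000 * B.sigma)) * (frameNorm 0 (F.h 1)
      + ENNReal.ofReal (sigmaLoss B.sigma t) * highNorm F N 1) := by
  have hx := Real.rpow_nonneg ht.1.le (2 / 3 - 3000000 * B.sigma)
  have hL := sigmaLoss_nonneg hσ t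
  rw [frameNorm_eq (hF.int_h t ht), frameNorm_eq (hF.int_h 1 one_mem)]
  set x := 57600000 * t ^ (2 / 3 - 3000000 * B.sigma) with hxdef
  have hx0 : 0 ≤ x := by positivity
  have h : ∀ m, coefSq (F.h t) m
      ≤ x ^ 2 * (coefSq (F.h 1) m + sigmaLoss B.sigma t ^ 2 * F.data m ^ 2) := fun m => by
    have h1 : ∀ p, coef (F.h t p) m ^ 2 ≤ (100000 * t ^ (2 / 3 - 3000000 * B.sigma)) ^ 2
        * (2 * coef (F.h 1 p) m ^ 2 + 2 * (sigmaLoss B.sigma t * F.data m) ^ 2) := fun p => by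
      have h2 := rpow_bound ht B.sigma_nonneg (by norm_num) (by norm_num)
        (add_nonneg (abs_nonneg _) (mul_nonneg hL (F.data_nonneg m)))
        (((hF.mode_isSol m).abs_h_le hσ ht p.1 p.2).trans_eq (mul_right_comm _ _ _)) le_rfl
      have h3 := sq_le_sq' (by linarith [abs_nonneg ((F.mode m).h t p.1 p.2)]) h2
      rw [sq_abs, mul_pow] at h3
      refine h3.trans (mul_le_mul_of_nonneg_left ?_ (sq_nonneg _))
      have h4 := sq_abs (coef (F.h 1 p) m)
      change (|coef (F.h 1 p) m| + _) ^ 2 ≤ _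
      nlinarith [sq_nonneg (|coef (F.h 1 p) m| - sigmaLoss B.sigma t * F.data m)]
    have h5 : coefSq (F.h t) m ≤ (100000 * t ^ (2 / 3 - 3000000 * B.sigma)) ^ 2
        * (2 * coefSq (F.h 1) m + 9 * (2 * (sigmaLoss B.sigma t * F.data m) ^ 2)) := by
      refine (Finset.sum_le_sum fun p _ => h1 p).trans_eq ?_
      rw [← Finset.mul_sum, Finset.sum_add_distrib, ← Finset.mul_sum]
      simp [coefSq]
    refine h5.trans ?_
    rw [hxdef]
    have h6 := coefSq_nonneg (F.h 1) m
    have h7 := sq_nonneg (sigmaLoss B.sigma t * F.data m)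
    have h8 := sq_nonneg (t ^ (2 / 3 - 3000000 * B.sigma))
    nlinarith [mul_nonneg h8 h6, mul_nonneg h8 h7]
  refine (sobolev_mono 0 h).trans ?_
  rw [sobolev_sq_mul 0 hx0]
  refine mul_le_mul_right ((sobolev_add_le 0 _ _).trans (add_le_add_right ?_ _)) _
  rw [sobolev_sq_mul 0 hL]
  exact mul_le_mul_right ((sobolev_mono_order (Nat.zero_le N) _).trans (hF.sobolev_data_le N)) _

end Estimates

end IsLinearizedSolution

/-! ### Estimates for K, the scalar field and the time derivatives. -/

namespace IsLinearizedSolution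

variable {B : Kasner} {F : Fields} {t : ℝ} {N : ℕ}

/-- The right-hand side of the evolution equation for `K`. -/
def evolK (B : Kasner) (F : Fields) (t : ℝ) (p : Fin 3 × Fin 3) : Distr :=
  -(t • ∑ a, B.ginv t p.1 a • D a (D p.2 (toDistr (F.n t))))
    - (t⁻¹ * B.bigK p.1 p.2) • toDistr (F.n t) + t • ric B F t p.1 p.2

theorem isFourier_evolK (hh : ∀ p, MemLp (F.h t p) 2 volume) (hn : MemLp (F.n t) 2 volume)
    (B : Kasner) (p : Fin 3 × Fin 3) : IsFourier (evolK B F t p) :=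
  have hn := IsFourier.toDistr hn
  (((IsFourier.sum _ fun a => ((hn.D _).D a).smul _).smul t).neg.sub (hn.smul _)).add
      ((isFourier_ric hh B _ _).smul t)

section Estimates

variable (hF : IsLinearizedSolution B F) (hσ : B.sigma ≤ 1 / 10000000) (ht : t ∈ Ioc (0 : ℝ) 1)

include ht in
theorem rpow_le_one (hσ : B.sigma ≤ 1 / 10000000) {c : ℝ} (hc : c ≤ 3000000) :
    t ^ (2 / 3 - c * B.sigma) ≤ 1 :=
  Real.rpow_le_one ht.1.le ht.2 (by nlinarith [B.sigma_nonneg])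

include ht in
theorem inv_mul_bound {y b : ℝ} {m : Idx} (hb : b ≤ 100000)
    (h : |y| ≤ b * (Mode.len m.freq * F.data m) * t ^ (2 / 3 - 1000000 * B.sigma)) :
    |t⁻¹ * y| ≤ 100000 * t ^ (-(1 / 3) - 3000000 * B.sigma) * (m.wgt ^ 1 * F.data m) := by
  rw [abs_mul, abs_of_pos (inv_pos.2 ht.1)]
  refine rpow_bound ht B.sigma_nonneg hb (by norm_num : (1000000 : ℝ) ≤ _)
    (mul_nonneg (Mode.len_nonneg _) (F.data_nonneg m)) ?_ (len_mul_data_le F m)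
  have h2 : t ^ (-(1 / 3) - 1000000 * B.sigma) = t⁻¹ * t ^ (2 / 3 - 1000000 * B.sigma) := by
    rw [← Real.rpow_neg_one, ← Real.rpow_add ht.1]
    congr 1
    ring
  rw [h2]
  exact (mul_le_mul_of_nonneg_left h (inv_nonneg.2 ht.1.le)).trans_eq (by ring)

/-- The rate of convergence evaluated at t = 1 compares the limit with the data. -/
theorem asymp_abs_K_le (m : Idx) (i j : Fin 3) :
    |(hF.asymp hσ m).K i j| ≤ 4401 * (m.wgt ^ 1 * F.data m) := by
  have h1 := (hF.asymp hσ m).abs_sub_K_le 1 one_mem i j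
  rw [Real.one_rpow, mul_one, abs_sub_comm] at h1
  have h2 := (F.mode m).abs_K_one_le m.freq i j
  have h3 := abs_sub_abs_le_abs_sub ((hF.asymp hσ m).K i j) ((F.mode m).K 1 i j)
  have h4 := len_mul_data_le F m
  have h5 := data_le F m
  change _ ≤ 4400 * (_ * F.data m) at h1
  change _ ≤ F.data m at h2
  linarith

theorem asymp_abs_Ψ_le (m : Idx) : |(hF.asymp hσ m).Ψ| ≤ 4801 * (m.wgt ^ 1 * F.data m) := by
  have h1 := (hF.asymp hσ m).abs_sub_Ψ_le 1 one_mem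
  rw [Real.one_rpow, mul_one, abs_sub_comm] at h1
  have h2 := (F.mode m).abs_f_one_le m.freq
  have h3 := abs_sub_abs_le_abs_sub ((hF.asymp hσ m).Ψ) ((F.mode m).f 1)
  have h4 := len_mul_data_le F m
  have h5 := data_le F m
  change _ ≤ 4800 * (_ * F.data m) at h1
  change _ ≤ F.data m at h2
  linarith

/-- Two weights are needed: one for the gradient and one from the derivative lost in the
convergence. Only |ξ||φ(1)| is controlled by the data, so φ has to be estimated after multiplication
by |ξ|. -/
theorem len_mul_asymp_φ_le (m : Idx) (ht : t ∈ Ioc (0 : ℝ) 1) :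
    Mode.len m.freq * |(F.mode m).φ t - Real.log t * (hF.asymp hσ m).Ψ|
      ≤ 20001 * (m.wgt ^ 2 * F.data m) := by
  have h1 := mul_le_mul_of_nonneg_left ((hF.asymp hσ m).abs_φ_sub_le t ht)
    (Mode.len_nonneg m.freq)
  have h2 := (F.mode m).len_mul_φ_one_le m.freq
  change _ ≤ F.data m at h2
  change _ ≤ _ * (_ + 20000 * (_ * F.data m)) at h1
  have h3 := F.data_nonneg m
  have h4 := Mode.len_nonneg m.freq
  rw [Idx.wgt]
  nlinarith [mul_nonneg h4 h3]

include hF hσ ht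

theorem frameNorm_K_le (N : ℕ) :
    frameNorm N (F.K t) ≤ ENNReal.ofReal 57600000 * highNorm F (N + 1) 1 := by
  refine hF.frameNorm_le (k := 1) (c := 100000) rfl (by norm_num) (by simp) (by norm_num)
    (by norm_num) (hF.int_K t ht) fun p m => ?_
  have hzd := mul_nonneg (Mode.len_nonneg m.freq) (F.data_nonneg m)
  have h1 := ((hF.asymp hσ m).abs_sub_K_le t ht p.1 p.2).trans
    (mul_le_of_le_one_right (by exact mul_nonneg (by norm_num) hzd)
      (rpow_le_one ht hσ (by norm_num)))
  have h2 := hF.asymp_abs_K_le hσ m p.1 p.2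
  have h3 := abs_sub_abs_le_abs_sub ((F.mode m).K t p.1 p.2) ((hF.asymp hσ m).K p.1 p.2)
  have h4 := len_mul_data_le F m
  change _ ≤ 4400 * (_ * F.data m) at h1
  change |(F.mode m).K t p.1 p.2| ≤ _
  linarith

theorem scalarNorm_f_le (N : ℕ) : scalarNorm N (fun x => t * F.dtφ t x)
    ≤ ENNReal.ofReal 57600000 * highNorm F (N + 1) 1 := by
  refine hF.frameNorm_le (k := 1) (c := 100000) rfl (by norm_num) (by simp) (by norm_num)
    (by norm_num) (fun _ => (hF.int_dtφ t ht).const_mul t) fun p m => ?_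
  have hzd := mul_nonneg (Mode.len_nonneg m.freq) (F.data_nonneg m)
  have h1 := ((hF.asymp hσ m).abs_sub_Ψ_le t ht).trans
    (mul_le_of_le_one_right (by exact mul_nonneg (by norm_num) hzd)
      (rpow_le_one ht hσ (by norm_num)))
  have h2 := hF.asymp_abs_Ψ_le hσ m
  have h3 := abs_sub_abs_le_abs_sub ((F.mode m).f t) ((hF.asymp hσ m).Ψ)
  have h4 := len_mul_data_le F m
  change _ ≤ 4800 * (_ * F.data m) at h1
  rw [coef_const_mul]
  change |(F.mode m).f t| ≤ _
  linarith

theorem scalarGradNorm_φ_le (N : ℕ) : scalarGradNorm N (F.φ t)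
    ≤ ENNReal.ofReal (57600000 * (1 + |Real.log t|)) * highNorm F (N + 2) 1 := by
  refine hF.gradNorm_le (k := 2) (c := 100000 * (1 + |Real.log t|)) rfl le_rfl (by simp)
    (by positivity) (by linarith) (fun _ => hF.int_φ t ht) fun _ m => ?_
  have h1 := hF.len_mul_asymp_φ_le hσ m ht
  have h2 := mul_le_mul_of_nonneg_left (hF.asymp_abs_Ψ_le hσ m) (Mode.len_nonneg m.freq)
  have h3 : |(F.mode m).φ t| ≤ |(F.mode m).φ t - Real.log t * (hF.asymp hσ m).Ψ|
      + |Real.log t| * |(hF.asymp hσ m).Ψ| := by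
    rw [← abs_mul]
    linarith [abs_sub_abs_le_abs_sub ((F.mode m).φ t) (Real.log t * (hF.asymp hσ m).Ψ)]
  have h4 := mul_le_mul_of_nonneg_left h3 (Mode.len_nonneg m.freq)
  have h5 : Mode.len m.freq * (4801 * (m.wgt ^ 1 * F.data m)) ≤ 4801 * (m.wgt ^ 2 * F.data m) := by
    have h6 : 0 ≤ m.wgt ^ 1 * F.data m := (F.data_nonneg m).trans (data_le F m)
    have h7 : Mode.len m.freq ≤ m.wgt := by rw [Idx.wgt]; linarith
    nlinarith [mul_le_mul_of_nonneg_right h7 h6]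
  have h8 := mul_le_mul_of_nonneg_left (h2.trans h5) (abs_nonneg (Real.log t))
  have h9 : 0 ≤ m.wgt ^ 2 * F.data m := mul_nonneg (sq_nonneg _) (F.data_nonneg m)
  change _ * |(F.mode m).φ t| ≤ _
  nlinarith [mul_nonneg (abs_nonneg (Real.log t)) h9]

variable (h0 : frameNorm 0 (F.h 1) < ⊤) (h1 : highNorm F (N + 2) 1 < ⊤)

-- `highNorm` contains ∂h but not h, hence the separate assumption on h(1).
include h0 h1 in
theorem memLp_h (p : Fin 3 × Fin 3) : MemLp (F.h t p) 2 volume := by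
  refine memLp_of_summable_coefSq (hF.int_h t ht) (summable_of_sobolev (M := 0)
    (coefSq_nonneg _) ?_) p
  rw [← frameNorm_eq (hF.int_h t ht)]
  refine ((hF.frameNorm_h_le hσ ht (N + 2)).trans_lt (ENNReal.mul_lt_top ENNReal.ofReal_lt_top
    (ENNReal.add_lt_top.2 ⟨h0, ENNReal.mul_lt_top ENNReal.ofReal_lt_top h1⟩))).ne

include h1 in
theorem memLp_n : MemLp (F.n t) 2 volume := by
  refine memLp_of_summable_coefSq (T := fun _ : Unit => F.n t) (fun _ => hF.int_n t ht)
    (summable_of_sobolev (M := N + 2) (coefSq_nonneg _) ?_) ()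
  rw [← frameNorm_eq (fun _ => hF.int_n t ht)]
  exact ((hF.scalarNorm_n_le hσ ht (N + 2)).trans_lt
    (ENNReal.mul_lt_top ENNReal.ofReal_lt_top h1)).ne

-- For φ no assumption on φ(1) itself is needed: an integrable function with square integrable
-- gradient is square integrable on the torus.
include h1 in
theorem memLp_φ : MemLp (F.φ t) 2 volume := by
  refine memLp_of_summable_coefSq (T := fun _ : Unit => F.φ t) (fun _ => hF.int_φ t ht)
    (summable_of_summable_freq (coefSq_nonneg _) (summable_of_sobolev (M := N)
      (fun m => mul_nonneg (Finset.sum_nonneg fun _ _ => sq_nonneg _) (coefSq_nonneg _ m)) ?_)) ()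
  rw [← gradNorm_eq (fun _ => hF.int_φ t ht)]
  exact ((hF.scalarGradNorm_φ_le hσ ht N).trans_lt
    (ENNReal.mul_lt_top ENNReal.ofReal_lt_top h1)).ne

include h0 h1 in
theorem timeDerivNorm_K_le : timeDerivNorm (N + 1) F.K t
    ≤ ENNReal.ofReal (57600000 * t ^ (-(1 / 3) - 3000000 * B.sigma)) * highNorm F (N + 2) 1 := by
  have hx := Real.rpow_nonneg ht.1.le (-(1 / 3) - 3000000 * B.sigma)
  refine (timeDerivNorm_le (isFourier_evolK (hF.memLp_h hσ ht h0 h1) (hF.memLp_n hσ ht h1) B)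
    (fun p => hF.evol_K t ht p.1 p.2) (N + 1)).trans ?_
  refine hF.sobolev_le (k := 1) (c := 100000 * t ^ (-(1 / 3) - 3000000 * B.sigma)) rfl (by norm_num)
    (by simp) (by positivity) (by linarith) fun p m => ?_
  rw [evolK, hF.evol_K_trig ht]
  exact inv_mul_bound ht (by norm_num) ((hF.mode_isSol m).abs_rhsK_le hσ ht p.1 p.2)

include h1 in
theorem timeDerivNorm_wave_le :
    timeDerivNorm (N + 1) (fun s (_ : Unit) x => s * F.dtφ s x - B.A * F.n s x) t
    ≤ ENNReal.ofReal (57600000 * t ^ (-(1 / 3) - 3000000 * B.sigma)) * highNorm F (N + 2) 1 := by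
  have hn := IsFourier.toDistr (hF.memLp_n hσ ht h1)
  have hx := Real.rpow_nonneg ht.1.le (-(1 / 3) - 3000000 * B.sigma)
  refine (timeDerivNorm_le (v := fun _ => t • lap B t (toDistr (F.φ t))
        - (B.A * t⁻¹) • toDistr (F.n t))
    (fun p => ((isFourier_lap (hF.memLp_φ hσ ht h1) B t).smul t).sub (hn.smul _))
    (fun p ψ hψ => ?_) (N + 1)).trans ?_
  · have h : ∀ s ∈ Ioc (0 : ℝ) 1, toDistr (fun x => s * F.dtφ s x - B.A * F.n s x) ψ
        = (s • toDistr (F.dtφ s) - B.A • toDistr (F.n s)) ψ := fun s hs => by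
      have h2 := (hψ.integrable_mul (hF.int_dtφ s hs)).const_mul s
      have h3 := (hψ.integrable_mul (hF.int_n s hs)).const_mul B.A
      simp only [toDistr, Pi.sub_apply, Pi.smul_apply, smul_eq_mul, ← integral_const_mul, sub_mul,
        mul_assoc]
      exact integral_sub h2 h3
    exact (hF.wave t ht ψ hψ).congr h (h t ht)
  refine hF.sobolev_le (k := 1) (c := 100000 * t ^ (-(1 / 3) - 3000000 * B.sigma)) rfl (by norm_num)
    (by simp) (by positivity) (by linarith) fun p m => ?_
  rw [wave_trig B F ht]
  exact inv_mul_bound ht (by norm_num) ((hF.mode_isSol m).abs_rhsg_le hσ ht)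

end Estimates

end IsLinearizedSolution

/-! ### The limiting fields -/

open Classical in
/-- The function with Fourier coefficients `a`, if there is one. -/
def synth (a : Idx → ℝ) : T3 → ℝ :=
  if h : ∃ f : T3 → ℝ, MemLp f 2 volume ∧ ∀ m, coef f m = a m then h.choose else 0

theorem synth_spec {a : Idx → ℝ} (ha : Summable fun m => a m ^ 2)
    (h1 : ∀ k, a (-k, false) = a (k, false)) (h2 : ∀ k, a (-k, true) = -a (k, true)) :
    MemLp (synth a) 2 volume ∧ ∀ m, coef (synth a) m = a m := by
  have h := exists_memLp_coef_eq ha h1 h2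
  rw [synth, dif_pos h]
  exact h.choose_spec

namespace IsLinearizedSolution

variable {B : Kasner} {F : Fields} {t : ℝ} {N : ℕ}

theorem tendsto_unique_neg {u v : ℝ → ℝ} {a b : ℝ} (hu : Tendsto u (𝓝[>] 0) (𝓝 a))
    (hv : Tendsto v (𝓝[>] 0) (𝓝 b)) (h : ∀ t, u t = -v t) : a = -b :=
  tendsto_nhds_unique (hu.congr h) hv.neg

section Limits

variable (hF : IsLinearizedSolution B F) (hσ : B.sigma ≤ 1 / 10000000)

/-- The asymptotic data are chosen separately for each index; uniqueness of limits transfers the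
parity of the coefficients to them, as synthesis requires. -/
theorem asymp_K_neg_false (k : Fin 3 → ℤ) (i j : Fin 3) :
    (hF.asymp hσ (-k, false)).K i j = (hF.asymp hσ (k, false)).K i j :=
  tendsto_nhds_unique (((hF.asymp hσ (-k, false)).tendsto_K i j).congr fun _ => coef_neg_false _ k)
    ((hF.asymp hσ (k, false)).tendsto_K i j)

theorem asymp_K_neg_true (k : Fin 3 → ℤ) (i j : Fin 3) :
    (hF.asymp hσ (-k, true)).K i j = -(hF.asymp hσ (k, true)).K i j :=
  tendsto_unique_neg ((hF.asymp hσ (-k, true)).tendsto_K i j)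
    ((hF.asymp hσ (k, true)).tendsto_K i j) fun _ => coef_neg_true _ k

theorem asymp_h_neg_false (k : Fin 3 → ℤ) (i j : Fin 3) :
    (hF.asymp hσ (-k, false)).h i j = (hF.asymp hσ (k, false)).h i j :=
  tendsto_nhds_unique (((hF.asymp hσ (-k, false)).tendsto_h i j).congr fun t => by
    rw [asymp_K_neg_false]
    simp only [Fields.mode, coef_neg_false]) ((hF.asymp hσ (k, false)).tendsto_h i j)

theorem asymp_h_neg_true (k : Fin 3 → ℤ) (i j : Fin 3) :
    (hF.asymp hσ (-k, true)).h i j = -(hF.asymp hσ (k, true)).h i j :=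
  tendsto_unique_neg ((hF.asymp hσ (-k, true)).tendsto_h i j)
    ((hF.asymp hσ (k, true)).tendsto_h i j) fun t => by
    rw [asymp_K_neg_true]
    simp only [Fields.mode, coef_neg_true]
    ring

theorem asymp_Ψ_neg_false (k : Fin 3 → ℤ) :
    (hF.asymp hσ (-k, false)).Ψ = (hF.asymp hσ (k, false)).Ψ :=
  tendsto_nhds_unique ((hF.asymp hσ (-k, false)).tendsto_Ψ.congr fun t => by
    simp only [Fields.mode, coef_neg_false]) (hF.asymp hσ (k, false)).tendsto_Ψ

theorem asymp_Ψ_neg_true (k : Fin 3 → ℤ) :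
    (hF.asymp hσ (-k, true)).Ψ = -(hF.asymp hσ (k, true)).Ψ :=
  tendsto_unique_neg (hF.asymp hσ (-k, true)).tendsto_Ψ (hF.asymp hσ (k, true)).tendsto_Ψ
    fun t => by
    simp only [Fields.mode, coef_neg_true]
    ring

theorem asymp_abs_sub_h_le (m : Idx) (p : Fin 3 × Fin 3) :
    |(hF.asymp hσ m).h p.1 p.2 - coef (F.h 1 p) m| ≤ 36000 * (m.wgt ^ 1 * F.data m) := by
  have h1 := (hF.asymp hσ m).abs_sub_h_le 1 one_mem p.1 p.2
  rw [Real.one_rpow, Real.one_rpow, metricCorrection_one, mul_one, zero_mul, add_zero, one_mul,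
    abs_sub_comm] at h1
  exact h1.trans (mul_le_mul_of_nonneg_left (len_mul_data_le F m) (by norm_num))

include hF in
theorem summable_of_abs_le (h1 : highNorm F (N + 2) 1 < ⊤) {a : Idx → ℝ} {c : ℝ} (hc : 0 ≤ c)
    (h : ∀ m, |a m| ≤ c * (m.wgt ^ 1 * F.data m)) : Summable fun m => a m ^ 2 := by
  have h2 := (hF.sobolev_le (a := fun _ : Unit => a) (M := N + 1) (k := 1) rfl (by norm_num)
    (by simp) hc le_rfl fun _ => h).trans_lt (ENNReal.mul_lt_top ENNReal.ofReal_lt_top h1)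
  simpa using summable_of_sobolev (fun m => Finset.sum_nonneg fun _ _ => sq_nonneg _) h2.ne

theorem summable_asymp_h (h0 : frameNorm 0 (F.h 1) < ⊤) (h1 : highNorm F (N + 2) 1 < ⊤)
    (p : Fin 3 × Fin 3) : Summable fun m => (hF.asymp hσ m).h p.1 p.2 ^ 2 := by
  have h2 := summable_coef_sq (hF.memLp_h hσ one_mem h0 h1 p)
  have h3 := hF.summable_of_abs_le h1 (by norm_num) (hF.asymp_abs_sub_h_le hσ · p)
  refine ((h2.add h3).mul_left 2).of_nonneg_of_le (fun _ => sq_nonneg _) fun m => ?_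
  nlinarith [sq_nonneg (2 * coef (F.h 1 p) m - (hF.asymp hσ m).h p.1 p.2)]

/-- The limiting metric. -/
def hBang (p : Fin 3 × Fin 3) : T3 → ℝ := synth fun m => (hF.asymp hσ m).h p.1 p.2

/-- The limiting second fundamental form. -/
def KBang (p : Fin 3 × Fin 3) : T3 → ℝ :=
  if p = (2, 2) then fun x => -synth (fun m => (hF.asymp hσ m).K 0 0) x
    - synth (fun m => (hF.asymp hσ m).K 1 1) x
  else synth fun m => (hF.asymp hσ m).K p.1 p.2

/-- The limit of `t ∂_t φ`. -/
def ΨBang : T3 → ℝ := synth fun m => (hF.asymp hσ m).Ψ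

/-- Since `synth` depends only on the coefficients, equality of coefficients gives equality at every
point. -/
theorem hBang_symm (i j : Fin 3) : hF.hBang hσ (i, j) = hF.hBang hσ (j, i) := by
  simp only [hBang, (hF.asymp hσ _).symm_h i j]

/-- The component (2,2) is defined as minus the sum of the other diagonal ones, so that the trace
vanishes at every point and not only almost everywhere. -/
theorem sum_KBang (x : T3) : ∑ a, hF.KBang hσ (a, a) x = 0 := by
  simp [KBang, Fin.sum_univ_three]

variable (h0 : frameNorm 0 (F.h 1) < ⊤) (h1 : highNorm F (N + 2) 1 < ⊤)

include h0 h1 in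
theorem hBang_spec (p : Fin 3 × Fin 3) : MemLp (hF.hBang hσ p) 2 volume ∧
    ∀ m, coef (hF.hBang hσ p) m = (hF.asymp hσ m).h p.1 p.2 :=
  synth_spec (hF.summable_asymp_h hσ h0 h1 p) (fun _ => hF.asymp_h_neg_false hσ _ _ _)
    fun _ => hF.asymp_h_neg_true hσ _ _ _

include h1

theorem synth_K_spec (i j : Fin 3) : MemLp (synth fun m => (hF.asymp hσ m).K i j) 2 volume ∧
    ∀ m, coef (synth fun m => (hF.asymp hσ m).K i j) m = (hF.asymp hσ m).K i j :=
  synth_spec (hF.summable_of_abs_le h1 (by norm_num) (hF.asymp_abs_K_le hσ · i j))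
    (fun _ => hF.asymp_K_neg_false hσ _ _ _) fun _ => hF.asymp_K_neg_true hσ _ _ _

theorem KBang_spec (p : Fin 3 × Fin 3) : MemLp (hF.KBang hσ p) 2 volume ∧
    ∀ m, coef (hF.KBang hσ p) m = (hF.asymp hσ m).K p.1 p.2 := by
  by_cases hp : p = (2, 2)
  · obtain ⟨h2, h3⟩ := hF.synth_K_spec hσ h1 0 0
    obtain ⟨h4, h5⟩ := hF.synth_K_spec hσ h1 1 1
    simp only [KBang, if_pos hp]
    refine ⟨h2.neg.sub h4, fun m => ?_⟩
    have h6 := (hF.asymp hσ m).tr_K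
    simp only [← neg_one_mul (synth (fun m => (hF.asymp hσ m).K 0 0) _)]
    rw [coef_sub ((integrable_of_memLp_two h2).const_mul (-1)) (integrable_of_memLp_two h4),
      coef_const_mul, h3, h5, hp]
    rw [Fin.sum_univ_three] at h6
    linarith
  · simp only [KBang, if_neg hp]
    exact hF.synth_K_spec hσ h1 p.1 p.2

theorem ΨBang_spec : MemLp (hF.ΨBang hσ) 2 volume ∧
    ∀ m, coef (hF.ΨBang hσ) m = (hF.asymp hσ m).Ψ :=
  synth_spec (hF.summable_of_abs_le h1 (by norm_num) (hF.asymp_abs_Ψ_le hσ))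
    (fun _ => hF.asymp_Ψ_neg_false hσ _) fun _ => hF.asymp_Ψ_neg_true hσ _

/-! #### Convergence -/

include h0 in
theorem frameNorm_hBang_sub_le : frameNorm (N + 1) (fun p x => hF.hBang hσ p x - F.h 1 p x)
    ≤ ENNReal.ofReal 57600000 * highNorm F (N + 2) 1 := by
  have hi := fun p => integrable_of_memLp_two (hF.hBang_spec hσ h0 h1 p).1
  refine hF.frameNorm_le (k := 1) (c := 36000) rfl (by norm_num) (by simp) (by norm_num)
    (by norm_num) (fun p => (hi p).sub (hF.int_h 1 one_mem p)) fun p m => ?_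
  rw [coef_sub (hi p) (hF.int_h 1 one_mem p), (hF.hBang_spec hσ h0 h1 p).2]
  exact hF.asymp_abs_sub_h_le hσ m p

-- The L² bound on h(1) together with its gradient bound puts h(1) in the Sobolev space; the
-- difference to the limit is already controlled.
include h0 in
theorem frameNorm_hBang_lt_top : frameNorm (N + 1) (hF.hBang hσ) < ⊤ := by
  have hi := fun p => integrable_of_memLp_two (hF.hBang_spec hσ h0 h1 p).1
  have hi1 := hF.int_h 1 one_mem
  have h2 : sobolev (N + 1) (coefSq (F.h 1)) ≠ ⊤ := by
    refine sobolev_succ_ne_top (coefSq_nonneg _) ?_ ?_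
    · rw [← frameNorm_eq hi1]
      exact h0.ne
    · refine ((sobolev_mono_order N.le_succ _).trans_lt ?_).ne
      rw [← gradNorm_eq hi1]
      exact (hF.gradNorm_h_le hσ one_mem (N + 1)).trans_lt
        (ENNReal.mul_lt_top ENNReal.ofReal_lt_top h1)
  have h3 := (hF.frameNorm_hBang_sub_le hσ h0 h1).trans_lt
    (ENNReal.mul_lt_top ENNReal.ofReal_lt_top h1)
  rw [frameNorm_eq (T := fun p x => hF.hBang hσ p x - F.h 1 p x) fun p => (hi p).sub (hi1 p)] at h3
  rw [frameNorm_eq hi]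
  refine (sobolev_mono _ (w' := fun m => 2 ^ 2 * (coefSq (F.h 1) m
    + coefSq (fun p x => hF.hBang hσ p x - F.h 1 p x) m)) fun m => ?_).trans_lt ?_
  · rw [coefSq, coefSq, coefSq, ← Finset.sum_add_distrib, Finset.mul_sum]
    refine Finset.sum_le_sum fun p _ => ?_
    rw [coef_sub (hi p) (hi1 p)]
    nlinarith [sq_nonneg (2 * coef (F.h 1 p) m - coef (hF.hBang hσ p) m),
      sq_nonneg (coef (F.h 1 p) m), sq_nonneg (coef (hF.hBang hσ p) m - coef (F.h 1 p) m)]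
  · rw [sobolev_sq_mul _ (by norm_num)]
    exact ENNReal.mul_lt_top ENNReal.ofReal_lt_top ((sobolev_add_le _ _ _).trans_lt
      (ENNReal.add_lt_top.2 ⟨h2.lt_top, h3⟩))

theorem frameNorm_KBang_lt_top : frameNorm (N + 1) (hF.KBang hσ) < ⊤ :=
  (hF.frameNorm_le (k := 1) (c := 4401) rfl (by norm_num) (by simp) (by norm_num) le_rfl
    (fun p => integrable_of_memLp_two (hF.KBang_spec hσ h1 p).1) fun p m => by
      rw [(hF.KBang_spec hσ h1 p).2]
      exact hF.asymp_abs_K_le hσ m p.1 p.2).trans_lt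
    (ENNReal.mul_lt_top ENNReal.ofReal_lt_top h1)

theorem scalarNorm_ΨBang_lt_top : scalarNorm (N + 1) (hF.ΨBang hσ) < ⊤ :=
  (hF.frameNorm_le (k := 1) (c := 4801) rfl (by norm_num) (by simp) (by norm_num) le_rfl
    (fun _ => integrable_of_memLp_two (hF.ΨBang_spec hσ h1).1) fun _ m => by
      rw [(hF.ΨBang_spec hσ h1).2]
      exact hF.asymp_abs_Ψ_le hσ m).trans_lt
    (ENNReal.mul_lt_top ENNReal.ofReal_lt_top h1)

include h0 in
theorem scalarNorm_h_sub_le (ht : t ∈ Ioc (0 : ℝ) 1) (i j : Fin 3) : scalarNorm (N + 1)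
      (fun x => t ^ (-(2 * B.q j)) * F.h t (i, j) x
        + metricCorrection B t i j * hF.KBang hσ (i, j) x - hF.hBang hσ (i, j) x)
    ≤ ENNReal.ofReal (57600000 * t ^ (2 / 3 - 3000000 * B.sigma)) * highNorm F (N + 2) 1 := by
  have hx := Real.rpow_nonneg ht.1.le (2 / 3 - 3000000 * B.sigma)
  have i1 := (hF.int_h t ht (i, j)).const_mul (t ^ (-(2 * B.q j)))
  have i2 := (integrable_of_memLp_two (hF.KBang_spec hσ h1 (i, j)).1).const_mul
    (metricCorrection B t i j)
  have i3 := integrable_of_memLp_two (hF.hBang_spec hσ h0 h1 (i, j)).1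
  refine hF.frameNorm_le (k := 1) (c := 100000 * t ^ (2 / 3 - 3000000 * B.sigma)) rfl (by norm_num)
    (by simp) (by positivity) (by linarith) (fun _ => (i1.add i2).sub i3) fun _ m => ?_
  have i4 : Integrable fun x => t ^ (-(2 * B.q j)) * F.h t (i, j) x
      + metricCorrection B t i j * hF.KBang hσ (i, j) x := i1.add i2
  rw [coef_sub i4 i3, coef_add i1 i2, coef_const_mul, coef_const_mul,
    (hF.KBang_spec hσ h1 (i, j)).2, (hF.hBang_spec hσ h0 h1 (i, j)).2]
  exact rpow_bound ht B.sigma_nonneg (by norm_num) (by norm_num)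
    (mul_nonneg (Mode.len_nonneg _) (F.data_nonneg m)) ((hF.asymp hσ m).abs_sub_h_le t ht i j)
    (len_mul_data_le F m)

theorem frameNorm_K_sub_le (ht : t ∈ Ioc (0 : ℝ) 1) :
    frameNorm (N + 1) (fun p x => F.K t p x - hF.KBang hσ p x)
    ≤ ENNReal.ofReal (57600000 * t ^ (2 / 3 - 3000000 * B.sigma)) * highNorm F (N + 2) 1 := by
  have hx := Real.rpow_nonneg ht.1.le (2 / 3 - 3000000 * B.sigma)
  have hi := fun p => integrable_of_memLp_two (hF.KBang_spec hσ h1 p).1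
  refine hF.frameNorm_le (k := 1) (c := 100000 * t ^ (2 / 3 - 3000000 * B.sigma)) rfl (by norm_num)
    (by simp) (by positivity) (by linarith) (fun p => (hF.int_K t ht p).sub (hi p)) fun p m => ?_
  rw [coef_sub (hF.int_K t ht p) (hi p), (hF.KBang_spec hσ h1 p).2]
  exact rpow_bound ht B.sigma_nonneg (by norm_num) (by norm_num)
    (mul_nonneg (Mode.len_nonneg _) (F.data_nonneg m))
    ((hF.asymp hσ m).abs_sub_K_le t ht p.1 p.2) (len_mul_data_le F m)

theorem scalarNorm_f_sub_le (ht : t ∈ Ioc (0 : ℝ) 1) :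
    scalarNorm (N + 1) (fun x => t * F.dtφ t x - hF.ΨBang hσ x)
    ≤ ENNReal.ofReal (57600000 * t ^ (2 / 3 - 3000000 * B.sigma)) * highNorm F (N + 2) 1 := by
  have hx := Real.rpow_nonneg ht.1.le (2 / 3 - 3000000 * B.sigma)
  have i1 := (hF.int_dtφ t ht).const_mul t
  have i2 := integrable_of_memLp_two (hF.ΨBang_spec hσ h1).1
  refine hF.frameNorm_le (k := 1) (c := 100000 * t ^ (2 / 3 - 3000000 * B.sigma)) rfl (by norm_num)
    (by simp) (by positivity) (by linarith) (fun _ => i1.sub i2) fun p m => ?_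
  rw [coef_sub i1 i2, coef_const_mul, (hF.ΨBang_spec hσ h1).2]
  exact rpow_bound ht B.sigma_nonneg (by norm_num) (by norm_num)
    (mul_nonneg (Mode.len_nonneg _) (F.data_nonneg m))
    ((hF.asymp hσ m).abs_sub_Ψ_le t ht) (len_mul_data_le F m)

theorem scalarGradNorm_φ_sub_le (ht : t ∈ Ioc (0 : ℝ) 1) :
    scalarGradNorm N (fun x => F.φ t x - Real.log t * hF.ΨBang hσ x)
    ≤ ENNReal.ofReal 57600000 * highNorm F (N + 2) 1 := by
  have i1 := hF.int_φ t ht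
  have i2 := (integrable_of_memLp_two (hF.ΨBang_spec hσ h1).1).const_mul (Real.log t)
  refine hF.gradNorm_le (k := 2) (c := 20001) rfl le_rfl (by simp) (by norm_num) (by norm_num)
    (fun _ => i1.sub i2) fun _ m => ?_
  rw [coef_sub i1 i2, coef_const_mul, (hF.ΨBang_spec hσ h1).2]
  exact hF.len_mul_asymp_φ_le hσ m ht

theorem frameNorm_KBang_sub_le : frameNorm (N + 1) (fun p x => hF.KBang hσ p x - F.K 1 p x)
    ≤ ENNReal.ofReal 57600000 * highNorm F (N + 2) 1 := by
  have hi := fun p => integrable_of_memLp_two (hF.KBang_spec hσ h1 p).1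
  refine hF.frameNorm_le (k := 1) (c := 4400) rfl (by norm_num) (by simp) (by norm_num)
    (by norm_num) (fun p => (hi p).sub (hF.int_K 1 one_mem p)) fun p m => ?_
  rw [coef_sub (hi p) (hF.int_K 1 one_mem p), (hF.KBang_spec hσ h1 p).2, abs_sub_comm]
  have h2 := (hF.asymp hσ m).abs_sub_K_le 1 one_mem p.1 p.2
  rw [Real.one_rpow, mul_one] at h2
  exact h2.trans (mul_le_mul_of_nonneg_left (len_mul_data_le F m) (by norm_num))

theorem scalarNorm_ΨBang_sub_le : scalarNorm (N + 1) (fun x => hF.ΨBang hσ x - F.dtφ 1 x)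
    ≤ ENNReal.ofReal 57600000 * highNorm F (N + 2) 1 := by
  have hi := integrable_of_memLp_two (hF.ΨBang_spec hσ h1).1
  refine hF.frameNorm_le (k := 1) (c := 4800) rfl (by norm_num) (by simp) (by norm_num)
    (by norm_num) (fun _ => hi.sub (hF.int_dtφ 1 one_mem)) fun _ m => ?_
  rw [coef_sub hi (hF.int_dtφ 1 one_mem), (hF.ΨBang_spec hσ h1).2, abs_sub_comm]
  have h2 := (hF.asymp hσ m).abs_sub_Ψ_le 1 one_mem
  rw [Real.one_rpow, mul_one] at h2
  simp only [Fields.mode, one_mul] at h2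
  exact h2.trans (mul_le_mul_of_nonneg_left (len_mul_data_le F m) (by norm_num))

end Limits

end IsLinearizedSolution

end KasnerLin

end

theorem theorem5p2 :
    ∃ C c σ₀ : ℝ, 0 < C ∧ 0 < c ∧ 0 < σ₀ ∧
      ∀ N : ℕ, 2 ≤ N → ∀ (B : KasnerLin.Kasner) (F : KasnerLin.Fields),
        B.sigma ≤ σ₀ →
        KasnerLin.IsLinearizedSolution B F →
        KasnerLin.frameNorm 0 (F.h 1) < ⊤ →
        KasnerLin.highNorm F N 1 < ⊤ →
        -- improved estimates below top order
        (∀ t ∈ Set.Ioc (0 : ℝ) 1,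
          KasnerLin.timeDerivNorm (N - 1) F.K t
              ≤ ENNReal.ofReal (C * t ^ (-(1 / 3) - c * B.sigma)) * KasnerLin.highNorm F N 1 ∧
          KasnerLin.frameNorm (N - 1) (F.K t)
              ≤ ENNReal.ofReal C * KasnerLin.highNorm F N 1 ∧
          KasnerLin.frameNorm 0 (F.h t)
              ≤ ENNReal.ofReal (C * t ^ (2 / 3 - c * B.sigma)) *
                (KasnerLin.frameNorm 0 (F.h 1)
                  + ENNReal.ofReal (KasnerLin.sigmaLoss B.sigma t) * KasnerLin.highNorm F N 1) ∧
          KasnerLin.gradNorm (N - 1) (F.h t)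
              ≤ ENNReal.ofReal (C * KasnerLin.sigmaLoss B.sigma t * t ^ (2 / 3 - c * B.sigma)) *
                KasnerLin.highNorm F N 1 ∧
          KasnerLin.timeDerivNorm (N - 1)
              (fun s (_ : Unit) x => s * F.dtφ s x - B.A * F.n s x) t
              ≤ ENNReal.ofReal (C * t ^ (-(1 / 3) - c * B.sigma)) * KasnerLin.highNorm F N 1 ∧
          KasnerLin.scalarNorm (N - 1) (fun x => t * F.dtφ t x)
              ≤ ENNReal.ofReal C * KasnerLin.highNorm F N 1 ∧
          KasnerLin.scalarGradNorm (N - 2) (F.φ t)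
              ≤ ENNReal.ofReal (C * (1 + |Real.log t|)) * KasnerLin.highNorm F N 1 ∧
          KasnerLin.scalarNorm N (F.n t)
              ≤ ENNReal.ofReal (C * t ^ (-(c * B.sigma))) * KasnerLin.highNorm F N 1 ∧
          KasnerLin.scalarNorm (N - 1) (F.n t)
              ≤ ENNReal.ofReal (C * t ^ (2 / 3 - c * B.sigma)) * KasnerLin.highNorm F N 1 ∧
          KasnerLin.scalarNorm (N - 2) (F.n t)
              ≤ ENNReal.ofReal (C * KasnerLin.sigmaLoss B.sigma t * t ^ (4 / 3 - c * B.sigma)) *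
                KasnerLin.highNorm F N 1) ∧
        -- convergence
        ∃ (hB KB : Fin 3 × Fin 3 → KasnerLin.T3 → ℝ) (ΨB : KasnerLin.T3 → ℝ),
          (∀ i j x, hB (i, j) x = hB (j, i) x) ∧
          (∀ x, ∑ a, KB (a, a) x = 0) ∧
          KasnerLin.frameNorm (N - 1) hB < ⊤ ∧
          KasnerLin.frameNorm (N - 1) KB < ⊤ ∧
          KasnerLin.scalarNorm (N - 1) ΨB < ⊤ ∧
          (∀ t ∈ Set.Ioc (0 : ℝ) 1,
            (∀ i j, KasnerLin.scalarNorm (N - 1)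
                (fun x => t ^ (-(2 * B.q j)) * F.h t (i, j) x
                  + KasnerLin.metricCorrection B t i j * KB (i, j) x - hB (i, j) x)
                ≤ ENNReal.ofReal (C * t ^ (2 / 3 - c * B.sigma)) * KasnerLin.highNorm F N 1) ∧
            KasnerLin.frameNorm (N - 1) (fun p x => F.K t p x - KB p x)
                ≤ ENNReal.ofReal (C * t ^ (2 / 3 - c * B.sigma)) * KasnerLin.highNorm F N 1 ∧
            KasnerLin.scalarNorm (N - 1) (fun x => t * F.dtφ t x - ΨB x)
                ≤ ENNReal.ofReal (C * t ^ (2 / 3 - c * B.sigma)) * KasnerLin.highNorm F N 1 ∧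
            KasnerLin.scalarGradNorm (N - 2) (fun x => F.φ t x - Real.log t * ΨB x)
                ≤ ENNReal.ofReal C * KasnerLin.highNorm F N 1) ∧
          KasnerLin.frameNorm (N - 1) (fun p x => hB p x - F.h 1 p x)
              ≤ ENNReal.ofReal C * KasnerLin.highNorm F N 1 ∧
          KasnerLin.frameNorm (N - 1) (fun p x => KB p x - F.K 1 p x)
              ≤ ENNReal.ofReal C * KasnerLin.highNorm F N 1 ∧
          KasnerLin.scalarNorm (N - 1) (fun x => ΨB x - F.dtφ 1 x)
              ≤ ENNReal.ofReal C * KasnerLin.highNorm F N 1 := by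
  -- C = 576 · 100000 combines the passage from modes to norms with the common mode constant. With σ
  -- ≤ 10⁻⁷ the loss 3000000σ is at most 0.3, so the exponents 2/3 - cσ stay positive.
  refine ⟨57600000, 3000000, 1 / 10000000, by norm_num, by norm_num, by norm_num, ?_⟩
  intro N hN B F hσ hF h0 h1
  -- Writing N = M + 2 makes the truncated subtractions N - 1 and N - 2 exact.
  obtain ⟨M, rfl⟩ := Nat.exists_eq_add_of_le' hN
  rw [show M + 2 - 1 = M + 1 from rfl, show M + 2 - 2 = M from rfl]
  refine ⟨fun t ht => ⟨hF.timeDerivNorm_K_le hσ ht h0 h1, hF.frameNorm_K_le hσ ht (M + 1),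
    hF.frameNorm_h_le hσ ht (M + 2), hF.gradNorm_h_le hσ ht (M + 1),
    hF.timeDerivNorm_wave_le hσ ht h1, hF.scalarNorm_f_le hσ ht (M + 1),
    hF.scalarGradNorm_φ_le hσ ht M, hF.scalarNorm_n_le hσ ht (M + 2),
    hF.scalarNorm_n_le_one hσ ht (M + 1), hF.scalarNorm_n_le_two hσ ht M⟩, ?_⟩
  exact ⟨hF.hBang hσ, hF.KBang hσ, hF.ΨBang hσ, fun i j x => congrFun (hF.hBang_symm hσ i j) x,
    hF.sum_KBang hσ, hF.frameNorm_hBang_lt_top hσ h0 h1, hF.frameNorm_KBang_lt_top hσ h1,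
    hF.scalarNorm_ΨBang_lt_top hσ h1, fun t ht => ⟨hF.scalarNorm_h_sub_le hσ h0 h1 ht,
      hF.frameNorm_K_sub_le hσ h1 ht, hF.scalarNorm_f_sub_le hσ h1 ht,
      hF.scalarGradNorm_φ_sub_le hσ h1 ht⟩, hF.frameNorm_hBang_sub_le hσ h0 h1,
    hF.frameNorm_KBang_sub_le hσ h1, hF.scalarNorm_ΨBang_sub_le hσ h1⟩
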